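/- Theorem (Phase transition). Let $\mathbf a_1,\mathbf a_2=(\sqrt3/2,\pm1/2)$, let $\mathbb L_2=\mathbf a_1\mathbb Z\oplus\mathbf a_2\mathbb Z$, and consider the honeycomb lattice $\Lambda$, which has two Carbon atoms per unit cell of $\mathbb L_2$. For real hopping amplitudes $\mathbf t=(t_{xy})$ on the bonds of $\Lambda$, let $T(\mathbf t)$ be the operator on $\ell^2(\Lambda)$ whose coefficients are $t_{xy}$ if $x,y$ are nearest neighbours and $0$ otherwise. If $\mathbf t$ is periodic with respect to a sublattice of $\mathbb L_2$ with $N$ atoms per unit cell and Brillouin zone $B$, then $T(\mathbf t)$ is, in Fourier space, multiplication by $N\times N$ matrices $T(\mathbf k)$, $\mathbf k\in B$, and $\underline{\mathrm{Tr}}\,|T(\mathbf t)|:=\frac1N\frac1{|B|}\int_B\mathrm{Tr}\sqrt{T(\mathbf k)^2}\,d\mathbf k$. For a rigidity $\mu>0$ and an $L$-periodic configuration $\mathbf t$ (that is, $t_{xy}$ is invariant under translations by $L\mathbf a_1$ and $L\mathbf a_2$), the energy per Carbon atom is $$\mathcal E_L(\mathbf t)=-\underline{\mathrm{Tr}}\,|T(\mathbf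 t)|+\frac\mu2\cdot\frac1{2L^2}\sum_{\langle x,y\rangle}(t_{xy}-1)^2 ,$$ the sum being over the $3L^2$ bonds of an $L\times L$ supercell. For $(t,u,v)\in\mathbb R^3$, label the bonds of $\Lambda$ by $t,u,v$ so that each atom has one bond of each label and the bonds of any two labels form disjoint hexagons (this labelling is periodic with respect to $\mathbf b_1=2\mathbf a_1-\mathbf a_2$, $\mathbf b_2=2\mathbf a_2-\mathbf a_1$, with $6$ atoms per cell); let $T(t,u,v)$ be the corresponding operator, and $$\mathcal E(t,u,v)=-\underline{\mathrm{Tr}}\,|T(t,u,v)|+\frac\mu2\cdot\frac12\left((t-1)^2+(u-1)^2+(v-1)^2\right).$$ Let $t_*=t_*(\mu)=1+\frac{2}{3\mu}\frac1{|B_2|}\int_{B_2}|1+e^{i\mathbf k\cdot\mathbf a_1}+e^{i\mathbf k\cdot\mathbf a_2}|\,d\mathbf k$, where $B_2$ is the Brillouin zone of $\mathbb L_2$. There are constants $0<\mu_c\le\mu_c'<\infty$ such that: (i) For all $0<\mu<\mu_c$, $\mathcal E$ has a minimizer on $\mathbb R^3$, and every minimizer satisfies $t=u<v$ up to a permutation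 of $(t,u,v)$; in particular it is strictly Kekulé distorted. Moreover, for every minimizer, $0\notin\sigma(T(t,u,v))$ (the Hamiltonian is gapped). (ii) For all $\mu\ge\mu_c'$, the unique minimizer of $\mathcal E$ on $\mathbb R^3$ is $(t_*,t_*,t_*)$, and $0\in\sigma(T(t_*,t_*,t_*))$ (the Hamiltonian is gapless). Moreover, for every integer $L\ge1$, the configuration with all amplitudes equal to $t_*$ is the unique minimizer of $\mathcal E_L$ among all $L$-periodic configurations ($\mu_c'$ does not depend on $L$). -/

import Mathlib

open Set MeasureTheory

noncomputable section

namespace Graphene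

/-! ### The honeycomb lattice

In the basis `a₁, a₂` of the triangular lattice, the sites of the honeycomb lattice are two copies
of `ℤ × ℤ`: `Sum.inl R` and `Sum.inr R` are the two Carbon atoms of the unit cell at
`R.1 a₁ + R.2 a₂`. Each site has three nearest neighbours, one for each bond direction. -/

/-- Sites of the honeycomb lattice (two sublattices). -/
abbrev Site : Type := (ℤ × ℤ) ⊕ (ℤ × ℤ)

/-- The bond in direction `i` joins `Sum.inl R` and `Sum.inr (R - dir i)`. -/
def dir (i : Fin 3) : ℤ × ℤ := ![(0, 0), (1, 0), (0, 1)] i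

/-- The nearest neighbour of a site in the bond direction `i`. -/
def nbr (i : Fin 3) : Site → Site
  | Sum.inl R => Sum.inr (R - dir i)
  | Sum.inr R => Sum.inl (R + dir i)

/-- Translation of the honeycomb lattice by the vector `R` of the triangular lattice. -/
def siteShift (R : ℤ × ℤ) : Site → Site := Sum.map (· + R) (· + R)

/-- A hopping configuration: `τ R i` is the amplitude of the bond in direction `i` that starts at
the site `Sum.inl R`. Every bond of the honeycomb lattice occurs exactly once. -/
abbrev Config : Type := ℤ × ℤ → Fin 3 → ℝ

/-- The amplitude of the bond in direction `i` at a given site. -/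
def amp (τ : Config) (i : Fin 3) : Site → ℝ
  | Sum.inl R => τ R i
  | Sum.inr R => τ (R + dir i) i

/-- The coefficient `T_{xy}` of the tight-binding operator: the amplitude of the bond `xy` if `x`
and `y` are nearest neighbours, and `0` otherwise. -/
def hop (τ : Config) (x y : Site) : ℝ :=
  ∑ i : Fin 3, if nbr i x = y then amp τ i x else 0

/-! ### The tight-binding operator on `ℓ²` of the honeycomb lattice -/

/-- The Hilbert space `ℓ²` of the honeycomb lattice. -/
abbrev Ell2 : Type := lp (fun _ : Site => ℂ) 2

theorem nbr_nbr (i : Fin 3) (x : Site) : nbr i (nbr i x) = x := by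
  rcases x with R | R <;> simp [nbr]

theorem sum_hop_term_le {a : Site → ℝ} {C : ℝ} (ha : ∀ x, |a x| ≤ C) (i : Fin 3) (f : Ell2)
    (s : Finset Site) :
    ∑ x ∈ s, ‖(a x : ℂ) * f (nbr i x)‖ ^ (2 : ENNReal).toReal
      ≤ (C * ‖f‖) ^ (2 : ENNReal).toReal := by
  have hC : 0 ≤ C := (abs_nonneg _).trans (ha (Sum.inl 0))
  have hinj : Function.Injective (nbr i) := fun x y h => by
    rw [← nbr_nbr i x, h, nbr_nbr]
  have h2 : (0 : ℝ) < (2 : ENNReal).toReal := by norm_num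
  have h1 := lp.sum_rpow_le_norm_rpow h2 f (s.image (nbr i))
  rw [Finset.sum_image (fun x _ y _ h => hinj h)] at h1
  rw [Real.mul_rpow hC (norm_nonneg _)]
  refine le_trans ?_ (mul_le_mul_of_nonneg_left h1 (Real.rpow_nonneg hC _))
  rw [Finset.mul_sum]
  refine Finset.sum_le_sum fun x _ => ?_
  rw [norm_mul, Real.mul_rpow (norm_nonneg _) (norm_nonneg _)]
  refine mul_le_mul_of_nonneg_right ?_ (Real.rpow_nonneg (norm_nonneg _) _)
  refine Real.rpow_le_rpow (norm_nonneg _) ?_ h2.le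
  simpa using ha x

theorem abs_amp_le {τ : Config} {C : ℝ} (hC : ∀ R i, |τ R i| ≤ C) (i : Fin 3) (x : Site) :
    |amp τ i x| ≤ C := by
  rcases x with R | R <;> exact hC _ _

theorem memlp_hop_term {a : Site → ℝ} (ha : ∃ C, ∀ x, |a x| ≤ C) (i : Fin 3) (f : Ell2) :
    Memℓp (fun x => (a x : ℂ) * f (nbr i x)) 2 := by
  obtain ⟨C, hC⟩ := ha
  exact memℓp_gen' (sum_hop_term_le hC i f)

/-- The part `(S f) x = a x * f (nbr i x)` of the hopping operator that uses only the bonds in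
direction `i`. -/
def hopTerm (a : Site → ℝ) (ha : ∃ C, ∀ x, |a x| ≤ C) (i : Fin 3) : Ell2 →L[ℂ] Ell2 :=
  LinearMap.mkContinuousOfExistsBound
    { toFun := fun f => ⟨fun x => (a x : ℂ) * f (nbr i x), memlp_hop_term ha i f⟩
      map_add' := fun f g => by
        ext x
        simp only [lp.coeFn_add, Pi.add_apply, mul_add]
      map_smul' := fun c f => by
        ext x
        simp [mul_left_comm] }
    (by
      obtain ⟨C, hC⟩ := ha
      refine ⟨C, fun f => ?_⟩
      have h0 : 0 ≤ C := (abs_nonneg _).trans (hC (Sum.inl 0))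
      exact lp.norm_le_of_forall_sum_le (by norm_num) (mul_nonneg h0 (norm_nonneg _))
        (sum_hop_term_le hC i f))

/-- The tight-binding operator `T(τ)` of a bounded configuration, as a bounded operator on `ℓ²`:
`(T f) x = ∑ i, (amplitude of the bond i at x) * f (neighbour i of x)`. -/
def hoppingOperator (τ : Config) (hτ : ∃ C, ∀ R i, |τ R i| ≤ C) : Ell2 →L[ℂ] Ell2 :=
  ∑ i : Fin 3, hopTerm (amp τ i) (hτ.imp fun _ hC => abs_amp_le hC i) i

theorem hoppingOperator_apply (τ : Config) (hτ : ∃ C, ∀ R i, |τ R i| ≤ C) (f : Ell2) (x : Site) :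
    hoppingOperator τ hτ f x = ∑ i : Fin 3, (amp τ i x : ℂ) * f (nbr i x) := by
  simp only [hoppingOperator, Fin.sum_univ_three]
  rfl

/-! ### Fourier fibres and the trace per Carbon atom

Let `τ` be periodic with respect to the lattice `ℤ c₁ ⊕ ℤ c₂`, and let `p : ι → Site` enumerate one
site of each class modulo this lattice. In Fourier space, `T(τ)` acts as multiplication by an
`ι × ι` matrix. A quasi-momentum `k` of the Brillouin zone is given by its coordinates
`θ = (k · c₁, k · c₂) ∈ [0, 2π]²`. -/

/-- The Fourier matrix `T(k)`, where `k · c₁ = θ.1` and `k · c₂ = θ.2`: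
`T(k)_{xy} = ∑_R T_{x, y + R} e^{i k · R}`, the sum being over the vectors `R = m c₁ + n c₂` of the
period lattice (only finitely many terms are nonzero). -/
def fibre {ι : Type} (c₁ c₂ : ℤ × ℤ) (p : ι → Site) (τ : Config) (θ : ℝ × ℝ) : Matrix ι ι ℂ :=
  Matrix.of fun x y => ∑' r : ℤ × ℤ,
    (hop τ (p x) (siteShift (r.1 • c₁ + r.2 • c₂) (p y)) : ℂ) *
      Complex.exp (Complex.I * (r.1 * θ.1 + r.2 * θ.2))

/-- `|M| = √(M²)` for a Hermitian matrix `M`. -/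
def matAbs {ι : Type} [Fintype ι] [DecidableEq ι] (M : Matrix ι ι ℂ) : Matrix ι ι ℂ :=
  cfc Real.sqrt (M ^ 2)

/-- The Brillouin zone in the coordinates `(k · c₁, k · c₂)`. -/
def brillouin : Set (ℝ × ℝ) := Icc 0 (2 * Real.pi) ×ˢ Icc 0 (2 * Real.pi)

/-- The trace per Carbon atom of `|T(τ)|`: the average over the Brillouin zone of the trace of
`|T(k)|`, divided by the number of atoms in the unit cell of the period lattice. -/
def traceAbs {ι : Type} [Fintype ι] [DecidableEq ι] (c₁ c₂ : ℤ × ℤ) (p : ι → Site)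
    (τ : Config) : ℝ :=
  (1 / (Fintype.card ι : ℝ)) *
    ⨍ θ in brillouin, (matAbs (fibre c₁ c₂ p τ θ)).trace.re

/-! ### `L`-periodic configurations -/

/-- Periodicity with respect to an `L × L` supercell of unit cells. -/
def IsPeriodic (L : ℕ) (τ : Config) : Prop :=
  ∀ R : ℤ × ℤ, τ (R + ((L : ℤ), 0)) = τ R ∧ τ (R + (0, (L : ℤ))) = τ R

/-- The lattice vector of the `j`-th unit cell of the `L × L` supercell. -/
def cellVec {L : ℕ} (j : Fin L × Fin L) : ℤ × ℤ := ((j.1 : ℕ), (j.2 : ℕ))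

/-- The `2 L²` atoms of the `L × L` supercell. -/
def superCell (L : ℕ) : (Fin L × Fin L) ⊕ (Fin L × Fin L) → Site := Sum.map cellVec cellVec

/-- The energy per Carbon atom of an `L`-periodic configuration, with rigidity `μ`. -/
def energy (μ : ℝ) (L : ℕ) (τ : Config) : ℝ :=
  - traceAbs ((L : ℤ), 0) (0, (L : ℤ)) (superCell L) τ
    + μ / 2 * (1 / (2 * (L : ℝ) ^ 2)) *
      ∑ j : Fin L × Fin L, ∑ i : Fin 3, (τ (cellVec j) i - 1) ^ 2

/-! ### Configurations with three amplitudes `t, u, v`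

A triple is `w : Fin 3 → ℝ`, with `t = w 0`, `u = w 1`, `v = w 2`. -/

/-- The label of the bond in direction `i` at the cell `R`: at every site there is one bond of each
label, and the bonds of any two labels form disjoint hexagons. -/
def bondLabel (R : ℤ × ℤ) (i : Fin 3) : Fin 3 :=
  if (R.2 - R.1 - (i : ℕ)) % 3 = 0 then 0 else if (R.2 - R.1 - (i : ℕ)) % 3 = 1 then 1 else 2

/-- The configuration with the amplitudes `t, u, v = w 0, w 1, w 2`. It is periodic with respect to
`b₁ = 2 a₁ - a₂` and `b₂ = 2 a₂ - a₁`. -/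
def kekule (w : Fin 3 → ℝ) : Config := fun R i => w (bondLabel R i)

theorem kekule_bounded (w : Fin 3 → ℝ) : ∃ C, ∀ R i, |kekule w R i| ≤ C :=
  ⟨∑ j, |w j|, fun R i =>
    Finset.single_le_sum (f := fun j => |w j|) (fun _ _ => abs_nonneg _)
      (Finset.mem_univ (bondLabel R i))⟩

/-- The six atoms, forming a hexagon, of the unit cell of the lattice `ℤ b₁ ⊕ ℤ b₂`. With them,
`fibre` is the matrix `[[0, A], [Aᴴ, 0]]` with
`A = !![t, v e^{-i k·b₁}, u; u, t, v e^{i k·(b₁+b₂)}; v e^{-i k·b₂}, u, t]`. -/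
def hexCell : Fin 3 ⊕ Fin 3 → Site :=
  Sum.map ![(0, 0), (1, 0), (1, -1)] ![(0, 0), (1, -1), (0, -1)]

/-- The operator `T(t, u, v)` on `ℓ²` of the honeycomb lattice. -/
def kekuleOperator (w : Fin 3 → ℝ) : Ell2 →L[ℂ] Ell2 :=
  hoppingOperator (kekule w) (kekule_bounded w)

/-- The energy per Carbon atom `ℰ(t, u, v)`, with rigidity `μ`. -/
def kekuleEnergy (μ : ℝ) (w : Fin 3 → ℝ) : ℝ :=
  - traceAbs (2, -1) (-1, 2) hexCell (kekule w)
    + μ / 2 * (1 / 2) * ((w 0 - 1) ^ 2 + (w 1 - 1) ^ 2 + (w 2 - 1) ^ 2)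

/-- The optimal amplitude among the pristine configurations,
`t_* = 1 + 2 / (3 μ) ⨍ |1 + e^{i k·a₁} + e^{i k·a₂}| dk`. -/
def tStar (μ : ℝ) : ℝ :=
  1 + 2 / (3 * μ) * ⨍ θ in brillouin,
    ‖1 + Complex.exp (Complex.I * θ.1) + Complex.exp (Complex.I * θ.2)‖

end Graphene

end

noncomputable section

namespace Graphene

/-! ### Periodic functions on the torus -/

/-- Functions of two angles. -/
def TorusPeriodic {E : Type*} (G : ℝ × ℝ → E) : Prop :=
  ∀ (k : ℝ × ℝ) (m n : ℤ), G (k.1 + m * (2 * Real.pi), k.2 + n * (2 * Real.pi)) = G k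

instance twoPi_pos_fact : Fact (0 < 2 * Real.pi) := ⟨Real.two_pi_pos⟩

/-- The covering map of the torus. -/
def toTorus (k : ℝ × ℝ) : AddCircle (2 * Real.pi) × AddCircle (2 * Real.pi) := (k.1, k.2)

/-- A measurable section of the covering map. -/
def torusRep (z : AddCircle (2 * Real.pi) × AddCircle (2 * Real.pi)) : ℝ × ℝ :=
  (AddCircle.equivIoc (2 * Real.pi) 0 z.1, AddCircle.equivIoc (2 * Real.pi) 0 z.2)

theorem measurable_torusRep : Measurable torusRep := by
  have h := (AddCircle.measurableEquivIoc (2 * Real.pi) 0).measurable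
  exact (measurable_subtype_coe.comp (h.comp measurable_fst)).prodMk
    (measurable_subtype_coe.comp (h.comp measurable_snd))

theorem exists_int_torusRep (x : ℝ) :
    ∃ n : ℤ, ((AddCircle.equivIoc (2 * Real.pi) 0 (x : AddCircle (2 * Real.pi)) : Ioc _ _) : ℝ) =
      x + n * (2 * Real.pi) := by
  have h : (((AddCircle.equivIoc (2 * Real.pi) 0 (x : AddCircle (2 * Real.pi)) : Ioc _ _) : ℝ) :
      AddCircle (2 * Real.pi)) = x := (AddCircle.equivIoc (2 * Real.pi) 0).symm_apply_apply _
  rw [← sub_eq_zero, ← AddCircle.coe_sub, AddCircle.coe_eq_zero_iff] at h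
  obtain ⟨n, hn⟩ := h
  refine ⟨n, ?_⟩
  rw [zsmul_eq_mul] at hn
  linarith

theorem TorusPeriodic.comp_rep {E : Type*} {G : ℝ × ℝ → E} (hG : TorusPeriodic G) (k : ℝ × ℝ) :
    G (torusRep (toTorus k)) = G k := by
  obtain ⟨m, hm⟩ := exists_int_torusRep k.1
  obtain ⟨n, hn⟩ := exists_int_torusRep k.2
  rw [← hG k m n, ← hm, ← hn]
  rfl

theorem measurePreserving_toTorus :
    MeasurePreserving toTorus (volume.restrict brillouin) volume := by
  have h := AddCircle.measurePreserving_mk (2 * Real.pi) 0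
  have h2 := h.prod h
  have : (volume.restrict brillouin : Measure (ℝ × ℝ)) =
      (volume.restrict (Ioc 0 (0 + 2 * Real.pi))).prod
        (volume.restrict (Ioc 0 (0 + 2 * Real.pi))) := by
    rw [zero_add, ← Measure.restrict_congr_set Ioc_ae_eq_Icc.symm, Measure.prod_restrict]
    rfl
  rw [this]
  exact h2

/-- The endomorphism of the torus given by an integer matrix. -/
def torusHom (a b c d : ℤ) :
    (AddCircle (2 * Real.pi) × AddCircle (2 * Real.pi)) →+
      (AddCircle (2 * Real.pi) × AddCircle (2 * Real.pi)) where
  toFun z := (a • z.1 + b • z.2, c • z.1 + d • z.2)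
  map_zero' := by simp
  map_add' x y := by
    ext <;> simp [add_add_add_comm]

theorem toTorus_surjective : Function.Surjective toTorus := by
  rintro ⟨x, y⟩
  induction x using QuotientAddGroup.induction_on
  induction y using QuotientAddGroup.induction_on
  exact ⟨(_, _), rfl⟩

theorem torusHom_toTorus (a b c d : ℤ) (k : ℝ × ℝ) :
    torusHom a b c d (toTorus k) = toTorus (a * k.1 + b * k.2, c * k.1 + d * k.2) := by
  simp [torusHom, toTorus]

theorem torusHom_surjective {a b c d : ℤ} (h : a * d - b * c ≠ 0) :
    Function.Surjective (torusHom a b c d) := by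
  intro z
  obtain ⟨k, rfl⟩ := toTorus_surjective z
  have h' : (a * d - b * c : ℝ) ≠ 0 := by exact_mod_cast h
  refine ⟨toTorus ((d * k.1 - b * k.2) / (a * d - b * c), (a * k.2 - c * k.1) / (a * d - b * c)), ?_⟩
  rw [torusHom_toTorus]
  congr 1
  ext
  · simp only
    rw [← mul_div_assoc, ← mul_div_assoc, ← add_div, div_eq_iff h']
    ring
  · simp only
    rw [← mul_div_assoc, ← mul_div_assoc, ← add_div, div_eq_iff h']
    ring

instance torus_isAddHaarMeasure :
    (volume : Measure (AddCircle (2 * Real.pi) × AddCircle (2 * Real.pi))).IsAddHaarMeasure :=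
  Measure.prod.instIsAddHaarMeasure volume volume

theorem measurePreserving_torusHom {a b c d : ℤ} (h : a * d - b * c ≠ 0) :
    MeasurePreserving (torusHom a b c d) volume volume := by
  refine AddMonoidHom.measurePreserving ?_ (torusHom_surjective h) rfl
  simp only [torusHom, AddMonoidHom.coe_mk, ZeroHom.coe_mk]
  fun_prop

/-- Averages over the Brillouin zone are invariant under integer linear maps and translations. -/
theorem setIntegral_brillouin_comp {E : Type*} [NormedAddCommGroup E] [NormedSpace ℝ E]
    [MeasurableSpace E] [BorelSpace E] [SecondCountableTopology E]
    {G : ℝ × ℝ → E} (hG : TorusPeriodic G) (hm : Measurable G) {a b c d : ℤ}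
    (h : a * d - b * c ≠ 0) (s : ℝ × ℝ) :
    ∫ k in brillouin, G (a * k.1 + b * k.2 + s.1, c * k.1 + d * k.2 + s.2) =
      ∫ k in brillouin, G k := by
  have hm' : Measurable (G ∘ torusRep) := hm.comp measurable_torusRep
  have h1 : ∀ f : ℝ × ℝ → ℝ × ℝ, ∀ Φ : AddCircle (2 * Real.pi) × AddCircle (2 * Real.pi) →
      AddCircle (2 * Real.pi) × AddCircle (2 * Real.pi), MeasurePreserving Φ volume volume →
      (∀ k, Φ (toTorus k) = toTorus (f k)) →
      ∫ k in brillouin, G (f k) = ∫ z, (G ∘ torusRep) z := by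
    intro f Φ hΦ hf
    have hc := hΦ.comp measurePreserving_toTorus
    rw [← hc.map_eq, integral_map hc.measurable.aemeasurable hm'.aestronglyMeasurable]
    refine integral_congr_ae (Filter.Eventually.of_forall fun k => ?_)
    simp only [Function.comp_apply, hf, hG.comp_rep]
  rw [h1 _ _ ((measurePreserving_add_right volume (toTorus s)).comp (measurePreserving_torusHom h)),
    ← h1 id id (MeasurePreserving.id _) fun _ => rfl]
  · rfl
  · intro k
    simp only [Function.comp_apply, torusHom_toTorus]
    rfl

theorem volume_brillouin : volume brillouin = ENNReal.ofReal ((2 * Real.pi) ^ 2) := by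
  rw [brillouin, Measure.volume_eq_prod, Measure.prod_prod, Real.volume_Icc, sub_zero,
    ← ENNReal.ofReal_mul Real.two_pi_pos.le, sq]

theorem isCompact_brillouin : IsCompact brillouin := isCompact_Icc.prod isCompact_Icc

end Graphene
end

noncomputable section

namespace Graphene

/-! ### The dispersion relation and the integrability of its inverse -/

/-- The normalized Lebesgue measure on the Brillouin zone. -/
def bz : Measure (ℝ × ℝ) :=
  ((volume.restrict brillouin : Measure (ℝ × ℝ)) univ)⁻¹ • volume.restrict brillouin

theorem average_brillouin {E : Type*} [NormedAddCommGroup E] [NormedSpace ℝ E] (G : ℝ × ℝ → E) :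
    ⨍ k in brillouin, G k = ∫ k, G k ∂bz := rfl

theorem restrict_brillouin_univ_ne_zero :
    (volume.restrict brillouin : Measure (ℝ × ℝ)) univ ≠ 0 := by
  rw [Measure.restrict_apply_univ, volume_brillouin]
  have := Real.pi_pos
  simp only [ne_eq, ENNReal.ofReal_eq_zero, not_le]
  positivity

theorem restrict_brillouin_univ_ne_top :
    (volume.restrict brillouin : Measure (ℝ × ℝ)) univ ≠ ⊤ := by
  rw [Measure.restrict_apply_univ, volume_brillouin]
  exact ENNReal.ofReal_ne_top

instance bz_isProbabilityMeasure : IsProbabilityMeasure bz := by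
  constructor
  rw [bz, Measure.smul_apply, smul_eq_mul]
  exact ENNReal.inv_mul_cancel restrict_brillouin_univ_ne_zero restrict_brillouin_univ_ne_top

theorem integral_bz {E : Type*} [NormedAddCommGroup E] [NormedSpace ℝ E] (G : ℝ × ℝ → E) :
    ∫ k, G k ∂bz =
      ((volume.restrict brillouin : Measure (ℝ × ℝ)) univ)⁻¹.toReal • ∫ k in brillouin, G k :=
  integral_smul_measure _ _

theorem integral_bz_comp {E : Type*} [NormedAddCommGroup E] [NormedSpace ℝ E]
    [MeasurableSpace E] [BorelSpace E] [SecondCountableTopology E]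
    {G : ℝ × ℝ → E} (hG : TorusPeriodic G) (hm : Measurable G) {a b c d : ℤ}
    (h : a * d - b * c ≠ 0) (s : ℝ × ℝ) :
    ∫ k, G (a * k.1 + b * k.2 + s.1, c * k.1 + d * k.2 + s.2) ∂bz = ∫ k, G k ∂bz := by
  rw [integral_bz, integral_bz, setIntegral_brillouin_comp hG hm h s]

theorem integrable_bz_iff {E : Type*} [NormedAddCommGroup E] {G : ℝ × ℝ → E} :
    Integrable G bz ↔ IntegrableOn G brillouin :=
  integrable_smul_measure (ENNReal.inv_ne_zero.2 restrict_brillouin_univ_ne_top)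
    (ENNReal.inv_ne_top.2 restrict_brillouin_univ_ne_zero)

theorem ae_bz_of_ae {P : ℝ × ℝ → Prop} (h : ∀ᵐ k ∂(volume.restrict brillouin), P k) :
    ∀ᵐ k ∂bz, P k :=
  Measure.ae_smul_measure h _

theorem _root_.Continuous.integrable_bz {E : Type*} [NormedAddCommGroup E] {G : ℝ × ℝ → E}
    (h : Continuous G) : Integrable G bz :=
  integrable_bz_iff.2 (h.continuousOn.integrableOn_compact isCompact_brillouin)

/-- The dispersion function `1 + e^{i k·a₁} + e^{i k·a₂}`. -/
def disp (k : ℝ × ℝ) : ℂ := 1 + Complex.exp (Complex.I * k.1) + Complex.exp (Complex.I * k.2)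

theorem continuous_disp : Continuous disp := by
  unfold disp
  fun_prop

theorem exp_I_add_int (x : ℝ) (n : ℤ) :
    Complex.exp (Complex.I * ((x + n * (2 * Real.pi) : ℝ) : ℂ)) =
      Complex.exp (Complex.I * x) := by
  push_cast
  rw [mul_add, show Complex.I * (n * (2 * (Real.pi : ℂ))) = n * (2 * Real.pi * Complex.I) by ring,
    Complex.exp_add, Complex.exp_int_mul_two_pi_mul_I, mul_one]

theorem torusPeriodic_disp : TorusPeriodic disp := fun k m n => by
  simp only [disp, exp_I_add_int]

theorem exp_I_mul_eq (x : ℝ) :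
    Complex.exp (Complex.I * x) = (Real.cos x : ℂ) + (Real.sin x : ℂ) * Complex.I := by
  rw [mul_comm, Complex.exp_mul_I, Complex.ofReal_cos, Complex.ofReal_sin]

theorem norm_disp_sq (k : ℝ × ℝ) :
    ‖disp k‖ ^ 2 = 3 + 2 * Real.cos k.1 + 2 * Real.cos k.2 + 2 * Real.cos (k.1 - k.2) := by
  rw [← Complex.normSq_eq_norm_sq, disp, exp_I_mul_eq, exp_I_mul_eq, Complex.normSq_apply]
  simp only [Complex.add_re, Complex.add_im, Complex.one_re, Complex.one_im, Complex.mul_re,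
    Complex.mul_im, Complex.ofReal_re, Complex.ofReal_im, Complex.I_re, Complex.I_im]
  rw [Real.cos_sub]
  nlinarith [Real.sin_sq_add_cos_sq k.1, Real.sin_sq_add_cos_sq k.2]

theorem abs_one_add_two_cos_le (a : ℝ) (z : ℂ) (hz : ‖z‖ = 1) :
    |1 + 2 * Real.cos a| ≤ 3 * ‖1 + Complex.exp (Complex.I * a) + z‖ := by
  set w : ℂ := 1 + Complex.exp (Complex.I * a) with hw
  have h1 : ‖w‖ ^ 2 = 2 + 2 * Real.cos a := by
    rw [← Complex.normSq_eq_norm_sq, hw, exp_I_mul_eq, Complex.normSq_apply]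
    simp only [Complex.add_re, Complex.add_im, Complex.one_re, Complex.one_im, Complex.mul_re,
      Complex.mul_im, Complex.ofReal_re, Complex.ofReal_im, Complex.I_re, Complex.I_im]
    nlinarith [Real.sin_sq_add_cos_sq a]
  have h2 : |‖w‖ - 1| ≤ ‖w + z‖ := by
    have := abs_norm_sub_norm_le w (-z)
    rwa [norm_neg, hz, sub_neg_eq_add] at this
  have h3 : ‖w‖ ≤ 2 := by
    nlinarith [Real.cos_le_one a, norm_nonneg w]
  have h4 : 1 + 2 * Real.cos a = (‖w‖ - 1) * (‖w‖ + 1) := by linarith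
  rw [h4, abs_mul, abs_of_nonneg (by positivity : 0 ≤ ‖w‖ + 1)]
  nlinarith [abs_nonneg (‖w‖ - 1), norm_nonneg w]

theorem abs_div_pi_le_abs_sin {x : ℝ} (hx : |x| ≤ 2 * Real.pi / 3) :
    |x| / Real.pi ≤ |Real.sin x| := by
  have hπ := Real.pi_pos
  have h1 : Real.sin x = 2 * Real.sin (x / 2) * Real.cos (x / 2) := by
    rw [← Real.sin_two_mul]; congr 1; ring
  have h2 : 2 / Real.pi * |x / 2| ≤ |Real.sin (x / 2)| := by
    apply Real.mul_abs_le_abs_sin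
    rw [abs_div, abs_two]
    linarith
  have h3 : 1 / 2 ≤ Real.cos (x / 2) := by
    rw [← Real.cos_abs, ← Real.cos_pi_div_three]
    apply Real.cos_le_cos_of_nonneg_of_le_pi (abs_nonneg _) (by linarith)
    rw [abs_div, abs_two]
    linarith
  rw [h1, abs_mul, abs_mul, abs_two, abs_of_nonneg (by linarith : 0 ≤ Real.cos (x / 2))]
  rw [abs_div, abs_two] at h2
  have h4 : 2 / Real.pi * (|x| / 2) = |x| / Real.pi := by ring
  rw [h4] at h2
  have : 0 ≤ |Real.sin (x / 2)| := abs_nonneg _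
  nlinarith

/-- The product of the distances to the two zeros of `1 + 2 cos a` in `[0, 2π]`. -/
def zeroDist (a : ℝ) : ℝ := |a - 2 * Real.pi / 3| * |a - 4 * Real.pi / 3|

theorem zeroDist_le {a : ℝ} (ha : a ∈ Icc 0 (2 * Real.pi)) :
    zeroDist a ≤ Real.pi ^ 2 * |1 + 2 * Real.cos a| := by
  have hπ := Real.pi_pos
  obtain ⟨h0, h1⟩ := ha
  have e : 1 + 2 * Real.cos a =
      4 * (Real.sin ((a - 2 * Real.pi / 3) / 2) * Real.sin ((a - 4 * Real.pi / 3) / 2)) := by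
    have h2 : Real.cos (2 * Real.pi / 3) = -1 / 2 := by
      rw [show 2 * Real.pi / 3 = Real.pi - Real.pi / 3 by ring, Real.cos_pi_sub,
        Real.cos_pi_div_three]
      norm_num
    have h3 : Real.sin ((a - 4 * Real.pi / 3) / 2) = - Real.sin ((a + 2 * Real.pi / 3) / 2) := by
      rw [← Real.sin_sub_pi]; congr 1; ring
    have h4 := Real.cos_sub_cos a (2 * Real.pi / 3)
    rw [h2] at h4
    rw [h3]
    linarith
  have s1 := abs_div_pi_le_abs_sin (x := (a - 2 * Real.pi / 3) / 2)
    (by rw [abs_le]; constructor <;> linarith)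
  have s2 := abs_div_pi_le_abs_sin (x := (a - 4 * Real.pi / 3) / 2)
    (by rw [abs_le]; constructor <;> linarith)
  rw [e, abs_mul, abs_mul, zeroDist]
  have := mul_le_mul s1 s2 (by positivity) (abs_nonneg _)
  rw [abs_div, abs_div, abs_two, abs_of_pos (by norm_num : (0 : ℝ) < 4)] at *
  calc _ = 4 * Real.pi ^ 2 * (|a - 2 * Real.pi / 3| / 2 / Real.pi *
        (|a - 4 * Real.pi / 3| / 2 / Real.pi)) := by field_simp; ring
    _ ≤ 4 * Real.pi ^ 2 * _ := mul_le_mul_of_nonneg_left this (by positivity)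
    _ = _ := by ring

theorem integrableOn_inv_sqrt_abs_sub (α : ℝ) :
    IntegrableOn (fun a : ℝ => (√|a - α|)⁻¹) (Icc 0 (2 * Real.pi)) := by
  have h0 : ∀ c : ℝ, IntervalIntegrable (fun a : ℝ => (√|a|)⁻¹) volume 0 c := by
    have hpos : ∀ c : ℝ, 0 ≤ c → IntervalIntegrable (fun a : ℝ => (√|a|)⁻¹) volume 0 c := by
      intro c hc
      have := intervalIntegral.intervalIntegrable_rpow' (a := 0) (b := c) (r := -(1 / 2))
        (by norm_num)
      refine this.congr ?_
      intro x hx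
      rw [uIoc_of_le hc] at hx
      simp only
      rw [abs_of_pos hx.1, Real.rpow_neg hx.1.le, Real.sqrt_eq_rpow]
    intro c
    rcases le_total 0 c with hc | hc
    · exact hpos c hc
    · have := (IntervalIntegrable.iff_comp_neg (by simp)).1 (hpos (-c) (by linarith))
      simpa using this
  have h1 : IntervalIntegrable (fun a : ℝ => (√|a|)⁻¹) volume (0 - α) (2 * Real.pi - α) :=
    (h0 _).symm.trans (h0 _)
  have h2 := h1.comp_sub_right α
  simp only [sub_add_cancel] at h2
  rwa [intervalIntegrable_iff_integrableOn_Icc_of_le Real.two_pi_pos.le] at h2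

theorem inv_sqrt_zeroDist_le (a : ℝ) : (√(zeroDist a))⁻¹ ≤
    (√(Real.pi / 3))⁻¹ * ((√|a - 2 * Real.pi / 3|)⁻¹ + (√|a - 4 * Real.pi / 3|)⁻¹) := by
  have hπ := Real.pi_pos
  rw [zeroDist, Real.sqrt_mul (abs_nonneg _), mul_inv]
  set x := |a - 2 * Real.pi / 3| with hx
  set y := |a - 4 * Real.pi / 3| with hy
  have hx0 : 0 ≤ (√x)⁻¹ := by positivity
  have hy0 : 0 ≤ (√y)⁻¹ := by positivity
  have hp0 : 0 ≤ (√(Real.pi / 3))⁻¹ := by positivity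
  have hpp : 0 < √(Real.pi / 3) := by positivity
  have hmax : Real.pi / 3 ≤ x ∨ Real.pi / 3 ≤ y := by
    by_contra! h
    have h1 := abs_lt.1 h.1
    have h2 := abs_lt.1 h.2
    linarith
  rcases hmax with h | h
  · have : (√x)⁻¹ ≤ (√(Real.pi / 3))⁻¹ := inv_anti₀ hpp (Real.sqrt_le_sqrt h)
    nlinarith
  · have : (√y)⁻¹ ≤ (√(Real.pi / 3))⁻¹ := inv_anti₀ hpp (Real.sqrt_le_sqrt h)
    nlinarith

theorem integrableOn_inv_sqrt_zeroDist :
    IntegrableOn (fun a : ℝ => (√(zeroDist a))⁻¹) (Icc 0 (2 * Real.pi)) := by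
  refine Integrable.mono' (((integrableOn_inv_sqrt_abs_sub (2 * Real.pi / 3)).add
    (integrableOn_inv_sqrt_abs_sub (4 * Real.pi / 3))).const_mul (√(Real.pi / 3))⁻¹) ?_ ?_
  · unfold zeroDist
    exact (by fun_prop : Measurable _).aestronglyMeasurable
  · refine Filter.Eventually.of_forall fun a => ?_
    rw [Real.norm_of_nonneg (by positivity)]
    exact inv_sqrt_zeroDist_le a

theorem ae_zeroDist_pos : ∀ᵐ k : ℝ × ℝ ∂(volume.restrict brillouin),
    0 < zeroDist k.1 ∧ 0 < zeroDist k.2 := by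
  have h1 : ∀ᵐ a : ℝ, 0 < zeroDist a := by
    have : ∀ᵐ a : ℝ, a ∉ ({2 * Real.pi / 3, 4 * Real.pi / 3} : Set ℝ) :=
      compl_mem_ae_iff.2 ((Set.toFinite _).measure_zero _)
    filter_upwards [this] with a ha
    simp only [mem_insert_iff, mem_singleton_iff, not_or] at ha
    have h1 := sub_ne_zero.2 ha.1
    have h2 := sub_ne_zero.2 ha.2
    unfold zeroDist
    positivity
  refine ae_restrict_of_ae ?_
  rw [Measure.volume_eq_prod]
  exact (Measure.quasiMeasurePreserving_fst.ae h1).and (Measure.quasiMeasurePreserving_snd.ae h1)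

theorem zeroDist_le_norm_disp {k : ℝ × ℝ} (hk : k ∈ brillouin) :
    zeroDist k.1 ≤ 3 * Real.pi ^ 2 * ‖disp k‖ ∧ zeroDist k.2 ≤ 3 * Real.pi ^ 2 * ‖disp k‖ := by
  have hn : ∀ x : ℝ, ‖Complex.exp (Complex.I * x)‖ = 1 := fun x => by
    rw [mul_comm]; exact Complex.norm_exp_ofReal_mul_I x
  have h1 := abs_one_add_two_cos_le k.1 _ (hn k.2)
  have h2 := abs_one_add_two_cos_le k.2 _ (hn k.1)
  rw [add_right_comm] at h2
  have hp : 0 < Real.pi ^ 2 := by positivity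
  exact ⟨(zeroDist_le hk.1).trans (by unfold disp; nlinarith),
    (zeroDist_le hk.2).trans (by unfold disp; nlinarith)⟩

theorem measurableSet_brillouin : MeasurableSet brillouin := isCompact_brillouin.measurableSet

theorem ae_norm_disp_pos : ∀ᵐ k ∂bz, 0 < ‖disp k‖ := by
  refine ae_bz_of_ae ?_
  filter_upwards [ae_zeroDist_pos, ae_restrict_mem measurableSet_brillouin] with k h1 h2
  have h3 := (zeroDist_le_norm_disp h2).1
  have hp : 0 < 3 * Real.pi ^ 2 := by positivity
  exact pos_of_mul_pos_right (h1.1.trans_le h3) hp.le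

theorem integrable_inv_norm_disp : Integrable (fun k => ‖disp k‖⁻¹) bz := by
  rw [integrable_bz_iff, IntegrableOn]
  have hq := integrableOn_inv_sqrt_zeroDist
  have hprod : Integrable (fun k : ℝ × ℝ => 3 * Real.pi ^ 2 *
      ((√(zeroDist k.1))⁻¹ * (√(zeroDist k.2))⁻¹)) (volume.restrict brillouin) := by
    refine Integrable.const_mul ?_ _
    rw [brillouin, Measure.volume_eq_prod, ← Measure.prod_restrict]
    exact hq.mul_prod hq
  refine hprod.mono' continuous_disp.norm.measurable.inv.aestronglyMeasurable ?_
  filter_upwards [ae_zeroDist_pos, ae_restrict_mem measurableSet_brillouin] with k h1 h2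
  obtain ⟨h3, h4⟩ := zeroDist_le_norm_disp h2
  have hp : 0 < 3 * Real.pi ^ 2 := by positivity
  have hf : 0 < ‖disp k‖ := pos_of_mul_pos_right (h1.1.trans_le h3) hp.le
  rw [norm_inv, norm_norm, ← mul_inv, ← div_eq_mul_inv, le_div_iff₀ (mul_pos
    (Real.sqrt_pos.2 h1.1) (Real.sqrt_pos.2 h1.2)), inv_mul_le_iff₀ hf, mul_comm ‖disp k‖]
  calc √(zeroDist k.1) * √(zeroDist k.2)
      ≤ √(3 * Real.pi ^ 2 * ‖disp k‖) * √(3 * Real.pi ^ 2 * ‖disp k‖) :=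
        mul_le_mul (Real.sqrt_le_sqrt h3) (Real.sqrt_le_sqrt h4) (Real.sqrt_nonneg _)
          (Real.sqrt_nonneg _)
    _ = _ := Real.mul_self_sqrt (by positivity)

/-- The average of `|1 + e^{i k·a₁} + e^{i k·a₂}|`. -/
def meanDisp : ℝ := ∫ k, ‖disp k‖ ∂bz

/-- The average of the inverse of `|1 + e^{i k·a₁} + e^{i k·a₂}|`. -/
def meanInvDisp : ℝ := ∫ k, ‖disp k‖⁻¹ ∂bz

/-- The average of `cos (k·a₁) / |1 + e^{i k·a₁} + e^{i k·a₂}|`. -/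
def meanCosDisp : ℝ := ∫ k : ℝ × ℝ, Real.cos k.1 * ‖disp k‖⁻¹ ∂bz

theorem integrable_cos_mul_inv {g : ℝ × ℝ → ℝ} (hg : Continuous g) :
    Integrable (fun k => Real.cos (g k) * ‖disp k‖⁻¹) bz := by
  refine integrable_inv_norm_disp.mono ?_ (Filter.Eventually.of_forall fun k => ?_)
  · exact (Measurable.mul (by fun_prop)
      continuous_disp.norm.measurable.inv).aestronglyMeasurable
  · rw [norm_mul]
    exact mul_le_of_le_one_left (norm_nonneg _) (Real.abs_cos_le_one _)

theorem abs_meanCosDisp_le : |meanCosDisp| ≤ meanInvDisp := by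
  refine (abs_integral_le_integral_abs).trans (integral_mono
    (integrable_cos_mul_inv continuous_fst).abs integrable_inv_norm_disp fun k => ?_)
  simp only [abs_mul]
  rw [abs_of_nonneg (a := ‖disp k‖⁻¹) (by positivity)]
  exact mul_le_of_le_one_left (by positivity) (Real.abs_cos_le_one _)

theorem torusPeriodic_cos_mul_inv :
    TorusPeriodic fun k : ℝ × ℝ => Real.cos k.1 * ‖disp k‖⁻¹ := fun k m n => by
  simp only [torusPeriodic_disp k m n, Real.cos_add_int_mul_two_pi]

theorem measurable_cos_mul_inv :
    Measurable fun k : ℝ × ℝ => Real.cos k.1 * ‖disp k‖⁻¹ :=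
  Measurable.mul (by fun_prop) continuous_disp.norm.measurable.inv

theorem integral_cos_snd : ∫ k : ℝ × ℝ, Real.cos k.2 * ‖disp k‖⁻¹ ∂bz = meanCosDisp := by
  rw [meanCosDisp, ← integral_bz_comp torusPeriodic_cos_mul_inv measurable_cos_mul_inv
    (a := 0) (b := 1) (c := 1) (d := 0) (by norm_num) 0]
  refine integral_congr_ae (Filter.Eventually.of_forall fun k => ?_)
  simp [disp, add_right_comm]

theorem integral_cos_sub :
    ∫ k : ℝ × ℝ, Real.cos (k.1 - k.2) * ‖disp k‖⁻¹ ∂bz = meanCosDisp := by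
  rw [meanCosDisp, ← integral_bz_comp torusPeriodic_cos_mul_inv measurable_cos_mul_inv
    (a := 1) (b := -1) (c := 0) (d := -1) (by norm_num) 0]
  refine integral_congr_ae (Filter.Eventually.of_forall fun k => ?_)
  have : ‖disp k‖ = ‖disp (k.1 - k.2, -k.2)‖ := by
    have e : disp k = Complex.exp (Complex.I * k.2) * disp (k.1 - k.2, -k.2) := by
      simp only [disp, mul_add, mul_one, ← Complex.exp_add]
      push_cast
      rw [show Complex.I * (k.2 : ℂ) + Complex.I * (k.1 - k.2) = Complex.I * k.1 by ring,
        show Complex.I * (k.2 : ℂ) + Complex.I * -k.2 = 0 by ring, Complex.exp_zero]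
      ring
    rw [e, norm_mul, mul_comm Complex.I, Complex.norm_exp_ofReal_mul_I, one_mul]
  simp [this, sub_eq_add_neg]

theorem meanDisp_eq : meanDisp = 3 * meanInvDisp + 6 * meanCosDisp := by
  have h1 : ∀ k : ℝ × ℝ, ‖disp k‖ = 3 * ‖disp k‖⁻¹ + 2 * (Real.cos k.1 * ‖disp k‖⁻¹) +
      2 * (Real.cos k.2 * ‖disp k‖⁻¹) + 2 * (Real.cos (k.1 - k.2) * ‖disp k‖⁻¹) := by
    intro k
    have h := norm_disp_sq k
    rcases eq_or_ne ‖disp k‖ 0 with h0 | h0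
    · simp [h0]
    · field_simp
      linarith
  have i1 := integrable_inv_norm_disp.const_mul 3
  have i2 := (integrable_cos_mul_inv continuous_fst).const_mul 2
  have i3 := (integrable_cos_mul_inv continuous_snd).const_mul 2
  have i4 := (integrable_cos_mul_inv (g := fun k => k.1 - k.2) (by fun_prop)).const_mul 2
  rw [meanDisp, integral_congr_ae (Filter.Eventually.of_forall h1), integral_add (by exact (i1.add i2).add i3) i4,
    integral_add (by exact i1.add i2) i3, integral_add i1 i2]
  simp only [integral_const_mul]
  rw [integral_cos_snd, integral_cos_sub, meanInvDisp, meanCosDisp]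
  ring

theorem meanDisp_pos : 0 < meanDisp := by
  rw [meanDisp, integral_pos_iff_support_of_nonneg (fun _ => norm_nonneg _)
    continuous_disp.norm.integrable_bz, pos_iff_ne_zero]
  intro h
  have h1 := measure_eq_zero_iff_ae_notMem.1 h
  obtain ⟨k, hk1, hk2⟩ := (h1.and ae_norm_disp_pos).exists
  exact hk1 hk2.ne'

theorem meanInvDisp_nonneg : 0 ≤ meanInvDisp := integral_nonneg fun _ => by positivity

theorem tStar_eq (μ : ℝ) : tStar μ = 1 + 2 / (3 * μ) * meanDisp := rfl

end Graphene
end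

noncomputable section

namespace Graphene

/-! ### The absolute value of a Hermitian matrix -/

section MatAbs

open Matrix
open scoped ComplexOrder

variable {ι : Type} [Fintype ι]

/-- The squared Euclidean norm of a complex vector. -/
def vecSq (φ : ι → ℂ) : ℝ := ∑ x, ‖φ x‖ ^ 2

theorem vecSq_nonneg (φ : ι → ℂ) : 0 ≤ vecSq φ := Finset.sum_nonneg fun _ _ => by positivity

theorem star_dotProduct_self (φ : ι → ℂ) : star φ ⬝ᵥ φ = (vecSq φ : ℂ) := by
  simp only [dotProduct, vecSq, Pi.star_apply, RCLike.star_def, Complex.conj_mul']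
  push_cast
  rfl

theorem vecSq_eq_norm (φ : ι → ℂ) : vecSq φ = ‖WithLp.toLp 2 φ‖ ^ 2 := by
  rw [EuclideanSpace.norm_sq_eq]
  rfl

theorem norm_star_dotProduct_le (φ ψ : ι → ℂ) :
    ‖star φ ⬝ᵥ ψ‖ ≤ √(vecSq φ) * √(vecSq ψ) := by
  have h := norm_inner_le_norm (𝕜 := ℂ) (WithLp.toLp 2 φ) (WithLp.toLp 2 ψ)
  rw [vecSq_eq_norm, vecSq_eq_norm, Real.sqrt_sq (norm_nonneg _), Real.sqrt_sq (norm_nonneg _)]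
  rwa [EuclideanSpace.inner_eq_star_dotProduct, dotProduct_comm] at h

theorem vecSq_eq_zero {φ : ι → ℂ} (h : vecSq φ = 0) : φ = 0 := by
  rw [vecSq_eq_norm, sq_eq_zero_iff, norm_eq_zero] at h
  exact congrArg WithLp.ofLp h

variable [DecidableEq ι]

theorem isHermitian_sq {M : Matrix ι ι ℂ} (hM : M.IsHermitian) : (M ^ 2).IsHermitian := hM.pow 2

theorem posSemidef_sq {M : Matrix ι ι ℂ} (hM : M.IsHermitian) : (M ^ 2).PosSemidef := by
  have := posSemidef_conjTranspose_mul_self M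
  rwa [hM.eq, ← sq] at this

open scoped MatrixOrder in
theorem posSemidef_matAbs {M : Matrix ι ι ℂ} : (matAbs M).PosSemidef := by
  rw [← nonneg_iff_posSemidef]
  exact cfc_nonneg fun x _ => Real.sqrt_nonneg x

open scoped MatrixOrder in
theorem matAbs_sq {M : Matrix ι ι ℂ} (hM : M.IsHermitian) : matAbs M ^ 2 = M ^ 2 := by
  have h0 : IsSelfAdjoint (M ^ 2) := isHermitian_sq hM
  have hn : 0 ≤ M ^ 2 := nonneg_iff_posSemidef.2 (posSemidef_sq hM)
  rw [matAbs, ← cfc_pow Real.sqrt 2 (M ^ 2) Real.continuous_sqrt.continuousOn h0]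
  conv_rhs => rw [← cfc_id ℝ (M ^ 2) h0]
  refine cfc_congr fun x hx => ?_
  exact Real.sq_sqrt (spectrum_nonneg_of_nonneg hn hx)

open scoped MatrixOrder in
theorem matAbs_eq_of_sq_eq {M Q : Matrix ι ι ℂ} (hQ : Q.PosSemidef) (h : Q ^ 2 = M ^ 2) :
    matAbs M = Q := by
  have h0 : IsSelfAdjoint Q := hQ.1
  have hn : 0 ≤ Q := nonneg_iff_posSemidef.2 hQ
  rw [matAbs, ← h, ← cfc_comp_pow Real.sqrt 2 Q Real.continuous_sqrt.continuousOn h0]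
  conv_rhs => rw [← cfc_id ℝ Q h0]
  refine cfc_congr fun x hx => ?_
  exact Real.sqrt_sq (spectrum_nonneg_of_nonneg hn hx)

open scoped Matrix.Norms.L2Operator in
theorem continuous_matAbs {X : Type*} [TopologicalSpace X] {F : X → Matrix ι ι ℂ}
    (hF : Continuous F) (hH : ∀ x, (F x).IsHermitian) : Continuous fun x => matAbs (F x) := by
  unfold matAbs
  exact Continuous.cfc_of_mem_nhdsSet (s := univ) Real.sqrt Filter.univ_mem (hF.pow 2)
    (fun x => isHermitian_sq (hH x)) Real.continuous_sqrt.continuousOn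

theorem vecSq_mulVec {M : Matrix ι ι ℂ} (hM : M.IsHermitian) (φ : ι → ℂ) :
    (vecSq (M *ᵥ φ) : ℂ) = star φ ⬝ᵥ (M ^ 2 *ᵥ φ) := by
  rw [← star_dotProduct_self, star_mulVec, hM.eq, ← dotProduct_mulVec, mulVec_mulVec, sq]

theorem vecSq_matAbs_mulVec {M : Matrix ι ι ℂ} (hM : M.IsHermitian) (φ : ι → ℂ) :
    vecSq (matAbs M *ᵥ φ) = vecSq (M *ᵥ φ) := by
  have h := vecSq_mulVec (posSemidef_matAbs (M := M)).1 φ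
  rw [matAbs_sq hM, ← vecSq_mulVec hM] at h
  exact_mod_cast h

theorem norm_dotProduct_matAbs_le {M : Matrix ι ι ℂ} (hM : M.IsHermitian) (φ : ι → ℂ) :
    ‖star φ ⬝ᵥ (matAbs M *ᵥ φ)‖ ≤ √(vecSq φ) * √(vecSq (M *ᵥ φ)) := by
  rw [← vecSq_matAbs_mulVec hM]
  exact norm_star_dotProduct_le _ _

/-- An eigenvector of `M ^ 2` with eigenvalue `l ^ 2` is an eigenvector of `|M|` with
eigenvalue `l ≥ 0`. -/
theorem matAbs_mulVec_eigenvector {M : Matrix ι ι ℂ} (hM : M.IsHermitian) {φ : ι → ℂ} {l : ℝ}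
    (hl : 0 ≤ l) (h : M ^ 2 *ᵥ φ = ((l : ℂ) ^ 2) • φ) : matAbs M *ᵥ φ = (l : ℂ) • φ := by
  set Q := matAbs M with hQ
  have hp : Q.PosSemidef := posSemidef_matAbs
  set ψ := Q *ᵥ φ - (l : ℂ) • φ with hψ
  have hQQ : Q *ᵥ (Q *ᵥ φ) = ((l : ℂ) ^ 2) • φ := by
    rw [mulVec_mulVec, ← sq, hQ, matAbs_sq hM, h]
  have h1 : Q *ᵥ ψ = -(l : ℂ) • ψ := by
    rw [hψ, mulVec_sub, hQQ, mulVec_smul, smul_sub, smul_smul]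
    rw [show -(l : ℂ) * l = -((l : ℂ) ^ 2) by ring]
    module
  have h2 : (0 : ℝ) ≤ -(l * vecSq ψ) := by
    have := hp.re_dotProduct_nonneg ψ
    rw [h1, dotProduct_smul, star_dotProduct_self] at this
    simpa using this
  have h3 : l * vecSq ψ = 0 := le_antisymm (by linarith) (mul_nonneg hl (vecSq_nonneg _))
  rcases mul_eq_zero.1 h3 with h4 | h4
  · have h5 : (vecSq (Q *ᵥ φ) : ℂ) = 0 := by
      rw [vecSq_mulVec hp.1, hQ, matAbs_sq hM, h, h4]
      simp
    have h6 : Q *ᵥ φ = 0 := vecSq_eq_zero (by exact_mod_cast h5)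
    rw [h6, h4]
    simp
  · exact sub_eq_zero.1 (vecSq_eq_zero h4)

theorem matAbs_smul {M : Matrix ι ι ℂ} (hM : M.IsHermitian) (c : ℝ) :
    matAbs ((c : ℂ) • M) = ((|c| : ℝ) : ℂ) • matAbs M := by
  refine matAbs_eq_of_sq_eq (posSemidef_matAbs.smul (by simp)) ?_
  rw [smul_pow, smul_pow, matAbs_sq hM]
  norm_cast
  rw [sq_abs]

theorem trace_matAbs_conj {M N V : Matrix ι ι ℂ} (hV : Vᴴ * V = 1) (hM : M.IsHermitian)
    (h : N = V * M * Vᴴ) : (matAbs N).trace = (matAbs M).trace := by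
  have : matAbs N = V * matAbs M * Vᴴ := by
    refine matAbs_eq_of_sq_eq (posSemidef_matAbs.mul_mul_conjTranspose_same V) ?_
    have e : ∀ X : Matrix ι ι ℂ, (V * X * Vᴴ) ^ 2 = V * X ^ 2 * Vᴴ := fun X => by
      rw [sq, sq]
      calc _ = V * X * (Vᴴ * V) * X * Vᴴ := by noncomm_ring
        _ = _ := by rw [hV]; noncomm_ring
    rw [h, e, e, matAbs_sq hM]
  rw [this, trace_mul_cycle, hV, one_mul]

theorem trace_matAbs_transpose {M : Matrix ι ι ℂ} (hM : M.IsHermitian) :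
    (matAbs Mᵀ).trace = (matAbs M).trace := by
  have : matAbs Mᵀ = (matAbs M)ᵀ := by
    refine matAbs_eq_of_sq_eq posSemidef_matAbs.transpose ?_
    rw [← transpose_pow, ← transpose_pow, matAbs_sq hM]
  rw [this, trace_transpose]

end MatAbs

end Graphene
end

noncomputable section

namespace Graphene

/-! ### Bloch waves and Fourier fibres -/

/-- The vector with coordinates `r` in the lattice spanned by `c₁` and `c₂`. -/
def latticeVec (c₁ c₂ : ℤ × ℤ) (r : ℤ × ℤ) : ℤ × ℤ := r.1 • c₁ + r.2 • c₂

/-- The product `k · R` of a quasi-momentum and a lattice vector. -/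
def dot (k : ℝ × ℝ) (R : ℤ × ℤ) : ℝ := k.1 * R.1 + k.2 * R.2

/-- The coordinates `(k · c₁, k · c₂)` of a quasi-momentum. -/
def cellMap (c₁ c₂ : ℤ × ℤ) (k : ℝ × ℝ) : ℝ × ℝ := (dot k c₁, dot k c₂)

/-- The phase `e^{i k · R}`. -/
def phase (k : ℝ × ℝ) (R : ℤ × ℤ) : ℂ := Complex.exp (Complex.I * (dot k R : ℝ))

theorem dot_add (k : ℝ × ℝ) (R S : ℤ × ℤ) : dot k (R + S) = dot k R + dot k S := by
  simp only [dot, Prod.fst_add, Prod.snd_add]; push_cast; ring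

theorem dot_latticeVec (c₁ c₂ : ℤ × ℤ) (k : ℝ × ℝ) (r : ℤ × ℤ) :
    dot k (latticeVec c₁ c₂ r) = dot (cellMap c₁ c₂ k) r := by
  simp only [dot, latticeVec, cellMap, Prod.fst_add, Prod.snd_add, Prod.smul_fst, Prod.smul_snd,
    smul_eq_mul]
  push_cast; ring

theorem phase_add (k : ℝ × ℝ) (R S : ℤ × ℤ) : phase k (R + S) = phase k R * phase k S := by
  rw [phase, dot_add, phase, phase, ← Complex.exp_add]; push_cast; ring_nf

theorem phase_zero (k : ℝ × ℝ) : phase k 0 = 1 := by simp [phase, dot]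

theorem norm_phase (k : ℝ × ℝ) (R : ℤ × ℤ) : ‖phase k R‖ = 1 := by
  rw [phase, mul_comm, Complex.norm_exp_ofReal_mul_I]

theorem star_phase (k : ℝ × ℝ) (R : ℤ × ℤ) : star (phase k R) = phase k (-R) := by
  rw [phase, phase, RCLike.star_def, ← Complex.exp_conj]
  simp [dot]
  ring_nf

theorem phase_sub (k : ℝ × ℝ) (R S : ℤ × ℤ) : phase k (R - S) = phase k R * star (phase k S) := by
  rw [sub_eq_add_neg, phase_add, star_phase]

theorem phase_add_left (k s : ℝ × ℝ) (R : ℤ × ℤ) : phase (k + s) R = phase k R * phase s R := by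
  rw [phase, phase, phase, ← Complex.exp_add]
  simp only [dot, Prod.fst_add, Prod.snd_add]
  push_cast; ring_nf

theorem phase_two_pi (m n : ℤ) (R : ℤ × ℤ) :
    phase (m * (2 * Real.pi), n * (2 * Real.pi)) R = 1 := by
  rw [phase, show dot (m * (2 * Real.pi), n * (2 * Real.pi)) R =
    0 + ((m * R.1 + n * R.2 : ℤ) : ℝ) * (2 * Real.pi) by simp only [dot]; push_cast; ring,
    exp_I_add_int]
  simp

theorem continuous_phase (R : ℤ × ℤ) : Continuous fun k => phase k R := by
  unfold phase dot
  fun_prop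

theorem phase_dir (k : ℝ × ℝ) : ∑ i : Fin 3, phase k (dir i) = disp k := by
  simp [Fin.sum_univ_three, phase, dir, dot, disp]

theorem cellMap_add (c₁ c₂ : ℤ × ℤ) (k s : ℝ × ℝ) :
    cellMap c₁ c₂ (k + s) = cellMap c₁ c₂ k + cellMap c₁ c₂ s := by
  ext <;> simp only [cellMap, dot, Prod.fst_add, Prod.snd_add] <;> ring

theorem continuous_cellMap (c₁ c₂ : ℤ × ℤ) : Continuous (cellMap c₁ c₂) := by
  unfold cellMap dot
  fun_prop

/-- `q` enumerates one vector of each class modulo the lattice spanned by `c₁` and `c₂`. -/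
def IsTransversal {ι : Type} (c₁ c₂ : ℤ × ℤ) (q : ι → ℤ × ℤ) : Prop :=
  Function.Bijective fun z : ι × (ℤ × ℤ) => q z.1 + latticeVec c₁ c₂ z.2

/-- The characters of the quotient by the lattice spanned by `c₁` and `c₂` separate the points
enumerated by `q`. -/
def CharactersSeparate {ι : Type} (c₁ c₂ : ℤ × ℤ) (q : ι → ℤ × ℤ) : Prop :=
  ∀ x y, x ≠ y → ∃ δ : ℝ × ℝ, (∃ m n : ℤ, cellMap c₁ c₂ δ =
    (m * (2 * Real.pi), n * (2 * Real.pi))) ∧ phase δ (q y - q x) ≠ 1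

/-- The configuration is periodic with respect to the lattice spanned by `c₁` and `c₂`. -/
def LatticePeriodic (c₁ c₂ : ℤ × ℤ) (τ : Config) : Prop :=
  ∀ R r, τ (R + latticeVec c₁ c₂ r) = τ R

theorem siteShift_bijective {ι : Type} {c₁ c₂ : ℤ × ℤ} {pA pB : ι → ℤ × ℤ}
    (hA : IsTransversal c₁ c₂ pA) (hB : IsTransversal c₁ c₂ pB) :
    Function.Bijective fun z : (ι ⊕ ι) × (ℤ × ℤ) =>
      siteShift (latticeVec c₁ c₂ z.2) (Sum.map pA pB z.1) := by
  constructor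
  · rintro ⟨x | x, r⟩ ⟨y | y, s⟩ h
    · have := hA.1 (a₁ := (x, r)) (a₂ := (y, s)) (by simpa [siteShift] using h)
      simp_all
    · simp [siteShift] at h
    · simp [siteShift] at h
    · have := hB.1 (a₁ := (x, r)) (a₂ := (y, s)) (by simpa [siteShift] using h)
      simp_all
  · rintro (R | R)
    · obtain ⟨⟨x, r⟩, h⟩ := hA.2 R
      exact ⟨(Sum.inl x, r), by simpa [siteShift] using h⟩
    · obtain ⟨⟨x, r⟩, h⟩ := hB.2 R
      exact ⟨(Sum.inr x, r), by simpa [siteShift] using h⟩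

theorem nbr_siteShift (i : Fin 3) (R : ℤ × ℤ) (x : Site) :
    nbr i (siteShift R x) = siteShift R (nbr i x) := by
  rcases x with S | S <;> simp only [nbr, siteShift, Sum.map_inl, Sum.map_inr]
  · congr 1; abel
  · congr 1; abel

theorem siteShift_siteShift (R S : ℤ × ℤ) (x : Site) :
    siteShift R (siteShift S x) = siteShift (R + S) x := by
  rcases x with T | T <;> simp only [siteShift, Sum.map_inl, Sum.map_inr] <;> congr 1 <;> abel

theorem siteShift_zero (x : Site) : siteShift 0 x = x := by
  rcases x with T | T <;> simp [siteShift]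

theorem siteShift_injective (R : ℤ × ℤ) : Function.Injective (siteShift R) := by
  intro x y h
  rw [← siteShift_zero x, ← siteShift_zero y, ← neg_add_cancel R, ← siteShift_siteShift, h,
    siteShift_siteShift]

theorem amp_siteShift {c₁ c₂ : ℤ × ℤ} {τ : Config} (hτ : LatticePeriodic c₁ c₂ τ) (i : Fin 3)
    (r : ℤ × ℤ) (x : Site) : amp τ i (siteShift (latticeVec c₁ c₂ r) x) = amp τ i x := by
  rcases x with S | S
  · simp [siteShift, amp, hτ S r]
  · simp [siteShift, amp, add_right_comm S, hτ (S + dir i) r]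

theorem amp_nbr (τ : Config) (i : Fin 3) (x : Site) : amp τ i (nbr i x) = amp τ i x := by
  rcases x with S | S <;> simp [nbr, amp]

theorem hop_comm (τ : Config) (x y : Site) : hop τ x y = hop τ y x := by
  refine Finset.sum_congr rfl fun i _ => ?_
  by_cases h : nbr i x = y
  · rw [if_pos h, if_pos (by rw [← h, nbr_nbr]), ← h, amp_nbr]
  · rw [if_neg h, if_neg fun h' => h (by rw [← h', nbr_nbr])]

theorem hop_siteShift {c₁ c₂ : ℤ × ℤ} {τ : Config} (hτ : LatticePeriodic c₁ c₂ τ) (r : ℤ × ℤ)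
    (x y : Site) : hop τ (siteShift (latticeVec c₁ c₂ r) x) (siteShift (latticeVec c₁ c₂ r) y) =
      hop τ x y := by
  refine Finset.sum_congr rfl fun i _ => ?_
  simp only [nbr_siteShift, (siteShift_injective _).eq_iff, amp_siteShift hτ]

section Fibre

open Matrix

variable {ι : Type} {c₁ c₂ : ℤ × ℤ}

theorem fibre_apply (p : ι → Site) (τ : Config) (θ : ℝ × ℝ) (x y : ι) :
    fibre c₁ c₂ p τ θ x y = ∑' r : ℤ × ℤ,
      (hop τ (p x) (siteShift (latticeVec c₁ c₂ r) (p y)) : ℂ) * phase θ r := by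
  simp only [fibre, of_apply, latticeVec, phase, dot]
  refine tsum_congr fun r => ?_
  push_cast
  ring_nf

theorem isHermitian_fibre {τ : Config} (hτ : LatticePeriodic c₁ c₂ τ) (p : ι → Site)
    (θ : ℝ × ℝ) : (fibre c₁ c₂ p τ θ).IsHermitian := by
  ext x y
  rw [conjTranspose_apply, fibre_apply, fibre_apply, RCLike.star_def, Complex.conj_tsum,
    ← (Equiv.neg (ℤ × ℤ)).tsum_eq]
  refine tsum_congr fun r => ?_
  rw [map_mul, Complex.conj_ofReal, ← RCLike.star_def, star_phase, Equiv.neg_apply, neg_neg]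
  congr 2
  rw [← hop_siteShift hτ r, siteShift_siteShift, hop_comm, show latticeVec c₁ c₂ r +
    latticeVec c₁ c₂ (-r) = 0 by simp [latticeVec]; abel, siteShift_zero]

theorem torusPeriodic_fibre (p : ι → Site) (τ : Config) :
    TorusPeriodic (fibre c₁ c₂ p τ) := by
  intro θ m n
  ext x y
  rw [fibre_apply, fibre_apply]
  refine tsum_congr fun r => ?_
  have := phase_add_left θ (m * (2 * Real.pi), n * (2 * Real.pi)) r
  rw [phase_two_pi, mul_one] at this
  rw [← this]
  rfl

theorem hop_eq_zero_of_notMem {τ : Config} {x y : Site}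
    (h : y ∉ Finset.univ.image fun i => nbr i x) : hop τ x y = 0 := by
  refine Finset.sum_eq_zero fun i _ => if_neg fun h' => h ?_
  exact Finset.mem_image.2 ⟨i, Finset.mem_univ _, h'⟩

theorem continuous_fibre {p : ι → Site} (hp : Function.Bijective fun z : ι × (ℤ × ℤ) =>
      siteShift (latticeVec c₁ c₂ z.2) (p z.1)) (τ : Config) :
    Continuous (fibre c₁ c₂ p τ) := by
  refine continuous_matrix fun x y => ?_
  simp only [fibre_apply]
  have hinj : Function.Injective fun r => siteShift (latticeVec c₁ c₂ r) (p y) := fun r s h => by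
    have := hp.1 (a₁ := (y, r)) (a₂ := (y, s)) h
    simpa using this
  set s : Finset (ℤ × ℤ) := (Finset.univ.image fun i => nbr i (p x)).preimage _ hinj.injOn with hs
  have : ∀ θ : ℝ × ℝ, ∑' r : ℤ × ℤ,
      (hop τ (p x) (siteShift (latticeVec c₁ c₂ r) (p y)) : ℂ) * phase θ r =
      ∑ r ∈ s, (hop τ (p x) (siteShift (latticeVec c₁ c₂ r) (p y)) : ℂ) * phase θ r := fun θ => by
    refine tsum_eq_sum fun r hr => ?_
    rw [hs, Finset.mem_preimage] at hr
    rw [hop_eq_zero_of_notMem hr]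
    simp
  simp only [this]
  exact continuous_finsetSum _ fun r _ => continuous_const.mul (continuous_phase r)

variable [Fintype ι]

/-- The fibre acts on the restriction of a Bloch wave to the unit cell by restricting the image of
the wave. -/
theorem fibre_mulVec {p : ι → Site} (hp : Function.Bijective fun z : ι × (ℤ × ℤ) =>
      siteShift (latticeVec c₁ c₂ z.2) (p z.1)) (τ : Config) (θ : ℝ × ℝ) {ψ : Site → ℂ}
    (hψ : ∀ r x, ψ (siteShift (latticeVec c₁ c₂ r) x) = phase θ r * ψ x) (x : ι) :
    (fibre c₁ c₂ p τ θ *ᵥ (ψ ∘ p)) x = ∑ i : Fin 3, (amp τ i (p x) : ℂ) * ψ (nbr i (p x)) := by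
  have h1 : HasSum (fun y : Site => (hop τ (p x) y : ℂ) * ψ y)
      (∑ i : Fin 3, (amp τ i (p x) : ℂ) * ψ (nbr i (p x))) := by
    have : ∀ y : Site, (hop τ (p x) y : ℂ) * ψ y =
        ∑ i : Fin 3, if y = nbr i (p x) then (amp τ i (p x) : ℂ) * ψ (nbr i (p x)) else 0 := by
      intro y
      rw [hop, Complex.ofReal_sum, Finset.sum_mul]
      refine Finset.sum_congr rfl fun i _ => ?_
      by_cases h : nbr i (p x) = y
      · rw [if_pos h, if_pos h.symm, h]
      · rw [if_neg h, if_neg (Ne.symm h)]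
        simp
    simp only [this]
    exact hasSum_sum fun i _ => hasSum_ite_eq _ _
  have h2 := (Equiv.ofBijective _ hp).hasSum_iff.2 h1
  rw [mulVec, dotProduct, ← h2.tsum_eq, h2.summable.tsum_prod, tsum_fintype]
  refine Finset.sum_congr rfl fun y _ => ?_
  rw [fibre_apply, ← tsum_mul_right]
  refine tsum_congr fun r => ?_
  simp only [Function.comp_apply, Equiv.ofBijective_apply, hψ]
  ring

/-- A plane wave with quasi-momentum `k` and amplitudes `f`, `g` on the two sublattices. -/
def planeWave (k : ℝ × ℝ) (f g : ℂ) : Site → ℂ :=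
  Sum.elim (fun R => f * phase k R) (fun R => g * phase k R)

theorem planeWave_siteShift (k : ℝ × ℝ) (f g : ℂ) (r : ℤ × ℤ) (x : Site) :
    planeWave k f g (siteShift (latticeVec c₁ c₂ r) x) =
      phase (cellMap c₁ c₂ k) r * planeWave k f g x := by
  have h : phase k (latticeVec c₁ c₂ r) = phase (cellMap c₁ c₂ k) r := by
    rw [phase, phase, dot_latticeVec]
  rcases x with R | R <;>
    simp only [siteShift, planeWave, Sum.map_inl, Sum.map_inr, Sum.elim_inl, Sum.elim_inr,
      phase_add, h] <;> ring

/-- The amplitude `∑ i, a i e^{i k · dir i}`. -/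
def bloch (a : Fin 3 → ℝ) (k : ℝ × ℝ) : ℂ := ∑ i, (a i : ℂ) * phase k (dir i)

theorem continuous_bloch (a : Fin 3 → ℝ) : Continuous (bloch a) := by
  unfold bloch
  exact continuous_finsetSum _ fun i _ => continuous_const.mul (continuous_phase _)

theorem bloch_const (t : ℝ) (k : ℝ × ℝ) : bloch (fun _ => t) k = t * disp k := by
  rw [bloch, ← Finset.mul_sum, phase_dir]

theorem sum_amp_planeWave_inl (τ : Config) (k : ℝ × ℝ) (f g : ℂ) (R : ℤ × ℤ) :
    ∑ i : Fin 3, (amp τ i (Sum.inl R) : ℂ) * planeWave k f g (nbr i (Sum.inl R)) =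
      g * phase k R * star (bloch (τ R) k) := by
  rw [bloch, star_sum, Finset.mul_sum]
  refine Finset.sum_congr rfl fun i _ => ?_
  simp only [amp, nbr, planeWave, Sum.elim_inr, phase_sub, star_mul', RCLike.star_def,
    Complex.conj_ofReal]
  ring

theorem sum_amp_planeWave_inr (τ : Config) (k : ℝ × ℝ) (f g : ℂ) (R : ℤ × ℤ) :
    ∑ i : Fin 3, (amp τ i (Sum.inr R) : ℂ) * planeWave k f g (nbr i (Sum.inr R)) =
      f * phase k R * bloch (fun i => τ (R + dir i) i) k := by
  rw [bloch, Finset.mul_sum]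
  refine Finset.sum_congr rfl fun i _ => ?_
  simp only [amp, nbr, planeWave, Sum.elim_inl, phase_add]
  ring

end Fibre

end Graphene
end

noncomputable section

namespace Graphene

/-! ### The trace per atom in terms of plane waves -/

section Trace

open Matrix

variable {ι : Type} {c₁ c₂ : ℤ × ℤ}

/-- A unit cell of a sublattice: the vectors `pA` and `pB` enumerate the atoms of the two kinds. -/
structure IsCell (c₁ c₂ : ℤ × ℤ) (pA pB : ι → ℤ × ℤ) : Prop where
  det_ne : c₁.1 * c₂.2 - c₁.2 * c₂.1 ≠ 0
  transA : IsTransversal c₁ c₂ pA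
  transB : IsTransversal c₁ c₂ pB
  sepA : CharactersSeparate c₁ c₂ pA
  sepB : CharactersSeparate c₁ c₂ pB

theorem IsCell.bijective {pA pB : ι → ℤ × ℤ} (h : IsCell c₁ c₂ pA pB) :
    Function.Bijective fun z : (ι ⊕ ι) × (ℤ × ℤ) =>
      siteShift (latticeVec c₁ c₂ z.2) (Sum.map pA pB z.1) :=
  siteShift_bijective h.transA h.transB

theorem TorusPeriodic.cellMap_add {E : Type*} {G : ℝ × ℝ → E} (hG : TorusPeriodic G)
    {δ : ℝ × ℝ} {m n : ℤ} (hδ : cellMap c₁ c₂ δ = (m * (2 * Real.pi), n * (2 * Real.pi)))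
    (k : ℝ × ℝ) : G (cellMap c₁ c₂ (k + δ)) = G (cellMap c₁ c₂ k) := by
  rw [Graphene.cellMap_add, hδ, ← hG (cellMap c₁ c₂ k) m n]
  rfl

theorem TorusPeriodic.comp_cellMap {E : Type*} {G : ℝ × ℝ → E} (hG : TorusPeriodic G)
    (c₁ c₂ : ℤ × ℤ) : TorusPeriodic fun k => G (cellMap c₁ c₂ k) := by
  intro k m n
  have h : cellMap c₁ c₂ (m * (2 * Real.pi), n * (2 * Real.pi)) =
      ((m * c₁.1 + n * c₁.2 : ℤ) * (2 * Real.pi), (m * c₂.1 + n * c₂.2 : ℤ) * (2 * Real.pi)) := by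
    ext <;> simp only [cellMap, dot] <;> push_cast <;> ring
  exact hG.cellMap_add h k

theorem torusPeriodic_phase (R : ℤ × ℤ) : TorusPeriodic fun k => phase k R := by
  intro k m n
  have := phase_add_left k (m * (2 * Real.pi), n * (2 * Real.pi)) R
  rwa [phase_two_pi, mul_one] at this

theorem integral_bz_cellMap (hdet : c₁.1 * c₂.2 - c₁.2 * c₂.1 ≠ 0) {G : ℝ × ℝ → ℂ}
    (hG : TorusPeriodic G) (hc : Continuous G) :
    ∫ k, G (cellMap c₁ c₂ k) ∂bz = ∫ k, G k ∂bz := by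
  rw [← integral_bz_comp hG hc.measurable hdet 0]
  refine integral_congr_ae (Filter.Eventually.of_forall fun k => ?_)
  simp only [cellMap, dot, Prod.fst_zero, Prod.snd_zero, add_zero]
  congr 2 <;> ring

theorem integral_phase_mul_eq_zero {G : ℝ × ℝ → ℂ} (hG : TorusPeriodic G) (hc : Continuous G)
    {δ : ℝ × ℝ} {m n : ℤ} (hδ : cellMap c₁ c₂ δ = (m * (2 * Real.pi), n * (2 * Real.pi)))
    {R : ℤ × ℤ} (hR : phase δ R ≠ 1) :
    ∫ k, phase k R * G (cellMap c₁ c₂ k) ∂bz = 0 := by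
  have hcont : Continuous fun k => phase k R * G (cellMap c₁ c₂ k) :=
    (continuous_phase R).mul (hc.comp (continuous_cellMap c₁ c₂))
  have hper : TorusPeriodic fun k => phase k R * G (cellMap c₁ c₂ k) := fun k m n => by
    simp only [torusPeriodic_phase R k m n, hG.comp_cellMap c₁ c₂ k m n]
  have h1 := integral_bz_comp hper hcont.measurable (a := 1) (b := 0) (c := 0) (d := 1)
    (by norm_num) δ
  have h2 : ∀ k : ℝ × ℝ, phase (((1 : ℤ) : ℝ) * k.1 + ((0 : ℤ) : ℝ) * k.2 + δ.1,
      ((0 : ℤ) : ℝ) * k.1 + ((1 : ℤ) : ℝ) * k.2 + δ.2) R *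
      G (cellMap c₁ c₂ (((1 : ℤ) : ℝ) * k.1 + ((0 : ℤ) : ℝ) * k.2 + δ.1,
      ((0 : ℤ) : ℝ) * k.1 + ((1 : ℤ) : ℝ) * k.2 + δ.2)) =
      phase δ R * (phase k R * G (cellMap c₁ c₂ k)) := by
    intro k
    have e : (((1 : ℤ) : ℝ) * k.1 + ((0 : ℤ) : ℝ) * k.2 + δ.1,
      ((0 : ℤ) : ℝ) * k.1 + ((1 : ℤ) : ℝ) * k.2 + δ.2) = k + δ := by ext <;> simp
    rw [e, phase_add_left, hG.cellMap_add hδ]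
    ring
  simp only [h2, integral_const_mul] at h1
  have h3 : (phase δ R - 1) * ∫ k, phase k R * G (cellMap c₁ c₂ k) ∂bz = 0 := by
    rw [sub_mul, h1, one_mul, sub_self]
  exact (mul_eq_zero.1 h3).resolve_left (sub_ne_zero.2 hR)

variable {pA pB : ι → ℤ × ℤ}

/-- The restriction to the unit cell of the plane wave on one of the two sublattices. -/
def sideWave (pA pB : ι → ℤ × ℤ) (s : Bool) (k : ℝ × ℝ) : ι ⊕ ι → ℂ :=
  planeWave k (if s then 1 else 0) (if s then 0 else 1) ∘ Sum.map pA pB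

theorem continuous_sideWave (s : Bool) (x : ι ⊕ ι) :
    Continuous fun k => sideWave pA pB s k x := by
  rcases x with x | x <;> exact continuous_const.mul (continuous_phase _)

variable [Fintype ι]

theorem vecSq_sideWave (s : Bool) (k : ℝ × ℝ) :
    vecSq (sideWave pA pB s k) = Fintype.card ι := by
  cases s <;> simp [vecSq, sideWave, planeWave, norm_phase]

open scoped Classical in
theorem integral_trace_eq (h : IsCell c₁ c₂ pA pB) {Q : ℝ × ℝ → Matrix (ι ⊕ ι) (ι ⊕ ι) ℂ}
    (hQ : TorusPeriodic Q) (hc : Continuous Q) :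
    ∫ θ, (Q θ).trace ∂bz =
      (∫ k, star (sideWave pA pB true k) ⬝ᵥ
        (Q (cellMap c₁ c₂ k) *ᵥ sideWave pA pB true k) ∂bz) +
      ∫ k, star (sideWave pA pB false k) ⬝ᵥ
        (Q (cellMap c₁ c₂ k) *ᵥ sideWave pA pB false k) ∂bz := by
  have hQc : ∀ x y, Continuous fun θ => Q θ x y := fun x y => hc.matrix_elem x y
  have hQp : ∀ x y, TorusPeriodic fun θ => Q θ x y := fun x y θ m n => by simp only [hQ θ m n]
  have key : ∀ (q : ι → ℤ × ℤ) (P : ℝ × ℝ → Matrix ι ι ℂ), CharactersSeparate c₁ c₂ q →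
      (∀ x y, Continuous fun θ => P θ x y) → (∀ x y, TorusPeriodic fun θ => P θ x y) →
      ∫ k, ∑ x, ∑ y, phase k (q y - q x) * P (cellMap c₁ c₂ k) x y ∂bz =
        ∑ x, ∫ θ, P θ x x ∂bz := by
    intro q P hq hPc hPp
    have hi : ∀ x y, Integrable (fun k => phase k (q y - q x) * P (cellMap c₁ c₂ k) x y) bz :=
      fun x y => ((continuous_phase _).mul
        ((hPc x y).comp (continuous_cellMap c₁ c₂))).integrable_bz
    rw [integral_finsetSum _ fun x _ => integrable_finsetSum _ fun y _ => hi x y]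
    refine Finset.sum_congr rfl fun x _ => ?_
    rw [integral_finsetSum _ fun y _ => hi x y, Finset.sum_eq_single x]
    · simp only [sub_self, phase_zero, one_mul]
      exact integral_bz_cellMap h.det_ne (hPp x x) (hPc x x)
    · intro y _ hy
      obtain ⟨δ, ⟨m, n, hδ⟩, hR⟩ := hq x y hy.symm
      exact integral_phase_mul_eq_zero (hPp x y) (hPc x y) hδ hR
    · simp
  have hA := key pA (fun θ => (Q θ).toBlocks₁₁) h.sepA (fun x y => hQc _ _) (fun x y => hQp _ _)
  have hB := key pB (fun θ => (Q θ).toBlocks₂₂) h.sepB (fun x y => hQc _ _) (fun x y => hQp _ _)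
  have h1 : ∀ k, star (sideWave pA pB true k) ⬝ᵥ
        (Q (cellMap c₁ c₂ k) *ᵥ sideWave pA pB true k) =
        ∑ x, ∑ y, phase k (pA y - pA x) * (Q (cellMap c₁ c₂ k)).toBlocks₁₁ x y := by
    intro k
    simp only [dotProduct, mulVec, sideWave, Fintype.sum_sum_type, Finset.mul_sum, planeWave,
      Function.comp_apply, Sum.map_inl, Sum.map_inr, Sum.elim_inl, Sum.elim_inr, Pi.star_apply,
      if_true, one_mul, zero_mul, star_zero, mul_zero, Finset.sum_const_zero, add_zero,
      toBlocks₁₁, of_apply]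
    refine Finset.sum_congr rfl fun x _ => Finset.sum_congr rfl fun y _ => ?_
    rw [phase_sub]
    ring
  have h2 : ∀ k, star (sideWave pA pB false k) ⬝ᵥ
        (Q (cellMap c₁ c₂ k) *ᵥ sideWave pA pB false k) =
        ∑ x, ∑ y, phase k (pB y - pB x) * (Q (cellMap c₁ c₂ k)).toBlocks₂₂ x y := by
    intro k
    simp only [dotProduct, mulVec, sideWave, Fintype.sum_sum_type, Finset.mul_sum, planeWave,
      Function.comp_apply, Sum.map_inl, Sum.map_inr, Sum.elim_inl, Sum.elim_inr, Pi.star_apply,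
      Bool.false_eq_true, if_false, one_mul, zero_mul, star_zero, mul_zero,
      Finset.sum_const_zero, zero_add, toBlocks₂₂, of_apply]
    refine Finset.sum_congr rfl fun x _ => Finset.sum_congr rfl fun y _ => ?_
    rw [phase_sub]
    ring
  simp only [h1, h2]
  rw [hA, hB]
  simp only [trace, diag_apply, Fintype.sum_sum_type]
  rw [integral_add (integrable_finsetSum _ fun x _ => (hQc _ _).integrable_bz)
    (integrable_finsetSum _ fun x _ => (hQc _ _).integrable_bz),
    integral_finsetSum _ fun x _ => (hQc _ _).integrable_bz,
    integral_finsetSum _ fun x _ => (hQc _ _).integrable_bz]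
  rfl

/-- The amplitudes of the three bonds at the atoms of one sublattice. -/
def bondRow (pA pB : ι → ℤ × ℤ) (τ : Config) (s : Bool) (j : ι) : Fin 3 → ℝ :=
  if s then fun i => τ (pB j + dir i) i else τ (pA j)

theorem vecSq_fibre_mulVec_sideWave (h : IsCell c₁ c₂ pA pB) (τ : Config) (s : Bool)
    (k : ℝ × ℝ) :
    vecSq (fibre c₁ c₂ (Sum.map pA pB) τ (cellMap c₁ c₂ k) *ᵥ sideWave pA pB s k) =
      ∑ j, ‖bloch (bondRow pA pB τ s j) k‖ ^ 2 := by
  have h1 : ∀ x, (fibre c₁ c₂ (Sum.map pA pB) τ (cellMap c₁ c₂ k) *ᵥ sideWave pA pB s k) x = _ :=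
    fibre_mulVec h.bijective τ _ (planeWave_siteShift k _ _)
  simp only [vecSq, h1, Fintype.sum_sum_type, Sum.map_inl, Sum.map_inr, sum_amp_planeWave_inl,
    sum_amp_planeWave_inr]
  cases s <;> simp [norm_phase, bondRow]

variable [DecidableEq ι]

theorem continuous_matAbs_fibre (h : IsCell c₁ c₂ pA pB) {τ : Config}
    (hτ : LatticePeriodic c₁ c₂ τ) :
    Continuous fun θ => matAbs (fibre c₁ c₂ (Sum.map pA pB) τ θ) :=
  continuous_matAbs (continuous_fibre h.bijective τ) fun θ => isHermitian_fibre hτ _ θ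

/-- The trace per atom is the average of the expectation of `|T(k)|` in the plane waves on the two
sublattices. -/
theorem traceAbs_eq (h : IsCell c₁ c₂ pA pB) {τ : Config} (hτ : LatticePeriodic c₁ c₂ τ) :
    traceAbs c₁ c₂ (Sum.map pA pB) τ = 1 / (2 * (Fintype.card ι : ℝ)) *
      ∑ s : Bool, ∫ k, (star (sideWave pA pB s k) ⬝ᵥ
        (matAbs (fibre c₁ c₂ (Sum.map pA pB) τ (cellMap c₁ c₂ k)) *ᵥ
          sideWave pA pB s k)).re ∂bz := by
  have hc := continuous_matAbs_fibre h hτ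
  have hre : ∀ {G : ℝ × ℝ → ℂ}, Continuous G → ∫ k, (G k).re ∂bz = (∫ k, G k ∂bz).re :=
    fun hG => integral_re hG.integrable_bz
  have hw : ∀ s, Continuous fun k => star (sideWave pA pB s k) ⬝ᵥ
        (matAbs (fibre c₁ c₂ (Sum.map pA pB) τ (cellMap c₁ c₂ k)) *ᵥ sideWave pA pB s k) := by
    intro s
    simp only [dotProduct, mulVec, Pi.star_apply]
    refine continuous_finsetSum _ fun x _ => (continuous_sideWave s x).star.mul
      (continuous_finsetSum _ fun y _ => Continuous.mul ?_ (continuous_sideWave s y))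
    exact (hc.matrix_elem x y).comp (continuous_cellMap c₁ c₂)
  rw [traceAbs, average_brillouin, Fintype.card_sum, Fintype.sum_bool, hre hc.matrix_trace,
    hre (hw _), hre (hw _), ← Complex.add_re, ← integral_trace_eq h (fun θ m n => by
      rw [torusPeriodic_fibre]) hc]
  push_cast
  ring

theorem traceAbs_le (h : IsCell c₁ c₂ pA pB) {τ : Config} (hτ : LatticePeriodic c₁ c₂ τ) :
    traceAbs c₁ c₂ (Sum.map pA pB) τ ≤ 1 / (2 * (Fintype.card ι : ℝ)) *
      ∑ s : Bool, ∫ k, √(Fintype.card ι) *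
        √(∑ j, ‖bloch (bondRow pA pB τ s j) k‖ ^ 2) ∂bz := by
  rw [traceAbs_eq h hτ]
  refine mul_le_mul_of_nonneg_left (Finset.sum_le_sum fun s _ => ?_) (by positivity)
  refine integral_mono_of_nonneg ?_ ?_ ?_
  · exact Filter.Eventually.of_forall fun k => posSemidef_matAbs.re_dotProduct_nonneg _
  · refine Continuous.integrable_bz ?_
    exact continuous_const.mul (continuous_finsetSum _ fun j _ =>
      (continuous_bloch _).norm.pow 2).sqrt
  · refine Filter.Eventually.of_forall fun k => ?_
    refine (Complex.re_le_norm _).trans ?_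
    refine (norm_dotProduct_matAbs_le (isHermitian_fibre hτ _ _) _).trans_eq ?_
    rw [vecSq_sideWave, vecSq_fibre_mulVec_sideWave h]

theorem traceAbs_const (h : IsCell c₁ c₂ pA pB) [Nonempty ι] (t : ℝ) :
    traceAbs c₁ c₂ (Sum.map pA pB) (fun _ _ => t) = |t| * meanDisp := by
  have hτ : LatticePeriodic c₁ c₂ fun _ _ => t := fun _ _ => rfl
  have h1 : ∀ k f g, fibre c₁ c₂ (Sum.map pA pB) (fun _ _ => t) (cellMap c₁ c₂ k) *ᵥ
      (planeWave k f g ∘ Sum.map pA pB) =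
      planeWave k (g * star (t * disp k)) (f * (t * disp k)) ∘ Sum.map pA pB := by
    intro k f g
    ext x
    rw [fibre_mulVec h.bijective _ _ (planeWave_siteShift k _ _)]
    rcases x with x | x
    · rw [Sum.map_inl, sum_amp_planeWave_inl, bloch_const]
      simp only [planeWave, Function.comp_apply, Sum.map_inl, Sum.elim_inl]
      ring
    · rw [Sum.map_inr, sum_amp_planeWave_inr, bloch_const]
      simp only [planeWave, Function.comp_apply, Sum.map_inr, Sum.elim_inr]
      ring
  have h2 : ∀ k s, star (sideWave pA pB s k) ⬝ᵥ
        (matAbs (fibre c₁ c₂ (Sum.map pA pB) (fun _ _ => t) (cellMap c₁ c₂ k)) *ᵥ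
          sideWave pA pB s k) = ((Fintype.card ι * (|t| * ‖disp k‖) : ℝ) : ℂ) := by
    intro k s
    have hN : star (t * disp k) * (t * disp k) = ((|t| * ‖disp k‖ : ℝ) : ℂ) ^ 2 := by
      rw [RCLike.star_def, Complex.conj_mul', norm_mul, Complex.norm_real, Real.norm_eq_abs]
    have hev : fibre c₁ c₂ (Sum.map pA pB) (fun _ _ => t) (cellMap c₁ c₂ k) ^ 2 *ᵥ
        sideWave pA pB s k = (((|t| * ‖disp k‖ : ℝ) : ℂ) ^ 2) • sideWave pA pB s k := by
      rw [sq, ← mulVec_mulVec, sideWave, h1, h1, ← hN]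
      ext x
      rcases x with x | x <;>
        simp only [planeWave, Function.comp_apply, Sum.map_inl, Sum.map_inr, Sum.elim_inl,
          Sum.elim_inr, Pi.smul_apply, smul_eq_mul] <;> ring
    rw [matAbs_mulVec_eigenvector (isHermitian_fibre hτ _ _) (by positivity) hev,
      dotProduct_smul, star_dotProduct_self, vecSq_sideWave, smul_eq_mul]
    push_cast
    ring
  rw [traceAbs_eq h hτ]
  simp only [h2, Complex.ofReal_re, integral_const_mul, Fintype.sum_bool]
  have : (Fintype.card ι : ℝ) ≠ 0 := by exact_mod_cast Fintype.card_ne_zero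
  rw [meanDisp]
  field_simp
  ring

end Trace

end Graphene
end

noncomputable section

namespace Graphene

/-! ### The energy of periodic configurations for large rigidity -/

theorem norm_bloch_sq (a : Fin 3 → ℝ) (k : ℝ × ℝ) :
    ‖bloch a k‖ ^ 2 = (∑ i, a i ^ 2) + 2 * (a 0 * a 1) * Real.cos k.1 +
      2 * (a 0 * a 2) * Real.cos k.2 + 2 * (a 1 * a 2) * Real.cos (k.1 - k.2) := by
  have h0 : dot k (dir 0) = 0 := by simp [dot, dir]
  have h1 : dot k (dir 1) = k.1 := by simp [dot, dir]
  have h2 : dot k (dir 2) = k.2 := by simp [dot, dir]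
  rw [← Complex.normSq_eq_norm_sq, bloch, Fin.sum_univ_three, Fin.sum_univ_three, phase, phase,
    phase, h0, h1, h2, exp_I_mul_eq, exp_I_mul_eq, exp_I_mul_eq, Complex.normSq_apply]
  simp only [Complex.add_re, Complex.add_im, Complex.mul_re,
    Complex.mul_im, Complex.ofReal_re, Complex.ofReal_im, Complex.I_re, Complex.I_im,
    Real.cos_zero, Real.sin_zero]
  rw [Real.cos_sub]
  linear_combination a 1 ^ 2 * Real.sin_sq_add_cos_sq k.1 + a 2 ^ 2 * Real.sin_sq_add_cos_sq k.2

theorem integrable_norm_bloch_sq_mul_inv (a : Fin 3 → ℝ) :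
    Integrable (fun k => ‖bloch a k‖ ^ 2 * ‖disp k‖⁻¹) bz ∧
    ∫ k, ‖bloch a k‖ ^ 2 * ‖disp k‖⁻¹ ∂bz =
      (∑ i, a i ^ 2) * (meanInvDisp - meanCosDisp) + (∑ i, a i) ^ 2 * meanCosDisp := by
  have h1 : (fun k => ‖bloch a k‖ ^ 2 * ‖disp k‖⁻¹) = fun k : ℝ × ℝ =>
      (∑ i, a i ^ 2) * ‖disp k‖⁻¹ + 2 * (a 0 * a 1) * (Real.cos k.1 * ‖disp k‖⁻¹) +
      2 * (a 0 * a 2) * (Real.cos k.2 * ‖disp k‖⁻¹) +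
      2 * (a 1 * a 2) * (Real.cos (k.1 - k.2) * ‖disp k‖⁻¹) := by
    ext k
    rw [norm_bloch_sq]
    ring
  have i1 := integrable_inv_norm_disp.const_mul (∑ i, a i ^ 2)
  have i2 := (integrable_cos_mul_inv continuous_fst).const_mul (2 * (a 0 * a 1))
  have i3 := (integrable_cos_mul_inv continuous_snd).const_mul (2 * (a 0 * a 2))
  have i4 := (integrable_cos_mul_inv (g := fun k => k.1 - k.2) (by fun_prop)).const_mul
    (2 * (a 1 * a 2))
  rw [h1]
  refine ⟨((i1.add i2).add i3).add i4, ?_⟩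
  rw [integral_add (by exact (i1.add i2).add i3) i4, integral_add (by exact i1.add i2) i3,
    integral_add i1 i2]
  simp only [integral_const_mul]
  rw [integral_cos_snd, integral_cos_sub, Fin.sum_univ_three, Fin.sum_univ_three]
  unfold meanInvDisp meanCosDisp
  ring

section

variable {ι : Type} [Fintype ι]

theorem integral_sqrt_bloch_le (a : ι → Fin 3 → ℝ) {σ : ℝ} (hσ : 0 < σ) :
    ∫ k, √(Fintype.card ι) * √(∑ j, ‖bloch (a j) k‖ ^ 2) ∂bz ≤
      1 / 2 * (Fintype.card ι * σ * meanDisp + 1 / σ *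
        ((∑ j, ∑ i, a j i ^ 2) * (meanInvDisp - meanCosDisp) +
          (∑ j, (∑ i, a j i) ^ 2) * meanCosDisp)) := by
  set n : ℝ := (Fintype.card ι : ℝ) with hn
  have hn0 : 0 ≤ n := by positivity
  have i1 : Integrable (fun k => ∑ j, ‖bloch (a j) k‖ ^ 2 * ‖disp k‖⁻¹) bz :=
    integrable_finsetSum _ fun j _ => (integrable_norm_bloch_sq_mul_inv (a j)).1
  have i2 : Integrable (fun k => ‖disp k‖) bz := continuous_disp.norm.integrable_bz
  have e1 : ∫ k, ∑ j, ‖bloch (a j) k‖ ^ 2 * ‖disp k‖⁻¹ ∂bz =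
      (∑ j, ∑ i, a j i ^ 2) * (meanInvDisp - meanCosDisp) +
          (∑ j, (∑ i, a j i) ^ 2) * meanCosDisp := by
    rw [integral_finsetSum _ fun j _ => (integrable_norm_bloch_sq_mul_inv (a j)).1,
      Finset.sum_mul, Finset.sum_mul, ← Finset.sum_add_distrib]
    exact Finset.sum_congr rfl fun j _ => (integrable_norm_bloch_sq_mul_inv (a j)).2
  rw [← e1, meanDisp, ← integral_const_mul, ← integral_const_mul, ← integral_add
    (i2.const_mul _) (i1.const_mul _), ← integral_const_mul]
  refine integral_mono_ae ?_ (((i2.const_mul _).add (i1.const_mul _)).const_mul _) ?_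
  · exact (continuous_const.mul (continuous_finsetSum _ fun j _ =>
      (continuous_bloch _).norm.pow 2).sqrt).integrable_bz
  filter_upwards [ae_norm_disp_pos] with k hk
  rw [← Real.sqrt_mul hn0, ← Finset.sum_mul]
  set X := ∑ j, ‖bloch (a j) k‖ ^ 2 with hX
  have hX0 : 0 ≤ X := Finset.sum_nonneg fun _ _ => by positivity
  refine Real.sqrt_le_iff.2 ⟨by positivity, ?_⟩
  have e : n * X = n * σ * ‖disp k‖ * (1 / σ * (X * ‖disp k‖⁻¹)) := by
    field_simp
  rw [e]
  nlinarith [sq_nonneg (n * σ * ‖disp k‖ - 1 / σ * (X * ‖disp k‖⁻¹))]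

variable {c₁ c₂ : ℤ × ℤ} {pA pB : ι → ℤ × ℤ}

theorem sum_transversal_eq (hA : IsTransversal c₁ c₂ pA) (hB : IsTransversal c₁ c₂ pB)
    (d : ℤ × ℤ) {G : ℤ × ℤ → ℝ} (hG : ∀ R r, G (R + latticeVec c₁ c₂ r) = G R) :
    ∑ j, G (pB j + d) = ∑ j, G (pA j) := by
  choose f hf using fun j => hA.2 (pB j + d)
  have hinj : Function.Injective fun j => (f j).1 := by
    intro j l h
    simp only at h
    have h1 := hf j
    have h2 := hf l
    simp only at h1 h2
    rw [h] at h1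
    have h3 : pB j + latticeVec c₁ c₂ 0 =
        pB l + latticeVec c₁ c₂ ((f j).2 - (f l).2) := by
      have e : latticeVec c₁ c₂ ((f j).2 - (f l).2) =
          latticeVec c₁ c₂ (f j).2 - latticeVec c₁ c₂ (f l).2 := by
        simp only [latticeVec, Prod.fst_sub, Prod.snd_sub, sub_smul]; abel
      have e0 : latticeVec c₁ c₂ 0 = 0 := by simp [latticeVec]
      rw [e, e0, add_zero]
      have h1' : pB j = pA (f l).1 + latticeVec c₁ c₂ (f j).2 - d := by rw [h1]; abel
      have h2' : pB l = pA (f l).1 + latticeVec c₁ c₂ (f l).2 - d := by rw [h2]; abel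
      rw [h1', h2']; abel
    have := hB.1 (a₁ := (j, 0)) (a₂ := (l, _)) h3
    exact (Prod.mk.inj this).1
  rw [← (Equiv.ofBijective _ (Finite.injective_iff_bijective.1 hinj)).sum_comp fun j => G (pA j)]
  refine Finset.sum_congr rfl fun j _ => ?_
  rw [Equiv.ofBijective_apply, ← hf j, hG]

theorem sum_bondRow_eq (hA : IsTransversal c₁ c₂ pA) (hB : IsTransversal c₁ c₂ pB) {τ : Config}
    (hτ : LatticePeriodic c₁ c₂ τ) (g : ℝ → ℝ) (s : Bool) :
    ∑ j, ∑ i, g (bondRow pA pB τ s j i) = ∑ j, ∑ i, g (τ (pA j) i) := by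
  cases s
  · simp [bondRow]
  · simp only [bondRow, if_true]
    rw [Finset.sum_comm, Finset.sum_comm (s := Finset.univ) (t := Finset.univ)
      (f := fun j i => g (τ (pA j) i))]
    exact Finset.sum_congr rfl fun i _ => sum_transversal_eq hA hB (dir i)
      (G := fun R => g (τ R i)) fun R r => by rw [hτ]

variable [DecidableEq ι]

/-- The energy per atom of a configuration that is periodic with respect to a unit cell. -/
def cellEnergy (μ : ℝ) (c₁ c₂ : ℤ × ℤ) (pA pB : ι → ℤ × ℤ) (τ : Config) : ℝ :=
  - traceAbs c₁ c₂ (Sum.map pA pB) τ +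
    μ / 2 * (1 / (2 * (Fintype.card ι : ℝ))) * ∑ j, ∑ i, (τ (pA j) i - 1) ^ 2

theorem three_mul_sum_sq_sub_le (a : Fin 3 → ℝ) (σ : ℝ) :
    3 * ∑ i, a i ^ 2 - (∑ i, a i) ^ 2 ≤ 3 * ∑ i, (a i - σ) ^ 2 := by
  simp only [Fin.sum_univ_three]
  nlinarith [sq_nonneg (a 0 + a 1 + a 2 - 3 * σ)]

theorem one_lt_tStar {μ : ℝ} (hμ : 0 < μ) : 1 < tStar μ := by
  rw [tStar_eq]
  have := meanDisp_pos
  have : 0 < 2 / (3 * μ) * meanDisp := by positivity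
  linarith

theorem cellEnergy_const [Nonempty ι] (h : IsCell c₁ c₂ pA pB) {μ t : ℝ} :
    cellEnergy μ c₁ c₂ pA pB (fun _ _ => t) = 3 * μ / 4 * (t - 1) ^ 2 - |t| * meanDisp := by
  have : (Fintype.card ι : ℝ) ≠ 0 := by exact_mod_cast Fintype.card_ne_zero
  rw [cellEnergy, traceAbs_const h]
  simp only [Finset.sum_const, Finset.card_univ, Fintype.card_fin, nsmul_eq_mul]
  field_simp
  push_cast
  ring

theorem cellEnergy_ge [Nonempty ι] (h : IsCell c₁ c₂ pA pB) {μ : ℝ} (hμ : 0 < μ) {τ : Config}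
    (hτ : LatticePeriodic c₁ c₂ τ) :
    cellEnergy μ c₁ c₂ pA pB (fun _ _ => tStar μ) +
      (μ - 6 * meanInvDisp) / (4 * Fintype.card ι * tStar μ) *
        ∑ j, ∑ i, (τ (pA j) i - tStar μ) ^ 2 ≤ cellEnergy μ c₁ c₂ pA pB τ := by
  have hn : (0 : ℝ) < Fintype.card ι := by exact_mod_cast Fintype.card_pos
  have hσ : 0 < tStar μ := by linarith [one_lt_tStar hμ]
  have hσ' : 3 * μ * (tStar μ - 1) = 2 * meanDisp := by
    rw [tStar_eq]; field_simp; ring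
  rw [cellEnergy_const h, abs_of_pos hσ]
  set σ := tStar μ with hσdef
  set n : ℝ := (Fintype.card ι : ℝ) with hndef
  have hT := traceAbs_le h hτ
  rw [Fintype.sum_bool, ← hndef] at hT
  have hb := fun s => integral_sqrt_bloch_le (bondRow pA pB τ s) hσ
  simp only [← hndef] at hb
  have hbt := hb true
  have hbf := hb false
  set Y := ∑ j, ∑ i, τ (pA j) i ^ 2 with hY
  set S := ∑ j, ∑ i, τ (pA j) i with hS
  set D := ∑ j, ∑ i, (τ (pA j) i - σ) ^ 2 with hD
  have hYs : ∀ s, ∑ j, ∑ i, bondRow pA pB τ s j i ^ 2 = Y :=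
    sum_bondRow_eq h.transA h.transB hτ fun x => x ^ 2
  have hDs : ∀ s, ∑ j, ∑ i, (bondRow pA pB τ s j i - σ) ^ 2 = D :=
    sum_bondRow_eq h.transA h.transB hτ fun x => (x - σ) ^ 2
  rw [hYs] at hbt hbf
  have hW : ∀ s, 3 * Y - ∑ j, (∑ i, bondRow pA pB τ s j i) ^ 2 ≤ 3 * D ∧
      0 ≤ 3 * Y - ∑ j, (∑ i, bondRow pA pB τ s j i) ^ 2 := by
    intro s
    rw [← hDs s, ← hYs s, Finset.mul_sum, Finset.mul_sum, ← Finset.sum_sub_distrib]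
    constructor
    · exact Finset.sum_le_sum fun j _ => three_mul_sum_sq_sub_le _ _
    · refine Finset.sum_nonneg fun j _ => ?_
      have := sq_nonneg (bondRow pA pB τ s j 0 - bondRow pA pB τ s j 1)
      have := sq_nonneg (bondRow pA pB τ s j 0 - bondRow pA pB τ s j 2)
      have := sq_nonneg (bondRow pA pB τ s j 1 - bondRow pA pB τ s j 2)
      simp only [Fin.sum_univ_three]
      nlinarith
  have hsum : ∀ c : ℝ, ∑ j, ∑ i, (τ (pA j) i - c) ^ 2 = Y - 2 * c * S + 3 * n * c ^ 2 := by
    intro c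
    have : ∀ j i, (τ (pA j) i - c) ^ 2 = τ (pA j) i ^ 2 - 2 * c * τ (pA j) i + c ^ 2 :=
      fun j i => by ring
    simp only [this, Finset.sum_add_distrib, Finset.sum_sub_distrib, ← Finset.mul_sum,
      Finset.sum_const, Finset.card_univ, Fintype.card_fin, nsmul_eq_mul]
    push_cast
    ring
  have hDe : D = Y - 2 * σ * S + 3 * n * σ ^ 2 := hsum σ
  rw [cellEnergy, hsum 1, ← hndef]
  obtain ⟨wt1, wt0⟩ := hW true
  obtain ⟨wf1, wf0⟩ := hW false
  set Wt := ∑ j, (∑ i, bondRow pA pB τ true j i) ^ 2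
  set Wf := ∑ j, (∑ i, bondRow pA pB τ false j i) ^ 2
  have hI := abs_le.1 abs_meanCosDisp_le
  have hJ := meanInvDisp_nonneg
  have hc := meanDisp_eq
  set J := meanInvDisp
  set I := meanCosDisp
  have key : traceAbs c₁ c₂ (Sum.map pA pB) τ ≤
      σ * meanDisp / 2 + (Y * meanDisp / 3 * 2 + 6 * D * J) / (4 * n * σ) := by
    refine hT.trans ?_
    have h1 : Y * (J - I) + Wt * I ≤ Y * meanDisp / 3 + 3 * D * J := by
      rw [hc]; nlinarith
    have h2 : Y * (J - I) + Wf * I ≤ Y * meanDisp / 3 + 3 * D * J := by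
      rw [hc]; nlinarith
    have h3 : 1 / (2 * n) * (1 / 2 * (n * σ * meanDisp + 1 / σ * (Y * (J - I) + Wt * I)) +
        1 / 2 * (n * σ * meanDisp + 1 / σ * (Y * (J - I) + Wf * I))) =
        σ * meanDisp / 2 + ((Y * (J - I) + Wt * I) + (Y * (J - I) + Wf * I)) / (4 * n * σ) := by
      field_simp; ring
    refine (mul_le_mul_of_nonneg_left (add_le_add hbt hbf) (by positivity)).trans ?_
    rw [h3]
    exact add_le_add le_rfl (div_le_div_of_nonneg_right (by linarith) (by positivity))
  have fin : 3 * μ / 4 * (σ - 1) ^ 2 - σ * meanDisp + (μ - 6 * J) / (4 * n * σ) * D =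
      -(σ * meanDisp / 2 + (Y * meanDisp / 3 * 2 + 6 * D * J) / (4 * n * σ)) +
        μ / 2 * (1 / (2 * n)) * (Y - 2 * 1 * S + 3 * n * 1 ^ 2) := by
    have hm : meanDisp = 3 * μ * (σ - 1) / 2 := by linarith
    rw [hm, hDe]
    field_simp
    ring
  rw [fin]
  linarith

/-- For large rigidity the constant configuration is the unique minimizer. -/
theorem cellEnergy_minimizer [Nonempty ι] (h : IsCell c₁ c₂ pA pB) {μ : ℝ}
    (hμ : 6 * meanInvDisp < μ) {τ : Config} (hτ : LatticePeriodic c₁ c₂ τ) :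
    cellEnergy μ c₁ c₂ pA pB (fun _ _ => tStar μ) ≤ cellEnergy μ c₁ c₂ pA pB τ ∧
    (cellEnergy μ c₁ c₂ pA pB τ ≤ cellEnergy μ c₁ c₂ pA pB (fun _ _ => tStar μ) →
      τ = fun _ _ => tStar μ) := by
  have hμ0 : 0 < μ := by linarith [meanInvDisp_nonneg]
  have hge := cellEnergy_ge h hμ0 hτ
  have hn : (0 : ℝ) < Fintype.card ι := by exact_mod_cast Fintype.card_pos
  have hσ : 0 < tStar μ := by linarith [one_lt_tStar hμ0]
  have hcoef : 0 < (μ - 6 * meanInvDisp) / (4 * Fintype.card ι * tStar μ) :=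
    div_pos (by linarith) (by positivity)
  have hD : 0 ≤ ∑ j, ∑ i, (τ (pA j) i - tStar μ) ^ 2 :=
    Finset.sum_nonneg fun _ _ => Finset.sum_nonneg fun _ _ => sq_nonneg _
  refine ⟨by nlinarith, fun hle => ?_⟩
  have hD0 : ∑ j, ∑ i, (τ (pA j) i - tStar μ) ^ 2 = 0 := by
    refine le_antisymm ?_ hD
    by_contra! hlt
    have := mul_pos hcoef hlt
    linarith
  rw [Finset.sum_eq_zero_iff_of_nonneg fun _ _ => Finset.sum_nonneg fun _ _ => sq_nonneg _] at hD0
  have hcell : ∀ j i, τ (pA j) i = tStar μ := fun j i => by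
    have h1 := hD0 j (Finset.mem_univ _)
    rw [Finset.sum_eq_zero_iff_of_nonneg fun _ _ => sq_nonneg _] at h1
    exact sub_eq_zero.1 (pow_eq_zero_iff two_ne_zero |>.1 (h1 i (Finset.mem_univ _)))
  ext R i
  obtain ⟨⟨j, r⟩, hR⟩ := h.transA.2 R
  simp only at hR
  rw [← hR, hτ, hcell]

end

/-! ### The supercells -/

theorem superCell_isTransversal {L : ℕ} (hL : 1 ≤ L) :
    IsTransversal ((L : ℤ), 0) (0, (L : ℤ)) (cellVec (L := L)) := by
  have hL' : (0 : ℤ) < L := by exact_mod_cast hL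
  constructor
  · rintro ⟨⟨a, b⟩, r⟩ ⟨⟨c, d⟩, s⟩ h
    simp only [cellVec, latticeVec, Prod.ext_iff, Prod.fst_add, Prod.snd_add, Prod.smul_fst,
      Prod.smul_snd, smul_eq_mul, mul_zero, add_zero, zero_add] at h
    obtain ⟨h1, h2⟩ := h
    have ha : ((a : ℕ) : ℤ) < L := by exact_mod_cast a.2
    have hb : ((b : ℕ) : ℤ) < L := by exact_mod_cast b.2
    have hc : ((c : ℕ) : ℤ) < L := by exact_mod_cast c.2
    have hd : ((d : ℕ) : ℤ) < L := by exact_mod_cast d.2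
    have e1 : ((a : ℕ) : ℤ) = (c : ℕ) := by
      have := congrArg (· % (L : ℤ)) h1
      simpa [Int.add_mul_emod_self_right, Int.emod_eq_of_lt, ha, hc] using this
    have e2 : ((b : ℕ) : ℤ) = (d : ℕ) := by
      have := congrArg (· % (L : ℤ)) h2
      simpa [Int.add_mul_emod_self_right, Int.emod_eq_of_lt, hb, hd] using this
    rw [e1] at h1
    rw [e2] at h2
    have e3 : r.1 = s.1 := mul_right_cancel₀ hL'.ne' (add_left_cancel h1)
    have e4 : r.2 = s.2 := mul_right_cancel₀ hL'.ne' (add_left_cancel h2)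
    have e5 : a = c := Fin.ext (by exact_mod_cast e1)
    have e6 : b = d := Fin.ext (by exact_mod_cast e2)
    rw [e5, e6, Prod.ext e3 e4]
  · rintro ⟨x, y⟩
    have hx0 := Int.emod_nonneg x hL'.ne'
    have hy0 := Int.emod_nonneg y hL'.ne'
    have hx1 := Int.emod_lt_of_pos x hL'
    have hy1 := Int.emod_lt_of_pos y hL'
    refine ⟨((⟨(x % L).toNat, by omega⟩, ⟨(y % L).toNat, by omega⟩), (x / L, y / L)), ?_⟩
    simp only [cellVec, latticeVec, Int.toNat_of_nonneg hx0, Int.toNat_of_nonneg hy0]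
    ext
    · simp [mul_comm, Int.emod_add_mul_ediv]
    · simp [mul_comm, Int.emod_add_mul_ediv]

theorem exp_two_pi_div_ne_one {L : ℕ} (hL : 1 ≤ L) {a b : Fin L} (h : a ≠ b) :
    Complex.exp (Complex.I * ((2 * Real.pi / L * (((b : ℕ) : ℤ) - ((a : ℕ) : ℤ) : ℤ) : ℝ) : ℂ))
      ≠ 1 := by
  intro h1
  rw [Complex.exp_eq_one_iff] at h1
  obtain ⟨m, hm⟩ := h1
  have hL0 : (L : ℝ) ≠ 0 := by positivity
  have hL0' : (L : ℂ) ≠ 0 := by exact_mod_cast hL0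
  have hπ : (Real.pi : ℂ) ≠ 0 := by exact_mod_cast Real.pi_ne_zero
  have h2 : (((b : ℕ) : ℤ) - ((a : ℕ) : ℤ) : ℂ) = m * L := by
    push_cast at hm
    field_simp at hm
    have := Complex.I_ne_zero
    push_cast
    linear_combination hm
  have h3 : ((b : ℕ) : ℤ) - ((a : ℕ) : ℤ) = m * L := by exact_mod_cast h2
  have ha := a.2
  have hb := b.2
  rcases lt_trichotomy m 0 with hm0 | hm0 | hm0
  · nlinarith
  · rw [hm0, zero_mul] at h3
    exact h (Fin.ext (by omega))
  · nlinarith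

theorem superCell_charactersSeparate {L : ℕ} (hL : 1 ≤ L) :
    CharactersSeparate ((L : ℤ), 0) (0, (L : ℤ)) (cellVec (L := L)) := by
  have hL0 : (L : ℝ) ≠ 0 := by positivity
  rintro ⟨a, b⟩ ⟨c, d⟩ hne
  by_cases h : a = c
  · have h' : b ≠ d := fun h' => hne (by rw [h, h'])
    refine ⟨(0, 2 * Real.pi / L), ⟨0, 1, ?_⟩, ?_⟩
    · ext <;> simp [cellMap, dot, hL0]
    · convert exp_two_pi_div_ne_one hL h' using 4
      simp [phase, dot, cellVec]
  · refine ⟨(2 * Real.pi / L, 0), ⟨1, 0, ?_⟩, ?_⟩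
    · ext <;> simp [cellMap, dot, hL0]
    · convert exp_two_pi_div_ne_one hL h using 4
      simp [phase, dot, cellVec]

theorem superCell_isCell {L : ℕ} (hL : 1 ≤ L) :
    IsCell ((L : ℤ), 0) (0, (L : ℤ)) (cellVec (L := L)) (cellVec (L := L)) where
  det_ne := by
    have : (0 : ℤ) < L := by exact_mod_cast hL
    simp only [mul_zero, sub_zero]
    positivity
  transA := superCell_isTransversal hL
  transB := superCell_isTransversal hL
  sepA := superCell_charactersSeparate hL
  sepB := superCell_charactersSeparate hL

theorem IsPeriodic.latticePeriodic {L : ℕ} {τ : Config} (h : IsPeriodic L τ) :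
    LatticePeriodic ((L : ℤ), 0) (0, (L : ℤ)) τ := by
  have h1 : Function.Periodic τ ((L : ℤ), 0) := fun R => (h R).1
  have h2 : Function.Periodic τ (0, (L : ℤ)) := fun R => (h R).2
  intro R r
  rw [latticeVec, ← add_assoc, h2.zsmul r.2, h1.zsmul r.1]

theorem energy_eq_cellEnergy (μ : ℝ) (L : ℕ) (τ : Config) :
    energy μ L τ = cellEnergy μ ((L : ℤ), 0) (0, (L : ℤ)) (cellVec (L := L)) cellVec τ := by
  rw [energy, cellEnergy, superCell, Fintype.card_prod, Fintype.card_fin]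
  push_cast
  rw [← sq]

theorem isMinOn_energy_iff {μ : ℝ} (hμ : 6 * meanInvDisp < μ) {L : ℕ} (hL : 1 ≤ L) (τ : Config) :
    (IsPeriodic L τ ∧ IsMinOn (energy μ L) {τ' | IsPeriodic L τ'} τ) ↔
      τ = fun _ _ => tStar μ := by
  have : Nonempty (Fin L × Fin L) := ⟨(⟨0, hL⟩, ⟨0, hL⟩)⟩
  have hc : IsPeriodic L fun _ _ => tStar μ := fun _ => ⟨rfl, rfl⟩
  have key := fun {τ'} (h : IsPeriodic L τ') =>
    cellEnergy_minimizer (superCell_isCell hL) hμ h.latticePeriodic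
  simp only [← energy_eq_cellEnergy] at key
  constructor
  · rintro ⟨h1, h2⟩
    exact (key h1).2 (h2 hc)
  · rintro rfl
    exact ⟨hc, fun τ' h' => (key h').1⟩

end Graphene
end

noncomputable section

namespace Graphene

/-! ### The hexagonal unit cell of the three-amplitude configurations -/

/-- The cells of the three atoms `Sum.inl` of the hexagonal unit cell. -/
def hexA : Fin 3 → ℤ × ℤ := ![(0, 0), (1, 0), (1, -1)]

/-- The cells of the three atoms `Sum.inr` of the hexagonal unit cell. -/
def hexB : Fin 3 → ℤ × ℤ := ![(0, 0), (1, -1), (0, -1)]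

theorem hexCell_eq : hexCell = Sum.map hexA hexB := rfl

theorem latticeVec_hex (r : ℤ × ℤ) :
    latticeVec (2, -1) (-1, 2) r = (2 * r.1 - r.2, 2 * r.2 - r.1) := by
  ext <;> simp [latticeVec] <;> ring

theorem hexA_isTransversal : IsTransversal (2, -1) (-1, 2) hexA := by
  constructor
  · rintro ⟨a, r1, r2⟩ ⟨b, s1, s2⟩ h
    simp only [latticeVec_hex, Prod.ext_iff, Prod.fst_add, Prod.snd_add] at h
    fin_cases a <;> fin_cases b <;> simp [hexA] at h ⊢ <;> omega
  · rintro ⟨x, y⟩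
    have h : (x - y) % 3 = 0 ∨ (x - y) % 3 = 1 ∨ (x - y) % 3 = 2 := by omega
    rcases h with h | h | h
    · refine ⟨(0, ((2 * x + y) / 3, (x + 2 * y) / 3)), ?_⟩
      simp only [latticeVec_hex]
      ext <;> simp [hexA] <;> omega
    · refine ⟨(1, ((2 * (x - 1) + y) / 3, ((x - 1) + 2 * y) / 3)), ?_⟩
      simp only [latticeVec_hex]
      ext <;> simp [hexA] <;> omega
    · refine ⟨(2, ((2 * (x - 1) + (y + 1)) / 3, ((x - 1) + 2 * (y + 1)) / 3)), ?_⟩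
      simp only [latticeVec_hex]
      ext <;> simp [hexA] <;> omega

theorem hexB_isTransversal : IsTransversal (2, -1) (-1, 2) hexB := by
  constructor
  · rintro ⟨a, r1, r2⟩ ⟨b, s1, s2⟩ h
    simp only [latticeVec_hex, Prod.ext_iff, Prod.fst_add, Prod.snd_add] at h
    fin_cases a <;> fin_cases b <;> simp [hexB] at h ⊢ <;> omega
  · rintro ⟨x, y⟩
    have h : (x - y) % 3 = 0 ∨ (x - y) % 3 = 1 ∨ (x - y) % 3 = 2 := by omega
    rcases h with h | h | h
    · refine ⟨(0, ((2 * x + y) / 3, (x + 2 * y) / 3)), ?_⟩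
      simp only [latticeVec_hex]
      ext <;> simp [hexB] <;> omega
    · refine ⟨(2, ((2 * x + (y + 1)) / 3, (x + 2 * (y + 1)) / 3)), ?_⟩
      simp only [latticeVec_hex]
      ext <;> simp [hexB] <;> omega
    · refine ⟨(1, ((2 * (x - 1) + (y + 1)) / 3, ((x - 1) + 2 * (y + 1)) / 3)), ?_⟩
      simp only [latticeVec_hex]
      ext <;> simp [hexB] <;> omega

theorem phase_third_ne_one {R : ℤ × ℤ} (h : ¬ (3 : ℤ) ∣ R.1 - R.2) :
    phase (2 * Real.pi / 3, -(2 * Real.pi / 3)) R ≠ 1 := by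
  intro h1
  rw [phase, Complex.exp_eq_one_iff] at h1
  obtain ⟨m, hm⟩ := h1
  have hπ : (Real.pi : ℂ) ≠ 0 := by exact_mod_cast Real.pi_ne_zero
  have h2 : ((R.1 - R.2 : ℤ) : ℂ) = (3 * m : ℤ) := by
    simp only [dot] at hm
    push_cast at hm ⊢
    have hI := Complex.I_ne_zero
    have : (2 * Real.pi * Complex.I / 3) * (R.1 - R.2 - 3 * m) = 0 := by
      linear_combination hm
    have h3 : (2 * Real.pi * Complex.I / 3 : ℂ) ≠ 0 := by
      refine div_ne_zero (mul_ne_zero (mul_ne_zero two_ne_zero hπ) hI) (by norm_num)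
    linear_combination (mul_eq_zero.1 this).resolve_left h3
  exact h ⟨m, by exact_mod_cast h2⟩

theorem cellMap_third : cellMap (2, -1) (-1, 2) (2 * Real.pi / 3, -(2 * Real.pi / 3)) =
    ((1 : ℤ) * (2 * Real.pi), (-1 : ℤ) * (2 * Real.pi)) := by
  ext <;> simp only [cellMap, dot] <;> push_cast <;> ring

theorem hexCell_isCell : IsCell (2, -1) (-1, 2) hexA hexB where
  det_ne := by norm_num
  transA := hexA_isTransversal
  transB := hexB_isTransversal
  sepA := fun x y hxy => ⟨_, ⟨1, -1, cellMap_third⟩, phase_third_ne_one (by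
    fin_cases x <;> fin_cases y <;> simp [hexA] at hxy ⊢)⟩
  sepB := fun x y hxy => ⟨_, ⟨1, -1, cellMap_third⟩, phase_third_ne_one (by
    fin_cases x <;> fin_cases y <;> simp [hexB] at hxy ⊢)⟩

theorem bondLabel_eq_iff (R S : ℤ × ℤ) (i j : Fin 3) : bondLabel R i = bondLabel S j ↔
    (R.2 - R.1 - (i : ℕ)) % 3 = (S.2 - S.1 - (j : ℕ)) % 3 := by
  unfold bondLabel
  split_ifs <;> simp <;> omega

theorem kekule_latticePeriodic (w : Fin 3 → ℝ) : LatticePeriodic (2, -1) (-1, 2) (kekule w) := by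
  intro R r
  ext i
  rw [kekule, kekule, (bondLabel_eq_iff _ R i i).2]
  rw [latticeVec_hex]
  simp only [Prod.fst_add, Prod.snd_add]
  omega

theorem bondLabel_hexA (j i : Fin 3) :
    bondLabel (hexA j) i = ![![0, 2, 1], ![2, 1, 0], ![1, 0, 2]] j i := by
  fin_cases j <;> fin_cases i <;> rfl

theorem sum_kekule_hexA (w : Fin 3 → ℝ) (g : ℝ → ℝ) :
    ∑ j, ∑ i, g (kekule w (hexA j) i) = 3 * ∑ l, g (w l) := by
  simp only [kekule, bondLabel_hexA, Fin.sum_univ_three]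
  simp
  ring

theorem kekuleEnergy_eq_cellEnergy (μ : ℝ) (w : Fin 3 → ℝ) :
    kekuleEnergy μ w = cellEnergy μ (2, -1) (-1, 2) hexA hexB (kekule w) := by
  rw [kekuleEnergy, cellEnergy, hexCell_eq, sum_kekule_hexA w fun x => (x - 1) ^ 2,
    Fin.sum_univ_three, Fintype.card_fin]
  push_cast
  ring

theorem isMinOn_kekuleEnergy_iff {μ : ℝ} (hμ : 6 * meanInvDisp < μ) (w : Fin 3 → ℝ) :
    IsMinOn (kekuleEnergy μ) univ w ↔ w = fun _ => tStar μ := by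
  have hc : kekule (fun _ => tStar μ) = fun _ _ => tStar μ := rfl
  have key := fun w' => cellEnergy_minimizer hexCell_isCell hμ (kekule_latticePeriodic w')
  rw [← hc] at key
  simp only [← kekuleEnergy_eq_cellEnergy] at key
  constructor
  · intro h
    have h1 := (key w).2 (h (mem_univ _))
    ext l
    have h2 : ∃ i, bondLabel 0 i = l := by
      fin_cases l
      · exact ⟨0, rfl⟩
      · exact ⟨2, rfl⟩
      · exact ⟨1, rfl⟩
    obtain ⟨i, rfl⟩ := h2
    exact congrFun (congrFun h1 0) i
  · rintro rfl w' -
    exact (key w').1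

/-! ### The spectrum of the tight-binding operator at zero -/

theorem norm_hopTerm_le {a : Site → ℝ} {C : ℝ} (hC : ∀ x, |a x| ≤ C) (i : Fin 3) :
    ‖hopTerm a ⟨C, hC⟩ i‖ ≤ C := by
  have h0 : 0 ≤ C := (abs_nonneg _).trans (hC (Sum.inl 0))
  refine ContinuousLinearMap.opNorm_le_bound _ h0 fun f => ?_
  exact lp.norm_le_of_forall_sum_le (by norm_num) (mul_nonneg h0 (norm_nonneg _))
    (sum_hop_term_le hC i f)

theorem norm_hoppingOperator_le {τ : Config} {C : ℝ} (hC : ∀ R i, |τ R i| ≤ C) :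
    ‖hoppingOperator τ ⟨C, hC⟩‖ ≤ 3 * C := by
  refine (norm_sum_le _ _).trans ?_
  refine (Finset.sum_le_sum fun i _ => norm_hopTerm_le (abs_amp_le hC i) i).trans_eq ?_
  simp

theorem kekuleOperator_apply (w : Fin 3 → ℝ) (f : Ell2) (x : Site) :
    kekuleOperator w f x = ∑ i : Fin 3, (amp (kekule w) i x : ℂ) * f (nbr i x) :=
  hoppingOperator_apply _ _ f x

theorem norm_kekuleOperator_le {w : Fin 3 → ℝ} {C : ℝ} (hC : ∀ l, |w l| ≤ C) :
    ‖kekuleOperator w‖ ≤ 3 * C :=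
  norm_hoppingOperator_le (τ := kekule w) fun R i => hC (bondLabel R i)

theorem kekuleOperator_add (w w' : Fin 3 → ℝ) :
    kekuleOperator (w + w') = kekuleOperator w + kekuleOperator w' := by
  ext f x
  rw [_root_.add_apply, lp.coeFn_add, Pi.add_apply, kekuleOperator_apply,
    kekuleOperator_apply, kekuleOperator_apply, ← Finset.sum_add_distrib]
  refine Finset.sum_congr rfl fun i _ => ?_
  rcases x with R | R <;> simp [amp, kekule] <;> ring

theorem kekuleOperator_smul (c : ℝ) (w : Fin 3 → ℝ) :
    kekuleOperator (c • w) = (c : ℂ) • kekuleOperator w := by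
  ext f x
  rw [_root_.smul_apply, lp.coeFn_smul, Pi.smul_apply, kekuleOperator_apply,
    kekuleOperator_apply, smul_eq_mul, Finset.mul_sum]
  refine Finset.sum_congr rfl fun i _ => ?_
  rcases x with R | R <;> simp [amp, kekule] <;> ring

/-- The label of the bond in direction `i` at a site. -/
def siteLabel (x : Site) (i : Fin 3) : Fin 3 :=
  match x with
  | Sum.inl R => bondLabel R i
  | Sum.inr R => bondLabel (R + dir i) i

theorem amp_kekule (w : Fin 3 → ℝ) (i : Fin 3) (x : Site) :
    amp (kekule w) i x = w (siteLabel x i) := by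
  rcases x with R | R <;> rfl

theorem siteLabel_nbr (x : Site) (i : Fin 3) : siteLabel (nbr i x) i = siteLabel x i := by
  rcases x with R | R <;> simp [siteLabel, nbr]

theorem siteLabel_bijective (x : Site) : Function.Bijective (siteLabel x) := by
  refine Finite.injective_iff_bijective.1 fun i j h => ?_
  rcases x with R | R
  · simp only [siteLabel, bondLabel_eq_iff] at h
    fin_cases i <;> fin_cases j <;> simp at h ⊢ <;> omega
  · simp only [siteLabel, bondLabel_eq_iff] at h
    fin_cases i <;> fin_cases j <;> simp [dir] at h ⊢ <;> omega

theorem kekuleOperator_single_apply (l : Fin 3) (f : Ell2) (x : Site) {i : Fin 3}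
    (hi : siteLabel x i = l) : kekuleOperator (Pi.single l 1) f x = f (nbr i x) := by
  rw [kekuleOperator_apply, Finset.sum_eq_single i]
  · simp [amp_kekule, hi]
  · intro j _ hj
    have : siteLabel x j ≠ l := fun h => hj ((siteLabel_bijective x).1 (h.trans hi.symm))
    simp [amp_kekule, this]
  · simp

theorem kekuleOperator_single_sq (l : Fin 3) :
    kekuleOperator (Pi.single l 1) * kekuleOperator (Pi.single l 1) = 1 := by
  ext f x
  obtain ⟨i, hi⟩ := (siteLabel_bijective x).2 l
  change kekuleOperator _ (kekuleOperator _ f) x = f x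
  rw [kekuleOperator_single_apply l _ x hi,
    kekuleOperator_single_apply l _ (nbr i x) ((siteLabel_nbr x i).trans hi), nbr_nbr]

/-- The operator is invertible if one amplitude dominates the other two. -/
theorem zero_notMem_spectrum_kekuleOperator {w : Fin 3 → ℝ} {l : Fin 3}
    (h : ∀ m, m ≠ l → 10 * |w m| ≤ |w l|) (hl : w l ≠ 0) :
    (0 : ℂ) ∉ spectrum ℂ (kekuleOperator w) := by
  rw [spectrum.zero_notMem_iff]
  set V := kekuleOperator (Pi.single l 1) with hV
  set w' : Fin 3 → ℝ := w - w l • Pi.single l 1 with hw'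
  set T' := kekuleOperator w' with hT'
  have hV2 : V * V = 1 := kekuleOperator_single_sq l
  have hVn : ‖V‖ ≤ 3 := by
    have := norm_kekuleOperator_le (w := Pi.single l 1) (C := 1) fun m => by
      by_cases hm : m = l <;> simp [hm]
    linarith
  have hT'n : ‖T'‖ ≤ 3 * (|w l| / 10) := by
    refine norm_kekuleOperator_le fun m => ?_
    by_cases hm : m = l
    · subst hm
      simp [hw']
      positivity
    · have := h m hm
      simp [hw', hm]
      linarith
  have hT : kekuleOperator w = (w l : ℂ) • V + T' := by
    rw [hV, hT', ← kekuleOperator_smul, ← kekuleOperator_add, hw']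
    congr 1
    abel
  have hwl : (w l : ℂ) ≠ 0 := by exact_mod_cast hl
  have hlt : ‖-((w l : ℂ)⁻¹ • (V * T'))‖ < 1 := by
    rw [norm_neg, norm_smul, norm_inv, Complex.norm_real, Real.norm_eq_abs,
      inv_mul_lt_iff₀ (abs_pos.2 hl), mul_one]
    have h1 : ‖V * T'‖ ≤ ‖V‖ * ‖T'‖ := norm_mul_le _ _
    have h2 : ‖V‖ * ‖T'‖ ≤ 3 * (3 * (|w l| / 10)) :=
      mul_le_mul hVn hT'n (norm_nonneg _) (by norm_num)
    have := abs_pos.2 hl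
    linarith
  have hu := isUnit_one_sub_of_norm_lt_one hlt
  have hVu : IsUnit V := ⟨⟨V, V, hV2, hV2⟩, rfl⟩
  have hcu : IsUnit ((w l : ℂ) • (1 : Ell2 →L[ℂ] Ell2)) :=
    (isUnit_one (M := Ell2 →L[ℂ] Ell2)).smul (Units.mk0 _ hwl)
  have e : kekuleOperator w = ((w l : ℂ) • (1 : Ell2 →L[ℂ] Ell2)) * (V *
      (1 - -((w l : ℂ)⁻¹ • (V * T')))) := by
    rw [sub_neg_eq_add, mul_add, mul_one, mul_smul_comm, ← mul_assoc, hV2, one_mul, smul_mul_assoc,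
      one_mul, smul_add, smul_smul, mul_inv_cancel₀ hwl, one_smul, hT]
  rw [e]
  exact hcu.mul (hVu.mul hu)

end Graphene
end

noncomputable section

namespace Graphene

/-! ### The pristine operator is gapless -/

/-- The Dirac point. -/
def diracPoint : ℝ × ℝ := (2 * Real.pi / 3, 4 * Real.pi / 3)

theorem disp_diracPoint : disp diracPoint = 0 := by
  have hc : Real.cos (2 * Real.pi / 3) = -1 / 2 := by
    rw [show 2 * Real.pi / 3 = Real.pi - Real.pi / 3 by ring, Real.cos_pi_sub,
      Real.cos_pi_div_three]
    norm_num
  have e : 4 * Real.pi / 3 = 2 * Real.pi - 2 * Real.pi / 3 := by ring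
  have hc' : Real.cos (4 * Real.pi / 3) = -1 / 2 := by rw [e, Real.cos_two_pi_sub, hc]
  have hs' : Real.sin (4 * Real.pi / 3) = - Real.sin (2 * Real.pi / 3) := by
    rw [e, Real.sin_two_pi_sub]
  rw [disp, diracPoint, exp_I_mul_eq, exp_I_mul_eq, hc, hc', hs']
  push_cast
  ring

/-- An exponentially decaying weight on the lattice. -/
def decay (r : ℝ) (R : ℤ × ℤ) : ℝ := r ^ R.1.natAbs * r ^ R.2.natAbs

theorem decay_pos {r : ℝ} (hr : 0 < r) (R : ℤ × ℤ) : 0 < decay r R := by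
  unfold decay
  positivity

theorem abs_pow_natAbs_succ_sub_le {r : ℝ} (hr : 0 < r) (hr1 : r < 1) (n : ℤ) :
    |r ^ (n + 1).natAbs - r ^ n.natAbs| ≤ (1 / r - 1) * r ^ n.natAbs := by
  have hinv : 1 / r * r = 1 := by field_simp
  have h1 : 1 < 1 / r := by rw [lt_div_iff₀ hr]; linarith
  rcases le_or_gt 0 n with hn | hn
  · rw [show (n + 1).natAbs = n.natAbs + 1 by omega, pow_succ]
    have hp : 0 < r ^ n.natAbs := by positivity
    have h2 : 1 - r ≤ 1 / r - 1 := by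
      have : 0 ≤ (1 / r - 1) * (1 - r) := mul_nonneg (by linarith) (by linarith)
      linarith
    rw [abs_le]
    constructor <;> nlinarith
  · obtain ⟨m, hm⟩ : ∃ m, n.natAbs = m + 1 := ⟨n.natAbs - 1, by omega⟩
    rw [show (n + 1).natAbs = m by omega, hm, pow_succ]
    have hp : 0 < r ^ m := by positivity
    rw [abs_le]
    have e : (1 / r - 1) * (r ^ m * r) = r ^ m - r ^ m * r := by
      rw [sub_mul, mul_left_comm, hinv]; ring
    rw [e]
    constructor <;> nlinarith

theorem abs_decay_add_dir_sub_le {r : ℝ} (hr : 0 < r) (hr1 : r < 1) (R : ℤ × ℤ) (i : Fin 3) :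
    |decay r (R + dir i) - decay r R| ≤ (1 / r - 1) * decay r R := by
  have h1 : 1 < 1 / r := by rw [lt_div_iff₀ hr]; linarith
  have hp1 : 0 < r ^ R.1.natAbs := by positivity
  have hp2 : 0 < r ^ R.2.natAbs := by positivity
  fin_cases i
  · simp [dir, decay]
    have := mul_pos hp1 hp2
    have : 0 ≤ r⁻¹ - 1 := by rw [← one_div]; linarith
    positivity
  · have := abs_pow_natAbs_succ_sub_le hr hr1 R.1
    simp only [dir, decay, Prod.fst_add, Prod.snd_add]
    simp only [Fin.mk_one, Matrix.cons_val_one, Matrix.cons_val_zero, add_zero]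
    rw [← sub_mul, abs_mul, abs_of_pos hp2, ← mul_assoc]
    exact mul_le_mul_of_nonneg_right this hp2.le
  · have := abs_pow_natAbs_succ_sub_le hr hr1 R.2
    simp only [dir, decay, Prod.fst_add, Prod.snd_add]
    simp only [Fin.reduceFinMk, Matrix.cons_val, add_zero]
    rw [← mul_sub, abs_mul, abs_of_pos hp1, mul_left_comm]
    exact mul_le_mul_of_nonneg_left this hp1.le

theorem summable_decay_sq {r : ℝ} (hr : 0 < r) (hr1 : r < 1) :
    Summable fun R => decay r R ^ 2 := by
  have h1 : Summable fun n : ℤ => (r ^ n.natAbs) ^ 2 := by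
    have hg : Summable fun n : ℕ => (r ^ n) ^ 2 := by
      simp only [← pow_mul, mul_comm _ 2]
      simp only [pow_mul]
      exact summable_geometric_of_lt_one (by positivity) (by nlinarith)
    exact Summable.of_nat_of_neg (by simpa using hg) (by simpa using hg)
  have := h1.mul_of_nonneg h1 (fun _ => by positivity) fun _ => by positivity
  simpa [decay, mul_pow] using this

/-- A slowly decaying wave at the Dirac point on one sublattice. -/
def diracWaveFun (r : ℝ) : Site → ℂ :=
  Sum.elim (fun R => phase diracPoint R * decay r R) 0

theorem memlp_diracWaveFun {r : ℝ} (hr : 0 < r) (hr1 : r < 1) :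
    Memℓp (diracWaveFun r) 2 := by
  refine memℓp_gen ?_
  have h2 : (2 : ENNReal).toReal = (2 : ℕ) := by norm_num
  simp only [h2, Real.rpow_natCast]
  refine (Function.Injective.summable_iff (g := (Sum.inl : ℤ × ℤ → Site)) Sum.inl_injective
    ?_).1 ?_
  · rintro (R | R) hR
    · exact absurd ⟨R, rfl⟩ hR
    · simp [diracWaveFun]
  · refine (summable_decay_sq hr hr1).congr fun R => ?_
    simp [diracWaveFun, norm_phase]

/-- The wave `diracWaveFun` as an element of `ℓ²`. -/
def diracWave {r : ℝ} (hr : 0 < r) (hr1 : r < 1) : Ell2 := ⟨diracWaveFun r, memlp_diracWaveFun hr hr1⟩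

theorem diracWave_ne_zero {r : ℝ} (hr : 0 < r) (hr1 : r < 1) : diracWave hr hr1 ≠ 0 := by
  intro h
  have h1 : diracWaveFun r (Sum.inl 0) = 0 := congrArg (fun f : Ell2 => f (Sum.inl 0)) h
  simp [diracWaveFun, phase_zero, decay] at h1

theorem norm_lp_le_of_comp {f g : Ell2} {η : ℝ} (hη : 0 ≤ η) {π : Site → Site}
    (hπ : Function.Injective π) (h : ∀ x, ‖f x‖ ≤ η * ‖g (π x)‖) : ‖f‖ ≤ η * ‖g‖ := by
  have h2 : (0 : ℝ) < (2 : ENNReal).toReal := by norm_num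
  refine lp.norm_le_of_forall_sum_le h2 (mul_nonneg hη (norm_nonneg _)) fun s => ?_
  have h1 := lp.sum_rpow_le_norm_rpow h2 g (s.image π)
  rw [Finset.sum_image (fun x _ y _ h => hπ h)] at h1
  rw [Real.mul_rpow hη (norm_nonneg _)]
  refine le_trans ?_ (mul_le_mul_of_nonneg_left h1 (Real.rpow_nonneg hη _))
  rw [Finset.mul_sum]
  refine Finset.sum_le_sum fun x _ => ?_
  rw [← Real.mul_rpow hη (norm_nonneg _)]
  exact Real.rpow_le_rpow (norm_nonneg _) (h x) h2.le

theorem norm_kekuleOperator_diracWave_le {r : ℝ} (hr : 0 < r) (hr1 : r < 1) (t : ℝ) :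
    ‖kekuleOperator (fun _ => t) (diracWave hr hr1)‖ ≤
      |t| * (3 * (1 / r - 1)) * ‖diracWave hr hr1‖ := by
  have h1 : 1 < 1 / r := by rw [lt_div_iff₀ hr]; linarith
  have h0 : 0 ≤ |t| * (3 * (1 / r - 1)) := mul_nonneg (abs_nonneg _) (by linarith)
  refine norm_lp_le_of_comp h0 (π := Sum.swap) Sum.swap_leftInverse.injective fun x => ?_
  rw [kekuleOperator_apply]
  have hw : ∀ x, (diracWave hr hr1 : Ell2) x = diracWaveFun r x := fun x => rfl
  simp only [hw, amp_kekule]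
  rcases x with R | R
  · simp only [nbr, diracWaveFun, Sum.elim_inr, Pi.zero_apply, mul_zero, Finset.sum_const_zero,
      norm_zero]
    positivity
  · simp only [nbr, diracWaveFun, Sum.elim_inl, Sum.swap_inr, phase_add]
    have e : ∑ i, (t : ℂ) * (phase diracPoint R * phase diracPoint (dir i) *
        (decay r (R + dir i) : ℝ)) = t * phase diracPoint R *
          ∑ i, phase diracPoint (dir i) * ((decay r (R + dir i) - decay r R : ℝ) : ℂ) := by
      have hz : ∑ i, phase diracPoint (dir i) = 0 := by rw [phase_dir, disp_diracPoint]
      have : ∑ i, phase diracPoint (dir i) * ((decay r (R + dir i) - decay r R : ℝ) : ℂ) =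
          ∑ i, phase diracPoint (dir i) * ((decay r (R + dir i) : ℝ) : ℂ) := by
        simp only [Complex.ofReal_sub, mul_sub, Finset.sum_sub_distrib, ← Finset.sum_mul, hz,
          zero_mul, sub_zero]
      rw [this, Finset.mul_sum]
      exact Finset.sum_congr rfl fun i _ => by ring
    rw [e, norm_mul, norm_mul, norm_mul, norm_phase, Complex.norm_real, Real.norm_eq_abs, mul_one,
      one_mul, mul_assoc, Complex.norm_real, Real.norm_of_nonneg (decay_pos hr R).le]
    refine mul_le_mul_of_nonneg_left ?_ (abs_nonneg _)
    refine (norm_sum_le _ _).trans ?_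
    have : ∀ i ∈ (Finset.univ : Finset (Fin 3)), ‖phase diracPoint (dir i) *
        ((decay r (R + dir i) - decay r R : ℝ) : ℂ)‖ ≤ (1 / r - 1) * decay r R := fun i _ => by
      rw [norm_mul, norm_phase, one_mul, Complex.norm_real]
      exact abs_decay_add_dir_sub_le hr hr1 R i
    refine (Finset.sum_le_sum this).trans_eq ?_
    rw [Finset.sum_const, Finset.card_univ, Fintype.card_fin, nsmul_eq_mul]
    push_cast
    ring

theorem zero_mem_spectrum_kekuleOperator_const (t : ℝ) :
    (0 : ℂ) ∈ spectrum ℂ (kekuleOperator fun _ => t) := by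
  rw [spectrum.zero_mem_iff]
  rintro ⟨u, hu⟩
  set S : Ell2 →L[ℂ] Ell2 := ↑(u⁻¹) with hS
  have hST : ∀ f, S (kekuleOperator (fun _ => t) f) = f := fun f => by
    have h1 : S * kekuleOperator (fun _ => t) = 1 := by rw [← hu, hS, Units.inv_mul]
    exact congrArg (fun T : Ell2 →L[ℂ] Ell2 => T f) h1
  set A := ‖S‖ * |t| * 3 with hA
  have hA0 : 0 ≤ A := by positivity
  set r : ℝ := (A + 1) / (A + 2) with hrdef
  have hr : 0 < r := by positivity
  have hr1 : r < 1 := by rw [hrdef, div_lt_one (by positivity)]; linarith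
  have h1 : ‖diracWave hr hr1‖ ≤ A * (1 / r - 1) * ‖diracWave hr hr1‖ := by
    conv_lhs => rw [← hST (diracWave hr hr1)]
    refine (S.le_opNorm _).trans ?_
    refine (mul_le_mul_of_nonneg_left (norm_kekuleOperator_diracWave_le hr hr1 t)
      (norm_nonneg _)).trans_eq ?_
    rw [hA]
    ring
  have h2 : A * (1 / r - 1) < 1 := by
    have : 1 / r - 1 = 1 / (A + 1) := by
      rw [hrdef]; field_simp; ring
    rw [this, mul_one_div, div_lt_one (by positivity)]
    linarith
  have h3 : 0 < ‖diracWave hr hr1‖ := norm_pos_iff.2 (diracWave_ne_zero hr hr1)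
  nlinarith

end Graphene
end

noncomputable section

namespace Graphene

/-! ### A strong concavity inequality for the trace of the square root -/

section TraceInequality

open Matrix
open scoped ComplexOrder

variable {ι : Type} [Fintype ι]

/-- The squared Frobenius norm. -/
def frob (X : Matrix ι ι ℂ) : ℝ := ∑ i, ∑ j, ‖X i j‖ ^ 2

theorem frob_nonneg (X : Matrix ι ι ℂ) : 0 ≤ frob X :=
  Finset.sum_nonneg fun _ _ => Finset.sum_nonneg fun _ _ => by positivity

theorem norm_sq_le_frob (X : Matrix ι ι ℂ) (i j : ι) : ‖X i j‖ ^ 2 ≤ frob X :=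
  (Finset.single_le_sum (f := fun j => ‖X i j‖ ^ 2) (fun _ _ => by positivity)
    (Finset.mem_univ j)).trans
    (Finset.single_le_sum (f := fun i => ∑ j, ‖X i j‖ ^ 2)
      (fun _ _ => Finset.sum_nonneg fun _ _ => by positivity) (Finset.mem_univ i))

theorem frob_conjTranspose (X : Matrix ι ι ℂ) : frob Xᴴ = frob X := by
  rw [frob, frob, Finset.sum_comm]
  simp

theorem frob_eq_sum_col (X : Matrix ι ι ℂ) : frob X = ∑ j, vecSq (fun i => X i j) := by
  rw [frob, Finset.sum_comm]
  rfl

theorem frob_eq_trace (X : Matrix ι ι ℂ) : frob X = (Xᴴ * X).trace.re := by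
  simp only [frob_eq_sum_col, trace, diag_apply, mul_apply, conjTranspose_apply, Complex.re_sum,
    vecSq]
  refine Finset.sum_congr rfl fun j _ => Finset.sum_congr rfl fun i _ => ?_
  rw [RCLike.star_def, Complex.conj_mul']
  norm_cast

theorem frob_add_le (X Y : Matrix ι ι ℂ) : frob (X + Y) ≤ 2 * frob X + 2 * frob Y := by
  simp only [frob, Finset.mul_sum, ← Finset.sum_add_distrib]
  refine Finset.sum_le_sum fun i _ => Finset.sum_le_sum fun j _ => ?_
  rw [Matrix.add_apply]
  nlinarith [norm_add_le (X i j) (Y i j), norm_nonneg (X i j + Y i j), norm_nonneg (X i j),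
    norm_nonneg (Y i j), sq_nonneg (‖X i j‖ - ‖Y i j‖)]

theorem frob_parallelogram (X Y : Matrix ι ι ℂ) :
    frob (X + Y) + frob (-X + Y) = 2 * frob X + 2 * frob Y := by
  simp only [frob, Finset.mul_sum, ← Finset.sum_add_distrib]
  refine Finset.sum_congr rfl fun i _ => Finset.sum_congr rfl fun j _ => ?_
  have := parallelogram_law_with_norm ℝ (Y i j) (X i j)
  rw [Matrix.add_apply, Matrix.add_apply, Matrix.neg_apply, add_comm (X i j), neg_add_eq_sub]
  nlinarith

theorem frob_smul (c : ℝ) (X : Matrix ι ι ℂ) : frob ((c : ℂ) • X) = c ^ 2 * frob X := by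
  simp [frob, Finset.mul_sum, mul_pow]

/-- `‖Q‖ ≤ K` in the operator norm. -/
def OpBound (Q : Matrix ι ι ℂ) (K : ℝ) : Prop := ∀ φ, vecSq (Q *ᵥ φ) ≤ K ^ 2 * vecSq φ

theorem OpBound.frob_mul_le {Q : Matrix ι ι ℂ} {K : ℝ} (h : OpBound Q K) (X : Matrix ι ι ℂ) :
    frob (Q * X) ≤ K ^ 2 * frob X := by
  rw [frob_eq_sum_col, frob_eq_sum_col, Finset.mul_sum]
  exact Finset.sum_le_sum fun j _ => h fun i => X i j

theorem OpBound.frob_mul_le' {Q : Matrix ι ι ℂ} {K : ℝ} (h : OpBound Q K) (hQ : Q.IsHermitian)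
    {X : Matrix ι ι ℂ} (hX : X.IsHermitian) : frob (X * Q) ≤ K ^ 2 * frob X := by
  rw [← frob_conjTranspose, conjTranspose_mul, hQ.eq, hX.eq]
  exact h.frob_mul_le X

variable [DecidableEq ι]

theorem opBound_diagonal {l : ι → ℝ} {K : ℝ} (h0 : ∀ i, 0 ≤ l i) (hK : ∀ i, l i ≤ K) :
    OpBound (diagonal fun i => (l i : ℂ)) K := by
  intro φ
  simp only [vecSq, mulVec_diagonal, norm_mul, mul_pow, Finset.mul_sum, Complex.norm_real,
    Real.norm_eq_abs, sq_abs]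
  refine Finset.sum_le_sum fun i _ => mul_le_mul_of_nonneg_right ?_ (by positivity)
  have := h0 i
  have := hK i
  nlinarith

theorem trace_le_of_diagonal {Q : Matrix ι ι ℂ} (hQ : Q.IsHermitian) {K : ℝ} (hK : 0 < K)
    (hQK : OpBound Q K) {l : ι → ℝ} (h0 : ∀ i, 0 < l i) (hl : ∀ i, l i ≤ K) :
    Q.trace.re ≤ ∑ i, l i + 1 / 2 * ∑ i, ((Q ^ 2) i i - (l i : ℂ) ^ 2).re / l i -
      frob (Q ^ 2 - (diagonal fun i => (l i : ℂ)) ^ 2) / (8 * K ^ 3) := by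
  set R : Matrix ι ι ℂ := diagonal fun i => (l i : ℂ) with hR
  have hRh : R.IsHermitian := by
    rw [hR, IsHermitian, diagonal_conjTranspose]
    congr 1
    ext i
    simp
  set D := Q - R with hD
  have hDh : D.IsHermitian := hQ.sub hRh
  have hRK : OpBound R K := opBound_diagonal (fun i => (h0 i).le) hl
  have e1 : Q ^ 2 - R ^ 2 = Q * D + D * R := by rw [hD]; noncomm_ring
  have h1 : frob (Q ^ 2 - R ^ 2) ≤ 4 * K ^ 2 * frob D := by
    rw [e1]
    have := frob_add_le (Q * D) (D * R)
    have := hQK.frob_mul_le D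
    have := hRK.frob_mul_le' hRh hDh
    linarith
  have hdd : ∀ i, ((D ^ 2) i i).re = vecSq fun j => D j i := by
    intro i
    rw [sq, mul_apply, Complex.re_sum]
    refine Finset.sum_congr rfl fun j _ => ?_
    rw [← hDh.apply i j, RCLike.star_def, Complex.conj_mul']
    norm_cast
  have h2 : frob D / K ≤ ∑ i, ((D ^ 2) i i).re / l i := by
    rw [frob_eq_sum_col, Finset.sum_div]
    refine Finset.sum_le_sum fun i _ => ?_
    rw [hdd]
    exact div_le_div_of_nonneg_left (vecSq_nonneg _) (h0 i) (hl i)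
  have h3 : ∀ i, (Q i i).re = l i + 1 / 2 * (((Q ^ 2) i i - (l i : ℂ) ^ 2).re / l i) -
      1 / 2 * (((D ^ 2) i i).re / l i) := by
    intro i
    have e2 : Q ^ 2 - R ^ 2 = R * D + D * R + D ^ 2 := by rw [hD]; noncomm_ring
    have e3 := congrArg (fun X : Matrix ι ι ℂ => (X i i).re) e2
    have e4 : (R ^ 2) i i = (l i : ℂ) ^ 2 := by rw [hR, diagonal_pow]; simp
    simp only [Matrix.sub_apply, Matrix.add_apply, e4] at e3
    have e5 : D i i = Q i i - (l i : ℂ) := by rw [hD, Matrix.sub_apply, hR, diagonal_apply_eq]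
    have e6 : (R * D) i i = (l i : ℂ) * D i i := by rw [hR, diagonal_mul]
    have e7 : (D * R) i i = D i i * (l i : ℂ) := by rw [hR, mul_diagonal]
    rw [e3, e6, e7, e5]
    have := (h0 i).ne'
    simp only [Complex.add_re, Complex.mul_re, Complex.sub_re, Complex.sub_im, Complex.ofReal_re,
      Complex.ofReal_im]
    field_simp
    ring
  rw [trace, Complex.re_sum]
  simp only [diag_apply]
  rw [Finset.sum_congr rfl fun i _ => h3 i, Finset.sum_sub_distrib, Finset.sum_add_distrib,
    ← Finset.mul_sum, ← Finset.mul_sum]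
  have h4 : frob (Q ^ 2 - R ^ 2) / (8 * K ^ 3) ≤ 1 / 2 * (frob D / K) := by
    rw [div_le_iff₀ (by positivity)]
    calc _ ≤ 4 * K ^ 2 * frob D := h1
      _ = _ := by field_simp; ring
  linarith

theorem vecSq_conjTranspose_mulVec {U : Matrix ι ι ℂ} (hU : U * Uᴴ = 1) (φ : ι → ℂ) :
    vecSq (Uᴴ *ᵥ φ) = vecSq φ := by
  have : (vecSq (Uᴴ *ᵥ φ) : ℂ) = vecSq φ := by
    rw [← star_dotProduct_self, ← star_dotProduct_self, star_mulVec, conjTranspose_conjTranspose,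
      ← dotProduct_mulVec, mulVec_mulVec, hU, one_mulVec]
  exact_mod_cast this

/-- Near a positive definite matrix `R` with spectrum in `[r, K]`, the trace of a positive
semidefinite `Q` is bounded by a linear functional of `Q ^ 2 - R ^ 2` minus a quadratic
correction. -/
theorem exists_trace_le {R : Matrix ι ι ℂ} (hR : R.PosSemidef) {r K : ℝ} (hr : 0 < r)
    (hrR : ∀ φ, r ^ 2 * vecSq φ ≤ vecSq (R *ᵥ φ)) (hRK : OpBound R K) (hK : 0 < K) :
    ∃ f : Matrix ι ι ℂ →ₗ[ℝ] ℝ, (∀ P : Matrix ι ι ℂ, P.PosSemidef → f P ≤ P.trace.re / r) ∧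
      ∀ Q : Matrix ι ι ℂ, Q.IsHermitian → OpBound Q K →
        Q.trace.re ≤ R.trace.re + 1 / 2 * f (Q ^ 2 - R ^ 2) -
          frob (Q ^ 2 - R ^ 2) / (8 * K ^ 3) := by
  obtain ⟨U, l, hUU, hUU', hRU, hl⟩ : ∃ (U : Matrix ι ι ℂ) (l : ι → ℝ), U * Uᴴ = 1 ∧ Uᴴ * U = 1 ∧
      R = U * (diagonal fun i => (l i : ℂ)) * Uᴴ ∧ ∀ i, 0 ≤ l i := by
    refine ⟨hR.1.eigenvectorUnitary, hR.1.eigenvalues, ?_, ?_, ?_, hR.eigenvalues_nonneg⟩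
    · exact Unitary.coe_mul_star_self _
    · exact Unitary.coe_star_mul_self _
    · exact hR.1.spectral_theorem
  have hconj : ∀ X Y : Matrix ι ι ℂ, Uᴴ * X * U * (Uᴴ * Y * U) = Uᴴ * (X * Y) * U := by
    intro X Y
    calc _ = Uᴴ * X * (U * Uᴴ) * Y * U := by noncomm_ring
      _ = _ := by rw [hUU]; noncomm_ring
  have htr : ∀ X : Matrix ι ι ℂ, (Uᴴ * X * U).trace = X.trace := fun X => by
    rw [trace_mul_cycle, hUU, one_mul]
  have hfr : ∀ X : Matrix ι ι ℂ, frob (Uᴴ * X * U) = frob X := fun X => by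
    rw [frob_eq_trace, frob_eq_trace, ← htr (Xᴴ * X), ← hconj]
    simp only [conjTranspose_mul, conjTranspose_conjTranspose, mul_assoc]
  have hUR : Uᴴ * R * U = diagonal fun i => (l i : ℂ) := by
    rw [hRU]
    calc _ = (Uᴴ * U) * (diagonal fun i => (l i : ℂ)) * (Uᴴ * U) := by noncomm_ring
      _ = _ := by rw [hUU']; noncomm_ring
  have hvs : ∀ i, vecSq (R *ᵥ (U *ᵥ Pi.single i 1)) = l i ^ 2 ∧
      vecSq (U *ᵥ Pi.single i 1) = 1 := by
    intro i
    have h1 : ∀ φ : ι → ℂ, vecSq (U *ᵥ φ) = vecSq φ := fun φ => by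
      have := vecSq_conjTranspose_mulVec (U := Uᴴ) (by rwa [conjTranspose_conjTranspose]) φ
      rwa [conjTranspose_conjTranspose] at this
    have h2 : R *ᵥ (U *ᵥ Pi.single i 1) = U *ᵥ ((diagonal fun i => (l i : ℂ)) *ᵥ
        Pi.single i 1) := by
      rw [mulVec_mulVec, mulVec_mulVec, hRU, mul_assoc, hUU', mul_one]
    rw [h2, h1, h1, diagonal_mulVec_single]
    constructor <;>
    · simp only [vecSq, Pi.single_apply]
      rw [Finset.sum_eq_single i] <;> simp +contextual
  have hlr : ∀ i, r ≤ l i := fun i => by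
    have := hrR (U *ᵥ Pi.single i 1)
    rw [(hvs i).1, (hvs i).2, mul_one] at this
    exact le_of_sq_le_sq this (hl i)
  have hlK : ∀ i, l i ≤ K := fun i => by
    have := hRK (U *ᵥ Pi.single i 1)
    rw [(hvs i).1, (hvs i).2, mul_one] at this
    exact le_of_sq_le_sq this hK.le
  have hl0 : ∀ i, 0 < l i := fun i => hr.trans_le (hlr i)
  refine ⟨{ toFun := fun X => ∑ i, ((Uᴴ * X * U) i i).re / l i
            map_add' := fun X Y => by
              simp [mul_add, add_mul, add_div, Finset.sum_add_distrib]
            map_smul' := fun c X => by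
              simp [Finset.mul_sum, mul_div_assoc] }, ?_, ?_⟩
  · intro P hP
    have hP' : (Uᴴ * P * U).PosSemidef := hP.conjTranspose_mul_mul_same U
    simp only [LinearMap.coe_mk, AddHom.coe_mk]
    rw [← htr P, trace, Complex.re_sum, Finset.sum_div]
    refine Finset.sum_le_sum fun i _ => ?_
    refine div_le_div_of_nonneg_left ?_ hr (hlr i)
    have := hP'.diag_nonneg (i := i)
    exact (Complex.le_def.1 this).1
  · intro Q hQ hQK
    have hQ' : (Uᴴ * Q * U).IsHermitian := isHermitian_conjTranspose_mul_mul U hQ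
    have hQK' : OpBound (Uᴴ * Q * U) K := fun φ => by
      rw [← mulVec_mulVec, ← mulVec_mulVec, vecSq_conjTranspose_mulVec hUU]
      refine (hQK _).trans_eq ?_
      have := vecSq_conjTranspose_mulVec (U := Uᴴ) (by rwa [conjTranspose_conjTranspose]) φ
      rw [conjTranspose_conjTranspose] at this
      rw [this]
    have key := trace_le_of_diagonal hQ' hK hQK' hl0 hlK
    have e : (Uᴴ * Q * U) ^ 2 - (diagonal fun i => (l i : ℂ)) ^ 2 = Uᴴ * (Q ^ 2 - R ^ 2) * U := by
      rw [← hUR, sq, sq, hconj, hconj, sq, sq]; noncomm_ring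
    have e2 : ∀ i, ((Uᴴ * Q * U) ^ 2) i i - (l i : ℂ) ^ 2 = (Uᴴ * (Q ^ 2 - R ^ 2) * U) i i := by
      intro i
      rw [← e, Matrix.sub_apply, diagonal_pow]
      simp
    rw [htr, e, hfr] at key
    simp only [e2] at key
    have e3 : R.trace.re = ∑ i, l i := by
      rw [← htr R, hUR, trace, Complex.re_sum]
      simp
    rw [e3]
    exact key

end TraceInequality

end Graphene
end

noncomputable section

namespace Graphene

/-! ### The Fourier matrix of the three-amplitude configurations -/

section KekuleMatrix

open Matrix
open scoped ComplexOrder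

/-- The block of the Fourier matrix that maps one sublattice to the other. -/
def kekBlock (w : Fin 3 → ℝ) (θ : ℝ × ℝ) : Matrix (Fin 3) (Fin 3) ℂ :=
  !![(w 0 : ℂ), w 2 * phase θ (-1, 0), w 1;
     (w 1 : ℂ), w 0, w 2 * phase θ (1, 1);
     w 2 * phase θ (0, -1), w 1, w 0]

/-- The Fourier matrix of the configuration with three amplitudes. -/
def kekMat (w : Fin 3 → ℝ) (θ : ℝ × ℝ) : Matrix (Fin 3 ⊕ Fin 3) (Fin 3 ⊕ Fin 3) ℂ :=
  fromBlocks 0 (kekBlock w θ) (kekBlock w θ)ᴴ 0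

theorem hop_inl_inr (τ : Config) (R S : ℤ × ℤ) :
    hop τ (Sum.inl R) (Sum.inr S) = ∑ i : Fin 3, if R - dir i = S then τ R i else 0 := by
  refine Finset.sum_congr rfl fun i _ => ?_
  simp only [nbr, amp, Sum.inr.injEq]

theorem fibre_hex_inl_inr (τ : Config) (θ : ℝ × ℝ) (x y i : Fin 3) (r : ℤ × ℤ)
    (h : ∀ j s, hexA x - dir j = hexB y + latticeVec (2, -1) (-1, 2) s ↔ j = i ∧ s = r) :
    fibre (2, -1) (-1, 2) hexCell τ θ (Sum.inl x) (Sum.inr y) = τ (hexA x) i * phase θ r := by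
  have e : ∀ s, hop τ (hexCell (Sum.inl x))
      (siteShift (latticeVec (2, -1) (-1, 2) s) (hexCell (Sum.inr y))) =
      if s = r then τ (hexA x) i else 0 := by
    intro s
    rw [hexCell_eq]
    simp only [siteShift, Sum.map_inl, Sum.map_inr]
    rw [hop_inl_inr]
    simp only [h]
    by_cases hs : s = r <;> simp [hs]
  rw [fibre_apply, tsum_eq_single r]
  · rw [e, if_pos rfl]
  · intro s hs
    rw [e, if_neg hs]
    simp

theorem fibre_hex_block (w : Fin 3 → ℝ) (θ : ℝ × ℝ) (x y : Fin 3) :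
    fibre (2, -1) (-1, 2) hexCell (kekule w) θ (Sum.inl x) (Sum.inr y) = kekBlock w θ x y := by
  have key := fun i r => fibre_hex_inl_inr (kekule w) θ x y i r
  simp only [kekule, bondLabel_hexA, latticeVec_hex] at key
  fin_cases x <;> fin_cases y
  · rw [key 0 (0, 0) ?_]; · simp [kekBlock, phase, dot]
    rintro j ⟨s, t⟩; fin_cases j <;> simp [hexA, hexB, dir, Prod.ext_iff] <;> omega
  · rw [key 1 (-1, 0) ?_]; · simp [kekBlock]
    rintro j ⟨s, t⟩; fin_cases j <;> simp [hexA, hexB, dir, Prod.ext_iff] <;> omega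
  · rw [key 2 (0, 0) ?_]; · simp [kekBlock, phase, dot]
    rintro j ⟨s, t⟩; fin_cases j <;> simp [hexA, hexB, dir, Prod.ext_iff] <;> omega
  · rw [key 1 (0, 0) ?_]; · simp [kekBlock, phase, dot]
    rintro j ⟨s, t⟩; fin_cases j <;> simp [hexA, hexB, dir, Prod.ext_iff] <;> omega
  · rw [key 2 (0, 0) ?_]; · simp [kekBlock, phase, dot]
    rintro j ⟨s, t⟩; fin_cases j <;> simp [hexA, hexB, dir, Prod.ext_iff] <;> omega
  · rw [key 0 (1, 1) ?_]; · simp [kekBlock]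
    rintro j ⟨s, t⟩; fin_cases j <;> simp [hexA, hexB, dir, Prod.ext_iff] <;> omega
  · rw [key 2 (0, -1) ?_]; · simp [kekBlock]
    rintro j ⟨s, t⟩; fin_cases j <;> simp [hexA, hexB, dir, Prod.ext_iff] <;> omega
  · rw [key 0 (0, 0) ?_]; · simp [kekBlock, phase, dot]
    rintro j ⟨s, t⟩; fin_cases j <;> simp [hexA, hexB, dir, Prod.ext_iff] <;> omega
  · rw [key 1 (0, 0) ?_]; · simp [kekBlock, phase, dot]
    rintro j ⟨s, t⟩; fin_cases j <;> simp [hexA, hexB, dir, Prod.ext_iff] <;> omega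

theorem fibre_hex_eq (w : Fin 3 → ℝ) (θ : ℝ × ℝ) :
    fibre (2, -1) (-1, 2) hexCell (kekule w) θ = kekMat w θ := by
  have hH := isHermitian_fibre (kekule_latticePeriodic w) hexCell θ
  ext (x | x) (y | y)
  · rw [fibre_apply]
    simp [hexCell, siteShift, hop, nbr, kekMat]
  · rw [fibre_hex_block]
    rfl
  · rw [← hH.apply, fibre_hex_block]
    rfl
  · rw [fibre_apply]
    simp [hexCell, siteShift, hop, nbr, kekMat]

theorem isHermitian_kekMat (w : Fin 3 → ℝ) (θ : ℝ × ℝ) : (kekMat w θ).IsHermitian := by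
  rw [← fibre_hex_eq]
  exact isHermitian_fibre (kekule_latticePeriodic w) hexCell θ

theorem kekMat_add (w w' : Fin 3 → ℝ) (θ : ℝ × ℝ) :
    kekMat (w + w') θ = kekMat w θ + kekMat w' θ := by
  have h : kekBlock (w + w') θ = kekBlock w θ + kekBlock w' θ := by
    ext x y
    fin_cases x <;> fin_cases y <;> simp [kekBlock, add_mul]
  simp only [kekMat, h, conjTranspose_add, fromBlocks_add, add_zero]

theorem kekMat_smul (c : ℝ) (w : Fin 3 → ℝ) (θ : ℝ × ℝ) :
    kekMat (c • w) θ = (c : ℂ) • kekMat w θ := by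
  have h : kekBlock (c • w) θ = (c : ℂ) • kekBlock w θ := by
    ext x y
    fin_cases x <;> fin_cases y <;> simp [kekBlock, mul_assoc]
  rw [kekMat, kekMat, h, fromBlocks_smul, conjTranspose_smul]
  simp

theorem phase_mul_star (θ : ℝ × ℝ) (R : ℤ × ℤ) : phase θ R * star (phase θ R) = 1 := by
  rw [star_phase, ← phase_add, add_neg_cancel, phase_zero]

theorem phase_one_one (θ : ℝ × ℝ) :
    phase θ (1, 1) = star (phase θ (-1, 0)) * star (phase θ (0, -1)) := by
  rw [star_phase, star_phase, ← phase_add]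
  rfl

theorem kekBlock_single_unitary (l : Fin 3) (θ : ℝ × ℝ) :
    kekBlock (Pi.single l 1) θ * (kekBlock (Pi.single l 1) θ)ᴴ = 1 ∧
    (kekBlock (Pi.single l 1) θ)ᴴ * kekBlock (Pi.single l 1) θ = 1 := by
  have h1 : kekBlock (Pi.single l 1) θ * (kekBlock (Pi.single l 1) θ)ᴴ = 1 := by
    have hp := phase_mul_star θ (-1, 0)
    have hq := phase_mul_star θ (1, 1)
    have hr := phase_mul_star θ (0, -1)
    rw [RCLike.star_def] at hp hq hr
    ext x y
    fin_cases l <;> fin_cases x <;> fin_cases y <;>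
      simp [kekBlock, mul_apply, Fin.sum_univ_three, hp, hq, hr]
  exact ⟨h1, mul_eq_one_comm.1 h1⟩

theorem kekMat_single_sq (l : Fin 3) (θ : ℝ × ℝ) : kekMat (Pi.single l 1) θ ^ 2 = 1 := by
  rw [sq, kekMat, fromBlocks_multiply, (kekBlock_single_unitary l θ).1,
    (kekBlock_single_unitary l θ).2]
  simp [fromBlocks_one]

theorem vecSq_kekMat_single (l : Fin 3) (θ : ℝ × ℝ) (φ : Fin 3 ⊕ Fin 3 → ℂ) :
    vecSq (kekMat (Pi.single l 1) θ *ᵥ φ) = vecSq φ := by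
  have := vecSq_mulVec (isHermitian_kekMat (Pi.single l 1) θ) φ
  rw [kekMat_single_sq, one_mulVec, star_dotProduct_self] at this
  exact_mod_cast this

theorem kekMat_eq_sum (w : Fin 3 → ℝ) (θ : ℝ × ℝ) : kekMat w θ =
    (w 0 : ℂ) • kekMat (Pi.single 0 1) θ + (w 1 : ℂ) • kekMat (Pi.single 1 1) θ +
      (w 2 : ℂ) • kekMat (Pi.single 2 1) θ := by
  rw [← kekMat_smul, ← kekMat_smul, ← kekMat_smul, ← kekMat_add, ← kekMat_add]
  congr 1
  ext l
  fin_cases l <;> simp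

/-- The Euclidean norm of a complex vector. -/
def vecNorm {ι : Type} [Fintype ι] (φ : ι → ℂ) : ℝ := ‖WithLp.toLp 2 φ‖

theorem vecNorm_sq {ι : Type} [Fintype ι] (φ : ι → ℂ) : vecNorm φ ^ 2 = vecSq φ :=
  (vecSq_eq_norm φ).symm

theorem vecNorm_nonneg {ι : Type} [Fintype ι] (φ : ι → ℂ) : 0 ≤ vecNorm φ := norm_nonneg _

theorem vecNorm_smul_kekMat_single (c : ℝ) (l : Fin 3) (θ : ℝ × ℝ) (φ : Fin 3 ⊕ Fin 3 → ℂ) :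
    vecNorm (((c : ℂ) • kekMat (Pi.single l 1) θ) *ᵥ φ) = |c| * vecNorm φ := by
  have h : vecNorm (kekMat (Pi.single l 1) θ *ᵥ φ) = vecNorm φ := by
    rw [← sq_eq_sq₀ (vecNorm_nonneg _) (vecNorm_nonneg _), vecNorm_sq, vecNorm_sq,
      vecSq_kekMat_single]
  rw [smul_mulVec, vecNorm, WithLp.toLp_smul, norm_smul, Complex.norm_real, Real.norm_eq_abs]
  rw [vecNorm] at h
  rw [h]

theorem vecNorm_add_le {ι : Type} [Fintype ι] (φ ψ : ι → ℂ) :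
    vecNorm (φ + ψ) ≤ vecNorm φ + vecNorm ψ := by
  rw [vecNorm, WithLp.toLp_add]
  exact norm_add_le _ _

theorem vecNorm_kekMat_le (w : Fin 3 → ℝ) (θ : ℝ × ℝ) (φ : Fin 3 ⊕ Fin 3 → ℂ) :
    vecNorm (kekMat w θ *ᵥ φ) ≤ (|w 0| + |w 1| + |w 2|) * vecNorm φ := by
  rw [kekMat_eq_sum, add_mulVec, add_mulVec]
  have h1 := vecNorm_add_le (((w 0 : ℂ) • kekMat (Pi.single 0 1) θ) *ᵥ φ +
    ((w 1 : ℂ) • kekMat (Pi.single 1 1) θ) *ᵥ φ) (((w 2 : ℂ) • kekMat (Pi.single 2 1) θ) *ᵥ φ)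
  have h2 := vecNorm_add_le (((w 0 : ℂ) • kekMat (Pi.single 0 1) θ) *ᵥ φ)
    (((w 1 : ℂ) • kekMat (Pi.single 1 1) θ) *ᵥ φ)
  simp only [vecNorm_smul_kekMat_single] at h1 h2
  linarith

theorem le_vecNorm_kekMat (w : Fin 3 → ℝ) (θ : ℝ × ℝ) (φ : Fin 3 ⊕ Fin 3 → ℂ) :
    (|w 2| - |w 0| - |w 1|) * vecNorm φ ≤ vecNorm (kekMat w θ *ᵥ φ) := by
  have e : ((w 2 : ℂ) • kekMat (Pi.single 2 1) θ) *ᵥ φ = kekMat w θ *ᵥ φ +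
      ((((-w 0 : ℝ) : ℂ) • kekMat (Pi.single 0 1) θ) *ᵥ φ +
      (((-w 1 : ℝ) : ℂ) • kekMat (Pi.single 1 1) θ) *ᵥ φ) := by
    rw [kekMat_eq_sum w, add_mulVec, add_mulVec]
    simp only [Complex.ofReal_neg, neg_smul, neg_mulVec]
    abel
  have h := vecNorm_smul_kekMat_single (w 2) 2 θ φ
  rw [e] at h
  have h1 := vecNorm_add_le (kekMat w θ *ᵥ φ)
    ((((-w 0 : ℝ) : ℂ) • kekMat (Pi.single 0 1) θ) *ᵥ φ +
      (((-w 1 : ℝ) : ℂ) • kekMat (Pi.single 1 1) θ) *ᵥ φ)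
  have h2 := vecNorm_add_le ((((-w 0 : ℝ) : ℂ) • kekMat (Pi.single 0 1) θ) *ᵥ φ)
      ((((-w 1 : ℝ) : ℂ) • kekMat (Pi.single 1 1) θ) *ᵥ φ)
  simp only [vecNorm_smul_kekMat_single, abs_neg] at h1 h2
  rw [h] at h1
  linarith

theorem opBound_matAbs_kekMat (w : Fin 3 → ℝ) (θ : ℝ × ℝ) {K : ℝ}
    (hK : |w 0| + |w 1| + |w 2| ≤ K) : OpBound (matAbs (kekMat w θ)) K := fun φ => by
  rw [vecSq_matAbs_mulVec (isHermitian_kekMat w θ), ← vecNorm_sq, ← vecNorm_sq, ← mul_pow]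
  refine pow_le_pow_left₀ (vecNorm_nonneg _) ((vecNorm_kekMat_le w θ φ).trans ?_) 2
  exact mul_le_mul_of_nonneg_right hK (vecNorm_nonneg _)

/-! ### The trace per atom of the three-amplitude configurations -/

/-- The trace per atom of `|T(t, u, v)|`. -/
def kekTrace (w : Fin 3 → ℝ) : ℝ := traceAbs (2, -1) (-1, 2) hexCell (kekule w)

theorem kekTrace_eq (w : Fin 3 → ℝ) :
    kekTrace w = 1 / 6 * ∫ θ, (matAbs (kekMat w θ)).trace.re ∂bz := by
  rw [kekTrace, traceAbs, average_brillouin, Fintype.card_sum, Fintype.card_fin]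
  simp only [fibre_hex_eq]
  norm_num

theorem continuous_kekMat : Continuous fun z : (Fin 3 → ℝ) × (ℝ × ℝ) => kekMat z.1 z.2 := by
  have h : Continuous fun z : (Fin 3 → ℝ) × (ℝ × ℝ) => kekBlock z.1 z.2 := by
    have hw : ∀ l, Continuous fun z : (Fin 3 → ℝ) × (ℝ × ℝ) => ((z.1 l : ℝ) : ℂ) := fun l => by
      fun_prop
    have hp : ∀ R, Continuous fun z : (Fin 3 → ℝ) × (ℝ × ℝ) => phase z.2 R := fun R =>
      (continuous_phase R).comp continuous_snd
    refine continuous_matrix fun x y => ?_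
    fin_cases x <;> fin_cases y <;> simp [kekBlock] <;>
      first
      | exact hw _
      | exact (hw _).mul (hp _)
  exact continuous_const.matrix_fromBlocks h h.matrix_conjTranspose continuous_const

theorem continuous_trace_matAbs_kekMat : Continuous fun z : (Fin 3 → ℝ) × (ℝ × ℝ) =>
    (matAbs (kekMat z.1 z.2)).trace.re :=
  Complex.continuous_re.comp
    (continuous_matAbs continuous_kekMat fun _ => isHermitian_kekMat _ _).matrix_trace

theorem integrable_trace_matAbs_kekMat (w : Fin 3 → ℝ) :
    Integrable (fun θ => (matAbs (kekMat w θ)).trace.re) bz :=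
  (continuous_trace_matAbs_kekMat.comp (continuous_const.prodMk continuous_id)).integrable_bz

theorem continuous_kekTrace : Continuous kekTrace := by
  have h : kekTrace = fun w => 1 / 6 * ∫ θ, (matAbs (kekMat w θ)).trace.re ∂bz :=
    funext kekTrace_eq
  rw [h]
  simp only [integral_bz]
  have hc : Continuous fun w => ∫ θ in brillouin, (matAbs (kekMat w θ)).trace.re :=
    continuous_parametric_integral_of_continuous continuous_trace_matAbs_kekMat isCompact_brillouin
  simp only [smul_eq_mul]
  exact continuous_const.mul (continuous_const.mul hc)

theorem kekTrace_smul (c : ℝ) (w : Fin 3 → ℝ) : kekTrace (c • w) = |c| * kekTrace w := by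
  rw [kekTrace_eq, kekTrace_eq]
  simp only [kekMat_smul, matAbs_smul (isHermitian_kekMat _ _), trace_smul, smul_eq_mul,
    Complex.re_ofReal_mul, integral_const_mul]
  ring

theorem kekTrace_single (l : Fin 3) : kekTrace (Pi.single l 1) = 1 := by
  have h : ∀ θ, matAbs (kekMat (Pi.single l 1) θ) = 1 := fun θ =>
    matAbs_eq_of_sq_eq PosSemidef.one (by rw [kekMat_single_sq, one_pow])
  rw [kekTrace_eq]
  simp only [h, trace_one]
  simp

/-! ### Permutations of the three amplitudes -/

theorem trace_matAbs_kekMat_swap (w : Fin 3 → ℝ) (θ : ℝ × ℝ) :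
    (matAbs (kekMat (w ∘ Equiv.swap 1 2) θ)).trace = (matAbs (kekMat w θ)).trace := by
  set p := phase θ (-1, 0) with hp
  set r := phase θ (0, -1) with hr
  set W : Matrix (Fin 3) (Fin 3) ℂ := diagonal ![1, star p, r] with hW
  have hpp : p * star p = 1 := phase_mul_star θ _
  have hrr : r * star r = 1 := phase_mul_star θ _
  have hpp' : star p * p = 1 := by rw [mul_comm, hpp]
  have hWW : Wᴴ * W = 1 := by
    rw [hW, diagonal_conjTranspose, diagonal_mul_diagonal, ← diagonal_one]
    congr 1
    ext x
    fin_cases x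
    · simp
    · simpa using hpp
    · simpa [mul_comm] using hrr
  have hA : kekBlock (w ∘ Equiv.swap 1 2) θ = W * (kekBlock w θ)ᵀ * Wᴴ := by
    have s0 : (Equiv.swap (1 : Fin 3) 2) 0 = 0 := by decide
    rw [RCLike.star_def] at hpp hrr hpp'
    ext x y
    rw [hW, diagonal_conjTranspose, mul_diagonal, diagonal_mul]
    fin_cases x <;> fin_cases y <;>
      simp [kekBlock, s0, phase_one_one, ← hp, ← hr]
    · linear_combination (-(w 2 : ℂ)) * hrr
    · linear_combination (-(w 2 : ℂ)) * hpp
    · linear_combination (-(w 0 : ℂ)) * hpp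
    · ring
    · ring
    · linear_combination (-(w 2 : ℂ)) * hpp * r * (starRingEnd ℂ) r - (w 2 : ℂ) * hrr
    · linear_combination (-(w 0 : ℂ)) * hrr
  set V : Matrix (Fin 3 ⊕ Fin 3) (Fin 3 ⊕ Fin 3) ℂ := fromBlocks 0 W W 0 with hV
  have hVV : Vᴴ * V = 1 := by
    rw [hV, fromBlocks_conjTranspose, fromBlocks_multiply, hWW]
    simp [fromBlocks_one]
  rw [← trace_matAbs_transpose (isHermitian_kekMat w θ)]
  refine trace_matAbs_conj hVV (isHermitian_kekMat w θ).transpose ?_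
  rw [hV, fromBlocks_conjTranspose, kekMat, kekMat, fromBlocks_transpose, fromBlocks_multiply,
    fromBlocks_multiply, hA]
  simp only [conjTranspose_mul, conjTranspose_conjTranspose, transpose_zero, mul_zero, zero_mul,
    add_zero, zero_add, conjTranspose_zero, mul_assoc]
  rfl

theorem trace_matAbs_kekMat_rotate (w : Fin 3 → ℝ) (θ : ℝ × ℝ) :
    (matAbs (kekMat (w ∘ finRotate 3) θ)).trace = (matAbs (kekMat w θ)).trace := by
  set p := phase θ (-1, 0) with hp
  set r := phase θ (0, -1) with hr
  set V₁ : Matrix (Fin 3) (Fin 3) ℂ := !![0, p, 0; 0, 0, star r; 1, 0, 0] with hV₁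
  set V₂ : Matrix (Fin 3) (Fin 3) ℂ := !![0, 1, 0; 0, 0, star p; r, 0, 0] with hV₂
  have hpp : p * star p = 1 := phase_mul_star θ _
  have hrr : r * star r = 1 := phase_mul_star θ _
  have hpp' : star p * p = 1 := by rw [mul_comm, hpp]
  have hrr' : star r * r = 1 := by rw [mul_comm, hrr]
  rw [RCLike.star_def] at hpp hrr hpp' hrr'
  have h1 : V₁ᴴ * V₁ = 1 := by
    ext x y
    fin_cases x <;> fin_cases y <;>
      simp [hV₁, mul_apply, Fin.sum_univ_three, hpp', hrr]
  have h2 : V₂ * V₂ᴴ = 1 := by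
    ext x y
    fin_cases x <;> fin_cases y <;>
      simp [hV₂, mul_apply, Fin.sum_univ_three, hpp', hrr]
  have hA : kekBlock w θ = V₁ * kekBlock (w ∘ finRotate 3) θ * V₂ := by
    have s0 : finRotate 3 0 = 1 := by decide
    have s1 : finRotate 3 1 = 2 := by decide
    have s2 : finRotate 3 2 = 0 := by decide
    ext x y
    fin_cases x <;> fin_cases y <;>
      simp [hV₁, hV₂, mul_apply, Fin.sum_univ_three, kekBlock, s0, s1, s2, phase_one_one,
        ← hp, ← hr]
    · linear_combination (-(w 0 : ℂ)) * hpp * r * (starRingEnd ℂ) r - (w 0 : ℂ) * hrr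
    · ring
    · linear_combination (-(w 1 : ℂ)) * hpp
    · linear_combination (-(w 1 : ℂ)) * hrr
    · linear_combination (-(w 0 : ℂ)) * hrr
    · ring
    · linear_combination (-(w 0 : ℂ)) * hpp
  have hV : (fromBlocks V₁ 0 0 V₂ᴴ)ᴴ * fromBlocks V₁ 0 0 V₂ᴴ = 1 := by
    rw [fromBlocks_conjTranspose, fromBlocks_multiply, conjTranspose_conjTranspose, h1, h2]
    simp [fromBlocks_one]
  refine (trace_matAbs_conj hV (isHermitian_kekMat _ θ) ?_).symm
  rw [fromBlocks_conjTranspose, kekMat, kekMat, fromBlocks_multiply, fromBlocks_multiply, hA]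
  simp only [conjTranspose_mul, conjTranspose_conjTranspose, mul_zero, zero_mul,
    add_zero, zero_add, conjTranspose_zero, mul_assoc]

theorem kekTrace_comp_perm (w : Fin 3 → ℝ) (σ : Equiv.Perm (Fin 3)) :
    kekTrace (w ∘ σ) = kekTrace w := by
  have hs : ∀ w, kekTrace (w ∘ Equiv.swap (1 : Fin 3) 2) = kekTrace w := fun w => by
    simp only [kekTrace_eq, trace_matAbs_kekMat_swap]
  have hr : ∀ w, kekTrace (w ∘ finRotate 3) = kekTrace w := fun w => by
    simp only [kekTrace_eq, trace_matAbs_kekMat_rotate]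
  have h : ∀ σ : Equiv.Perm (Fin 3),
      σ = 1 ∨ σ = finRotate 3 ∨ σ = finRotate 3 * finRotate 3 ∨ σ = Equiv.swap 1 2 ∨
      σ = finRotate 3 * Equiv.swap 1 2 ∨ σ = finRotate 3 * finRotate 3 * Equiv.swap 1 2 := by
    decide
  rcases h σ with rfl | rfl | rfl | rfl | rfl | rfl <;>
    simp only [Equiv.Perm.coe_mul, Equiv.Perm.coe_one, Function.comp_id, ← Function.comp_assoc,
      hs, hr]

end KekuleMatrix

end Graphene
end

noncomputable section

namespace Graphene

/-! ### Averages over the Brillouin zone -/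

theorem integral_cos_linear {a b c d : ℤ} (h : a * d - b * c ≠ 0) :
    ∫ k : ℝ × ℝ, Real.cos (a * k.1 + b * k.2) ∂bz = 0 := by
  have hper : TorusPeriodic fun k : ℝ × ℝ => Real.cos k.1 := fun k m n => by
    simp only [Real.cos_add_int_mul_two_pi]
  have hm : Measurable fun k : ℝ × ℝ => Real.cos k.1 := by fun_prop
  have h0 := integral_bz_comp hper hm (a := 1) (b := 0) (c := 0) (d := 1) (by norm_num)
    (Real.pi, 0)
  have h1 := integral_bz_comp hper hm h 0
  simp only [Int.cast_one, one_mul, Int.cast_zero, zero_mul, add_zero, Real.cos_add_pi,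
    integral_neg] at h0
  simp only [Prod.fst_zero, add_zero] at h1
  rw [h1]
  linarith

theorem integral_cos_combination (A B C D : ℝ) :
    ∫ k : ℝ × ℝ, (A + B * Real.cos k.1 + C * Real.cos k.2 + D * Real.cos (k.1 + k.2)) ∂bz = A := by
  have h1 := integral_cos_linear (a := 1) (b := 0) (c := 0) (d := 1) (by norm_num)
  have h2 := integral_cos_linear (a := 0) (b := 1) (c := 1) (d := 0) (by norm_num)
  have h3 := integral_cos_linear (a := 1) (b := 1) (c := 0) (d := 1) (by norm_num)
  simp only [Int.cast_one, one_mul, Int.cast_zero, zero_mul, add_zero, zero_add] at h1 h2 h3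
  rw [integral_add (Continuous.integrable_bz (by fun_prop)) (Continuous.integrable_bz (by fun_prop)),
    integral_add (Continuous.integrable_bz (by fun_prop)) (Continuous.integrable_bz (by fun_prop)),
    integral_add (Continuous.integrable_bz (by fun_prop)) (Continuous.integrable_bz (by fun_prop)),
    integral_const_mul, integral_const_mul, integral_const_mul, h1, h2, h3]
  simp

section KekuleBounds

open Matrix
open scoped ComplexOrder

/-! ### The trace is at most the Euclidean norm of the amplitudes -/

theorem phase_eq (θ : ℝ × ℝ) (R : ℤ × ℤ) :
    phase θ R = ⟨Real.cos (dot θ R), Real.sin (dot θ R)⟩ := by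
  rw [phase, exp_I_mul_eq]
  apply Complex.ext <;> simp [Complex.cos_ofReal_re, Complex.sin_ofReal_re]

theorem phase_neg_one_zero (θ : ℝ × ℝ) :
    phase θ (-1, 0) = ⟨Real.cos θ.1, -Real.sin θ.1⟩ := by
  simp [phase_eq, dot]

theorem phase_one_one_eq (θ : ℝ × ℝ) :
    phase θ (1, 1) = ⟨Real.cos (θ.1 + θ.2), Real.sin (θ.1 + θ.2)⟩ := by
  simp [phase_eq, dot]

theorem kekMat_mul_apply_inl (w w' : Fin 3 → ℝ) (θ : ℝ × ℝ) (x y : Fin 3) :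
    (kekMat w θ * kekMat w' θ) (Sum.inl x) (Sum.inl y) =
      ∑ k, kekBlock w θ x k * star (kekBlock w' θ y k) := by
  rw [kekMat, kekMat, fromBlocks_multiply, fromBlocks_apply₁₁, zero_mul, zero_add, mul_apply]
  rfl

theorem kekMat_mul_apply_inr (w w' : Fin 3 → ℝ) (θ : ℝ × ℝ) (x y : Fin 3) :
    (kekMat w θ * kekMat w' θ) (Sum.inr x) (Sum.inr y) =
      ∑ k, star (kekBlock w θ k x) * kekBlock w' θ k y := by
  rw [kekMat, kekMat, fromBlocks_multiply, fromBlocks_apply₂₂, zero_mul, add_zero, mul_apply]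
  rfl

theorem kekMat_sq_diag (w : Fin 3 → ℝ) (θ : ℝ × ℝ) (i : Fin 3 ⊕ Fin 3) :
    (kekMat w θ ^ 2) i i = ((w 0 ^ 2 + w 1 ^ 2 + w 2 ^ 2 : ℝ) : ℂ) := by
  have hp := phase_mul_star θ (-1, 0)
  have hq := phase_mul_star θ (1, 1)
  have hr := phase_mul_star θ (0, -1)
  rw [RCLike.star_def] at hp hq hr
  rw [sq]
  rcases i with i | i
  · rw [kekMat_mul_apply_inl]
    fin_cases i <;> simp [kekBlock, Fin.sum_univ_three]
    · linear_combination (w 2 : ℂ) ^ 2 * hp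
    · linear_combination (w 2 : ℂ) ^ 2 * hq
    · linear_combination (w 2 : ℂ) ^ 2 * hr
  · rw [kekMat_mul_apply_inr]
    fin_cases i <;> simp [kekBlock, Fin.sum_univ_three]
    · linear_combination (w 2 : ℂ) ^ 2 * hr
    · linear_combination (w 2 : ℂ) ^ 2 * hp
    · linear_combination (w 2 : ℂ) ^ 2 * hq

theorem norm_sq_kekMat_sq_apply (w : Fin 3 → ℝ) (θ : ℝ × ℝ) :
    ‖(kekMat w θ ^ 2) (Sum.inl 0) (Sum.inl 1)‖ ^ 2 =
      ((w 0 * w 1) ^ 2 + (w 0 * w 2) ^ 2 + (w 1 * w 2) ^ 2) +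
      (2 * w 0 ^ 2 * w 1 * w 2) * Real.cos θ.1 + (2 * w 0 * w 1 * w 2 ^ 2) * Real.cos θ.2 +
      (2 * w 0 * w 1 ^ 2 * w 2) * Real.cos (θ.1 + θ.2) := by
  have e : (kekMat w θ ^ 2) (Sum.inl 0) (Sum.inl 1) =
      w 0 * w 1 + w 2 * phase θ (-1, 0) * w 0 + w 1 * (w 2 * star (phase θ (1, 1))) := by
    rw [sq, kekMat_mul_apply_inl]
    simp [kekBlock, Fin.sum_univ_three]
  have h2 : Real.cos θ.2 = Real.cos (θ.1 + θ.2) * Real.cos θ.1 +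
      Real.sin (θ.1 + θ.2) * Real.sin θ.1 := by
    rw [← Real.cos_sub]; congr 1; ring
  have s1 := Real.sin_sq_add_cos_sq θ.1
  have s2 := Real.sin_sq_add_cos_sq (θ.1 + θ.2)
  rw [e, phase_neg_one_zero, phase_one_one_eq, ← Complex.normSq_eq_norm_sq, Complex.normSq_apply, h2]
  simp only [RCLike.star_def, Complex.add_re, Complex.add_im, Complex.mul_re, Complex.mul_im,
    Complex.ofReal_re, Complex.ofReal_im, Complex.conj_re, Complex.conj_im]
  linear_combination ((w 0 * w 2) ^ 2) * s1 + ((w 1 * w 2) ^ 2) * s2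

theorem abs_sum_le_two_mul {w : Fin 3 → ℝ} {ρ : ℝ} (hρ : 0 ≤ ρ)
    (h : w 0 ^ 2 + w 1 ^ 2 + w 2 ^ 2 = ρ ^ 2) : |w 0| + |w 1| + |w 2| ≤ 2 * ρ := by
  refine abs_le_of_sq_le_sq' ?_ (by linarith) |>.2
  nlinarith [sq_abs (w 0), sq_abs (w 1), sq_abs (w 2), sq_nonneg (|w 0| - |w 1|),
    sq_nonneg (|w 0| - |w 2|), sq_nonneg (|w 1| - |w 2|), sq_nonneg ρ]

theorem kekTrace_le {w : Fin 3 → ℝ} {ρ : ℝ} (hρ : 0 < ρ)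
    (h : w 0 ^ 2 + w 1 ^ 2 + w 2 ^ 2 = ρ ^ 2) :
    kekTrace w ≤
      ρ - ((w 0 * w 1) ^ 2 + (w 0 * w 2) ^ 2 + (w 1 * w 2) ^ 2) / (384 * ρ ^ 3) := by
  have key : ∀ θ, (matAbs (kekMat w θ)).trace.re ≤ 6 * ρ -
      1 / (64 * ρ ^ 3) * ‖(kekMat w θ ^ 2) (Sum.inl 0) (Sum.inl 1)‖ ^ 2 := by
    intro θ
    have hH := isHermitian_kekMat w θ
    have h1 := trace_le_of_diagonal (posSemidef_matAbs (M := kekMat w θ)).1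
      (K := 2 * ρ) (by linarith)
      (opBound_matAbs_kekMat w θ (abs_sum_le_two_mul hρ.le h)) (l := fun _ => ρ) (fun _ => hρ)
      (fun _ => by linarith)
    have h2 := norm_sq_le_frob (matAbs (kekMat w θ) ^ 2 -
      (diagonal fun _ : Fin 3 ⊕ Fin 3 => (ρ : ℂ)) ^ 2) (Sum.inl 0) (Sum.inl 1)
    rw [Matrix.sub_apply, diagonal_pow, diagonal_apply_ne _ (by simp), sub_zero, ← diagonal_pow,
      matAbs_sq hH] at h2
    rw [matAbs_sq hH] at h1
    simp only [kekMat_sq_diag, h] at h1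
    have h3 : ∀ x : ℝ, 0 ≤ x → x / (8 * (2 * ρ) ^ 3) = 1 / (64 * ρ ^ 3) * x := fun x _ => by
      field_simp; ring
    rw [h3 _ (frob_nonneg _)] at h1
    have h4 := mul_le_mul_of_nonneg_left h2 (show 0 ≤ 1 / (64 * ρ ^ 3) by positivity)
    simp at h1 h4 ⊢
    linarith
  simp only [norm_sq_kekMat_sq_apply] at key
  have hi : Continuous fun θ : ℝ × ℝ =>
      ((w 0 * w 1) ^ 2 + (w 0 * w 2) ^ 2 + (w 1 * w 2) ^ 2) +
      (2 * w 0 ^ 2 * w 1 * w 2) * Real.cos θ.1 + (2 * w 0 * w 1 * w 2 ^ 2) * Real.cos θ.2 +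
      (2 * w 0 * w 1 ^ 2 * w 2) * Real.cos (θ.1 + θ.2) := by fun_prop
  have h5 := integral_mono (integrable_trace_matAbs_kekMat w)
    (Continuous.integrable_bz (by fun_prop)) key
  rw [integral_sub (integrable_const _) (hi.integrable_bz.const_mul _),
    integral_const_mul (1 / (64 * ρ ^ 3)), integral_cos_combination] at h5
  simp only [integral_const, probReal_univ, one_smul] at h5
  rw [kekTrace_eq]
  have h6 : ∀ x : ℝ, x / (384 * ρ ^ 3) = 1 / 6 * (1 / (64 * ρ ^ 3) * x) := fun x => by
    field_simp; ring
  rw [h6]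
  linarith

/-! ### Splitting the two weak amplitudes does not pay -/

theorem trace_kekMat_diff_sq (θ : ℝ × ℝ) : (kekMat ![1, -1, 0] θ ^ 2).trace.re = 12 := by
  have h : (![1, -1, 0] : Fin 3 → ℝ) 0 ^ 2 + (![1, -1, 0] : Fin 3 → ℝ) 1 ^ 2 +
      (![1, -1, 0] : Fin 3 → ℝ) 2 ^ 2 = 2 := by
    simp only [cons_val_zero, cons_val_one, cons_val]
    norm_num
  simp only [trace, diag_apply, kekMat_sq_diag, h]
  norm_num

theorem norm_sq_kekMat_anticomm_apply (m v : ℝ) (θ : ℝ × ℝ) :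
    ‖(kekMat ![m, m, v] θ * kekMat ![1, -1, 0] θ + kekMat ![1, -1, 0] θ * kekMat ![m, m, v] θ)
      (Sum.inl 0) (Sum.inl 1)‖ ^ 2 = 2 * v ^ 2 - 2 * v ^ 2 * Real.cos θ.2 := by
  have e : (kekMat ![m, m, v] θ * kekMat ![1, -1, 0] θ +
      kekMat ![1, -1, 0] θ * kekMat ![m, m, v] θ) (Sum.inl 0) (Sum.inl 1) =
      v * (phase θ (-1, 0) - star (phase θ (1, 1))) := by
    rw [Matrix.add_apply, kekMat_mul_apply_inl, kekMat_mul_apply_inl]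
    simp [kekBlock, Fin.sum_univ_three]
    ring
  have h2 : Real.cos θ.2 = Real.cos (θ.1 + θ.2) * Real.cos θ.1 +
      Real.sin (θ.1 + θ.2) * Real.sin θ.1 := by
    rw [← Real.cos_sub]; congr 1; ring
  have s1 := Real.sin_sq_add_cos_sq θ.1
  have s2 := Real.sin_sq_add_cos_sq (θ.1 + θ.2)
  rw [e, phase_neg_one_zero, phase_one_one_eq, ← Complex.normSq_eq_norm_sq, Complex.normSq_apply, h2]
  simp only [RCLike.star_def, Complex.sub_re, Complex.sub_im, Complex.mul_re, Complex.mul_im,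
    Complex.ofReal_re, Complex.ofReal_im, Complex.conj_re, Complex.conj_im]
  linear_combination v ^ 2 * s1 + v ^ 2 * s2

theorem trace_matAbs_kekMat_split_le {m d v : ℝ} (h : 2 * |m| < v) (θ : ℝ × ℝ) :
    (matAbs (kekMat ![m + d, m - d, v] θ)).trace.re +
      (matAbs (kekMat ![m - d, m + d, v] θ)).trace.re ≤
    2 * (matAbs (kekMat ![m, m, v] θ)).trace.re + 12 * d ^ 2 / (v - 2 * |m|) -
      d ^ 2 / (4 * (v + 2 * |m| + 2 * |d|) ^ 3) * (2 * v ^ 2 - 2 * v ^ 2 * Real.cos θ.2) := by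
  set F := kekMat ![m, m, v] θ with hF
  set M := kekMat ![1, -1, 0] θ with hM
  set K := v + 2 * |m| + 2 * |d| with hK
  set N := F * M + M * F with hN
  have hv : 0 < v := by linarith [abs_nonneg m]
  have hK0 : 0 < K := by positivity
  have hFH : F.IsHermitian := isHermitian_kekMat _ θ
  have e1 : kekMat ![m + d, m - d, v] θ = F + (d : ℂ) • M := by
    rw [hF, hM, ← kekMat_smul, ← kekMat_add]
    congr 1
    ext i
    fin_cases i <;> simp [sub_eq_add_neg]
  have e2 : kekMat ![m - d, m + d, v] θ = F + ((-d : ℝ) : ℂ) • M := by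
    rw [hF, hM, ← kekMat_smul, ← kekMat_add]
    congr 1
    ext i
    fin_cases i <;> simp [sub_eq_add_neg]
  have sq1 : ∀ c : ℝ, (F + (c : ℂ) • M) ^ 2 - F ^ 2 = (c : ℂ) • N + ((c ^ 2 : ℝ) : ℂ) • M ^ 2 := by
    intro c
    simp only [hN, sq, add_mul, mul_add, smul_mul_assoc, mul_smul_comm, smul_smul, smul_add]
    push_cast
    abel
  obtain ⟨f, hf, hQ⟩ := exists_trace_le (posSemidef_matAbs (M := F)) (r := v - 2 * |m|) (K := K)
    (by linarith) (fun φ => by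
      rw [vecSq_matAbs_mulVec hFH, ← vecNorm_sq, ← vecNorm_sq, ← mul_pow]
      refine pow_le_pow_left₀ (mul_nonneg (by linarith) (vecNorm_nonneg _)) ?_ 2
      have := le_vecNorm_kekMat ![m, m, v] θ φ
      simp only [cons_val_zero, cons_val_one, cons_val, abs_of_pos hv] at this
      linarith)
    (opBound_matAbs_kekMat _ θ (by
      simp only [cons_val_zero, cons_val_one, cons_val, abs_of_pos hv]
      linarith [abs_nonneg d])) hK0
  have b1 := hQ _ (posSemidef_matAbs (M := kekMat ![m + d, m - d, v] θ)).1
    (opBound_matAbs_kekMat _ θ (by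
      simp only [cons_val_zero, cons_val_one, cons_val, abs_of_pos hv]
      linarith [abs_add_le m d, abs_sub m d]))
  have b2 := hQ _ (posSemidef_matAbs (M := kekMat ![m - d, m + d, v] θ)).1
    (opBound_matAbs_kekMat _ θ (by
      simp only [cons_val_zero, cons_val_one, cons_val, abs_of_pos hv]
      linarith [abs_add_le m d, abs_sub m d]))
  rw [matAbs_sq (isHermitian_kekMat _ θ), matAbs_sq hFH, e1, sq1] at b1
  rw [matAbs_sq (isHermitian_kekMat _ θ), matAbs_sq hFH, e2, sq1] at b2
  rw [e1, e2, Complex.ofReal_neg, neg_smul]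
  have hfM := hf (M ^ 2) (posSemidef_sq (isHermitian_kekMat _ θ))
  rw [trace_kekMat_diff_sq] at hfM
  have hpar := frob_parallelogram ((d : ℂ) • N) (((d ^ 2 : ℝ) : ℂ) • M ^ 2)
  have hN2 := norm_sq_le_frob N (Sum.inl 0) (Sum.inl 1)
  rw [norm_sq_kekMat_anticomm_apply] at hN2
  rw [frob_smul] at hpar
  have hf0 := frob_nonneg (((d ^ 2 : ℝ) : ℂ) • M ^ 2)
  have hfs : ∀ c : ℝ, f ((c : ℂ) • M ^ 2) = c * f (M ^ 2) := fun c => by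
    rw [← smul_eq_mul, ← map_smul]
    congr 1
  rw [map_add, hfs] at b1 b2
  rw [Complex.ofReal_neg, neg_smul, neg_smul, map_neg, neg_sq] at b2
  have h3 : d ^ 2 * (12 / (v - 2 * |m|)) = 12 * d ^ 2 / (v - 2 * |m|) := by ring
  have h4 := mul_le_mul_of_nonneg_left hfM (sq_nonneg d)
  have h5 : d ^ 2 / (4 * K ^ 3) * (2 * v ^ 2 - 2 * v ^ 2 * Real.cos θ.2) ≤
      (frob ((d : ℂ) • N + ((d ^ 2 : ℝ) : ℂ) • M ^ 2) +
        frob (-((d : ℂ) • N) + ((d ^ 2 : ℝ) : ℂ) • M ^ 2)) / (8 * K ^ 3) := by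
    rw [hpar, le_div_iff₀ (by positivity)]
    have h6 : d ^ 2 / (4 * K ^ 3) * (2 * v ^ 2 - 2 * v ^ 2 * Real.cos θ.2) * (8 * K ^ 3) =
        2 * (d ^ 2 * (2 * v ^ 2 - 2 * v ^ 2 * Real.cos θ.2)) := by
      field_simp
      ring
    rw [h6]
    nlinarith [mul_le_mul_of_nonneg_left hN2 (sq_nonneg d)]
  rw [add_div] at h5
  linarith

theorem kekTrace_split_le {m d v : ℝ} (h : 2 * |m| < v) :
    kekTrace ![m + d, m - d, v] ≤ kekTrace ![m, m, v] + d ^ 2 / (v - 2 * |m|) -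
      d ^ 2 * v ^ 2 / (24 * (v + 2 * |m| + 2 * |d|) ^ 3) := by
  have hswap : kekTrace ![m - d, m + d, v] = kekTrace ![m + d, m - d, v] := by
    rw [← kekTrace_comp_perm _ (Equiv.swap 0 1)]
    congr 1
    ext i
    fin_cases i <;> simp [Equiv.swap_apply_def]
  have i1 := integrable_trace_matAbs_kekMat ![m + d, m - d, v]
  have i2 := integrable_trace_matAbs_kekMat ![m - d, m + d, v]
  have i3 := integrable_trace_matAbs_kekMat ![m, m, v]
  set c := d ^ 2 / (4 * (v + 2 * |m| + 2 * |d|) ^ 3) with hc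
  have i4 : Integrable (fun k : ℝ × ℝ => 12 * d ^ 2 / (v - 2 * |m|) - c * (2 * v ^ 2 + 0 * Real.cos k.1 +
      (-(2 * v ^ 2)) * Real.cos k.2 + 0 * Real.cos (k.1 + k.2))) bz :=
    Continuous.integrable_bz (by fun_prop)
  have key := integral_mono (i1.add i2) ((i3.const_mul 2).add i4) fun θ => by
    have := trace_matAbs_kekMat_split_le (d := d) h θ
    simp only [Pi.add_apply, zero_mul, add_zero]
    linarith
  simp only [Pi.add_apply] at key
  rw [integral_add i1 i2, integral_add (i3.const_mul 2) i4, integral_const_mul,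
    integral_sub (Continuous.integrable_bz (by fun_prop))
      (Continuous.integrable_bz (by fun_prop)),
    integral_const_mul c, integral_cos_combination] at key
  simp only [integral_const, probReal_univ, one_smul] at key
  have e1 := kekTrace_eq ![m + d, m - d, v]
  have e2 := kekTrace_eq ![m - d, m + d, v]
  have e3 := kekTrace_eq ![m, m, v]
  have e4 : d ^ 2 * v ^ 2 / (24 * (v + 2 * |m| + 2 * |d|) ^ 3) = 1 / 12 * (c * (2 * v ^ 2)) := by
    rw [hc]
    have : 0 < v + 2 * |m| + 2 * |d| := by
      have := abs_nonneg m
      have := abs_nonneg d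
      linarith
    field_simp
    ring
  have e5 : 12 * d ^ 2 / (v - 2 * |m|) = 12 * (d ^ 2 / (v - 2 * |m|)) := by ring
  linarith

end KekuleBounds

end Graphene
end

noncomputable section

namespace Graphene

/-! ### Minimizers at small rigidity -/

theorem kekuleEnergy_eq (μ : ℝ) (w : Fin 3 → ℝ) : kekuleEnergy μ w = -kekTrace w +
    μ / 4 * (w 0 ^ 2 + w 1 ^ 2 + w 2 ^ 2 - 2 * (w 0 + w 1 + w 2) + 3) := by
  rw [kekuleEnergy, kekTrace]
  ring

theorem kekuleEnergy_comp_perm (μ : ℝ) (w : Fin 3 → ℝ) (σ : Equiv.Perm (Fin 3)) :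
    kekuleEnergy μ (w ∘ σ) = kekuleEnergy μ w := by
  have h2 := Equiv.sum_comp σ fun i => w i ^ 2
  have h1 := Equiv.sum_comp σ w
  rw [Fin.sum_univ_three, Fin.sum_univ_three] at h1 h2
  simp only [kekuleEnergy_eq, kekTrace_comp_perm, Function.comp_apply, h1, h2]

theorem kekTrace_zero : kekTrace 0 = 0 := by
  simpa using kekTrace_smul 0 0

theorem exists_isMinOn_kekuleEnergy {μ : ℝ} (hμ : 0 < μ) :
    ∃ w, IsMinOn (kekuleEnergy μ) univ w := by
  have hc : Continuous (kekuleEnergy μ) := by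
    have h : kekuleEnergy μ = fun w => -kekTrace w +
        μ / 4 * (w 0 ^ 2 + w 1 ^ 2 + w 2 ^ 2 - 2 * (w 0 + w 1 + w 2) + 3) :=
      funext (kekuleEnergy_eq μ)
    rw [h]
    exact continuous_kekTrace.neg.add (by fun_prop)
  obtain ⟨w, hw⟩ := hc.exists_forall_le' 0 (by
    filter_upwards [(isCompact_closedBall (0 : Fin 3 → ℝ) (4 + 4 / μ)).compl_mem_cocompact]
      with w hw
    set ρ := √(w 0 ^ 2 + w 1 ^ 2 + w 2 ^ 2) with hρ
    have hρ2 : w 0 ^ 2 + w 1 ^ 2 + w 2 ^ 2 = ρ ^ 2 := (Real.sq_sqrt (by positivity)).symm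
    have hρ0 : 0 ≤ ρ := Real.sqrt_nonneg _
    have hlt : 4 + 4 / μ < ρ := by
      by_contra! hle
      refine hw (mem_closedBall_zero_iff.2 ((pi_norm_le_iff_of_nonneg (by positivity)).2 fun i => ?_))
      refine (abs_le_of_sq_le_sq ?_ hρ0).trans hle
      rw [← hρ2]
      fin_cases i <;> simp <;> nlinarith [sq_nonneg (w 0), sq_nonneg (w 1), sq_nonneg (w 2)]
    have hρpos : 0 < ρ := lt_trans (by positivity) hlt
    have h1 := kekTrace_le hρpos hρ2
    have h2 : 0 ≤ ((w 0 * w 1) ^ 2 + (w 0 * w 2) ^ 2 + (w 1 * w 2) ^ 2) / (384 * ρ ^ 3) := by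
      positivity
    have h3 := abs_sum_le_two_mul hρ0 hρ2
    have h4 : w 0 + w 1 + w 2 ≤ 2 * ρ := by
      linarith [le_abs_self (w 0), le_abs_self (w 1), le_abs_self (w 2)]
    have h5 : 4 ≤ μ * (ρ - 4) := by
      have : μ * (4 / μ) = 4 := by field_simp
      nlinarith
    rw [kekuleEnergy_eq, kekuleEnergy_eq, hρ2, kekTrace_zero]
    simp only [Pi.zero_apply]
    nlinarith [mul_le_mul_of_nonneg_left h4 hμ.le, mul_le_mul_of_nonneg_right h5 hρ0])
  exact ⟨w, fun w' _ => hw w'⟩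

theorem eq_zero_of_forall_linear_add_sq_nonneg {A B : ℝ}
    (h : ∀ x : ℝ, -1 ≤ x → 0 ≤ x * A + B * x ^ 2) : A = 0 := by
  by_contra hA
  have hD : 0 < |A| + |B| + 1 := by positivity
  have h1 := h (-A / (|A| + |B| + 1)) (by
    rw [le_div_iff₀ hD]
    linarith [le_abs_self A, abs_nonneg B])
  have h2 : -A / (|A| + |B| + 1) * A + B * (-A / (|A| + |B| + 1)) ^ 2 =
      A ^ 2 * (B - (|A| + |B| + 1)) / (|A| + |B| + 1) ^ 2 := by
    field_simp
    ring
  rw [h2] at h1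
  have h3 : A ^ 2 * (B - (|A| + |B| + 1)) / (|A| + |B| + 1) ^ 2 < 0 :=
    div_neg_of_neg_of_pos (mul_neg_of_pos_of_neg (by positivity)
      (by linarith [le_abs_self B, abs_pos.2 hA])) (by positivity)
  linarith

theorem kekTrace_of_isMinOn {μ : ℝ} {w : Fin 3 → ℝ} (hw : IsMinOn (kekuleEnergy μ) univ w) :
    kekTrace w = μ / 2 * (w 0 ^ 2 + w 1 ^ 2 + w 2 ^ 2 - (w 0 + w 1 + w 2)) := by
  have h : -kekTrace w + μ / 2 * (w 0 ^ 2 + w 1 ^ 2 + w 2 ^ 2 - (w 0 + w 1 + w 2)) = 0 := by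
    refine eq_zero_of_forall_linear_add_sq_nonneg
      (B := μ / 4 * (w 0 ^ 2 + w 1 ^ 2 + w 2 ^ 2)) fun x hx => ?_
    have h1 : kekuleEnergy μ w ≤ kekuleEnergy μ ((1 + x) • w) := hw (mem_univ _)
    rw [kekuleEnergy_eq, kekuleEnergy_eq, kekTrace_smul, abs_of_nonneg (by linarith)] at h1
    simp only [Pi.smul_apply, smul_eq_mul] at h1
    linarith
  linarith

/-- A minimizer at small rigidity has Euclidean norm at least `2 / μ`, and its largest amplitude is
positive and dominates the others. -/
theorem isMinOn_kekuleEnergy_bounds {μ : ℝ} (hμ : 0 < μ) (hμc : 576 * μ < 1 / 10 ^ 6)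
    {w : Fin 3 → ℝ} (hw : IsMinOn (kekuleEnergy μ) univ w) (h0 : |w 0| ≤ |w 2|)
    (h1 : |w 1| ≤ |w 2|) :
    ∃ ρ : ℝ, 0 < ρ ∧ 2 ≤ μ * ρ ∧ |w 0| ≤ ρ / 1000 ∧ |w 1| ≤ ρ / 1000 ∧ 998 / 1000 * ρ ≤ w 2 := by
  set ρ := √(w 0 ^ 2 + w 1 ^ 2 + w 2 ^ 2) with hρ
  have hρ2 : w 0 ^ 2 + w 1 ^ 2 + w 2 ^ 2 = ρ ^ 2 := (Real.sq_sqrt (by positivity)).symm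
  have hρ0 : 0 ≤ ρ := Real.sqrt_nonneg _
  have hg := kekTrace_of_isMinOn hw
  have hle : kekuleEnergy μ w ≤ kekuleEnergy μ ((1 + 2 / μ) • Pi.single 2 1) := hw (mem_univ _)
  rw [kekuleEnergy_eq, kekuleEnergy_eq, kekTrace_smul, kekTrace_single, hg, hρ2,
    abs_of_nonneg (by positivity)] at hle
  have z0 : (Pi.single 2 1 : Fin 3 → ℝ) 0 = 0 := by simp
  have z1 : (Pi.single 2 1 : Fin 3 → ℝ) 1 = 0 := by simp
  simp only [Pi.smul_apply, smul_eq_mul, z0, z1, Pi.single_eq_same] at hle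
  have hρge : 1 + 2 / μ ≤ ρ := by
    refine abs_le_of_sq_le_sq' ?_ hρ0 |>.2
    set x := 2 / μ with hx
    have hμx : μ * x = 2 := by rw [hx]; field_simp
    have hx2 : μ * x ^ 2 = 2 * x := by rw [sq, ← mul_assoc, hμx]
    refine le_of_mul_le_mul_left ?_ hμ
    linarith
  have hμρ : 2 + μ ≤ μ * ρ := by
    have := mul_le_mul_of_nonneg_left hρge hμ.le
    have e : μ * (1 + 2 / μ) = 2 + μ := by field_simp; ring
    linarith
  have hρpos : 0 < ρ := lt_of_lt_of_le (by positivity) hρge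
  have hk := kekTrace_le hρpos hρ2
  set s := w 0 + w 1 + w 2 with hs
  set e := (w 0 * w 1) ^ 2 + (w 0 * w 2) ^ 2 + (w 1 * w 2) ^ 2 with he
  have he0 : 0 ≤ e := by positivity
  have hs2 : s ≤ 2 * ρ := by
    have := abs_sum_le_two_mul hρ0 hρ2
    linarith [le_abs_self (w 0), le_abs_self (w 1), le_abs_self (w 2)]
  rw [hg, hρ2] at hk
  have hes : e / (384 * ρ ^ 3) ≤ μ / 2 * (s - ρ) := by
    nlinarith [mul_le_mul_of_nonneg_right hμρ hρ0]
  have hsρ : ρ ≤ s := by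
    have : 0 ≤ μ / 2 * (s - ρ) := le_trans (by positivity) hes
    by_contra! hlt
    linarith [mul_neg_of_pos_of_neg (half_pos hμ) (sub_neg.2 hlt)]
  have he4 : e ≤ 192 * μ * ρ ^ 4 := by
    rw [div_le_iff₀ (by positivity)] at hes
    have : μ / 2 * (s - ρ) * (384 * ρ ^ 3) ≤ μ / 2 * ρ * (384 * ρ ^ 3) := by
      gcongr
      linarith
    linarith
  have h0' := sq_le_sq.2 h0
  have h1' := sq_le_sq.2 h1
  have hsmall : w 0 ^ 2 + w 1 ^ 2 ≤ (ρ / 1000) ^ 2 := by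
    have hv : ρ ^ 2 ≤ 3 * w 2 ^ 2 := by linarith
    have a1 : (w 0 ^ 2 + w 1 ^ 2) * ρ ^ 2 ≤ 3 * e := by
      nlinarith [mul_le_mul_of_nonneg_left hv (show 0 ≤ w 0 ^ 2 + w 1 ^ 2 by positivity),
        sq_nonneg (w 0 * w 1)]
    have a2 : (w 0 ^ 2 + w 1 ^ 2) * ρ ^ 2 ≤ (ρ / 1000) ^ 2 * ρ ^ 2 := by
      have : 576 * μ * ρ ^ 4 ≤ 1 / 10 ^ 6 * ρ ^ 4 := by gcongr
      linarith
    exact le_of_mul_le_mul_right a2 (by positivity)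
  have a0 : |w 0| ≤ ρ / 1000 :=
    abs_le_of_sq_le_sq (by linarith [sq_nonneg (w 1)]) (by positivity)
  have a1 : |w 1| ≤ ρ / 1000 :=
    abs_le_of_sq_le_sq (by linarith [sq_nonneg (w 0)]) (by positivity)
  refine ⟨ρ, hρpos, by linarith, a0, a1, ?_⟩
  linarith [le_abs_self (w 0), le_abs_self (w 1)]

theorem eq_of_isMinOn_kekuleEnergy {μ ρ : ℝ} (hρ : 0 < ρ) (hμρ : 2 ≤ μ * ρ) {w : Fin 3 → ℝ}
    (hw : IsMinOn (kekuleEnergy μ) univ w) (h0 : |w 0| ≤ ρ / 1000) (h1 : |w 1| ≤ ρ / 1000)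
    (h2 : 998 / 1000 * ρ ≤ w 2) : w 0 = w 1 := by
  obtain ⟨m, hm⟩ : ∃ m, m = (w 0 + w 1) / 2 := ⟨_, rfl⟩
  obtain ⟨d, hd⟩ : ∃ d, d = (w 0 - w 1) / 2 := ⟨_, rfl⟩
  obtain ⟨v, hv⟩ : ∃ v, v = w 2 := ⟨_, rfl⟩
  have ew : w = ![m + d, m - d, v] := by
    ext i
    fin_cases i <;> simp [hm, hd, hv] <;> ring
  have hm' : |m| ≤ ρ / 1000 := by
    rw [abs_le] at h0 h1 ⊢
    constructor <;> linarith
  have hd' : |d| ≤ ρ / 1000 := by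
    rw [abs_le] at h0 h1 ⊢
    constructor <;> linarith
  rw [← hv] at h2
  have hv0 : 0 < v := by linarith
  by_contra hne
  have hd0 : 0 < d ^ 2 := by
    have : d ≠ 0 := fun h => hne (by linarith)
    positivity
  have hmin : kekuleEnergy μ w ≤ kekuleEnergy μ ![m, m, v] := hw (mem_univ _)
  have hsplit := kekTrace_split_le (m := m) (d := d) (v := v) (by linarith)
  rw [ew, kekuleEnergy_eq, kekuleEnergy_eq] at hmin
  simp only [Matrix.cons_val_zero, Matrix.cons_val_one, Matrix.cons_val] at hmin
  have hr : 994 / 1000 * v ≤ v - 2 * |m| := by linarith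
  have hK : v + 2 * |m| + 2 * |d| ≤ 1005 / 1000 * v := by linarith
  have b1 : d ^ 2 / (v - 2 * |m|) ≤ d ^ 2 / (994 / 1000 * v) := by gcongr
  have b2 : d ^ 2 * v ^ 2 / (24 * (1005 / 1000 * v) ^ 3) ≤
      d ^ 2 * v ^ 2 / (24 * (v + 2 * |m| + 2 * |d|) ^ 3) := by gcongr
  have b3 : d ^ 2 / (994 / 1000 * v) = 1000 / 994 * (d ^ 2 / v) := by field_simp
  have b4 : d ^ 2 * v ^ 2 / (24 * (1005 / 1000 * v) ^ 3) =
      1 / (24 * (1005 / 1000) ^ 3) * (d ^ 2 / v) := by field_simp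
  have b5 : μ * d ^ 2 / 2 ≤ 1000 / 994 * (d ^ 2 / v) - 1 / (24 * (1005 / 1000) ^ 3) * (d ^ 2 / v) := by
    linarith
  have b6 : 998 / 1000 * (d ^ 2 / v) ≤ μ * d ^ 2 / 2 := by
    have hμ : 0 < μ := pos_of_mul_pos_left (by linarith : 0 < μ * ρ) hρ.le
    have : 1996 / 1000 ≤ μ * v := by nlinarith [mul_le_mul_of_nonneg_left h2 hμ.le]
    have e : μ * d ^ 2 / 2 = μ * v / 2 * (d ^ 2 / v) := by field_simp
    rw [e]
    exact mul_le_mul_of_nonneg_right (by linarith) (by positivity)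
  have b7 : 0 < d ^ 2 / v := by positivity
  norm_num at b5
  linarith

theorem kekule_distorted_and_gapped {μ : ℝ} (hμ : 0 < μ) (hμc : 576 * μ < 1 / 10 ^ 6)
    {w : Fin 3 → ℝ} (hw : IsMinOn (kekuleEnergy μ) univ w) :
    (∃ σ : Equiv.Perm (Fin 3), w (σ 0) = w (σ 1) ∧ w (σ 1) < w (σ 2)) ∧
      (0 : ℂ) ∉ spectrum ℂ (kekuleOperator w) := by
  obtain ⟨k, hk⟩ := Finite.exists_max fun i => |w i|
  set σ : Equiv.Perm (Fin 3) := Equiv.swap 2 k with hσ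
  have hσ2 : σ 2 = k := Equiv.swap_apply_left 2 k
  have hwσ : IsMinOn (kekuleEnergy μ) univ (w ∘ σ) := fun w' hw' => by
    change kekuleEnergy μ (w ∘ σ) ≤ kekuleEnergy μ w'
    rw [kekuleEnergy_comp_perm]
    exact hw hw'
  obtain ⟨ρ, hρ, hμρ, h0, h1, h2⟩ := isMinOn_kekuleEnergy_bounds hμ hμc hwσ
    (by simpa [hσ2] using hk _) (by simpa [hσ2] using hk _)
  have he := eq_of_isMinOn_kekuleEnergy hρ hμρ hwσ h0 h1 h2
  simp only [Function.comp_apply] at h0 h1 h2 he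
  refine ⟨⟨σ, he, by linarith [le_abs_self (w (σ 1))]⟩, ?_⟩
  have h2' := le_abs_self (w (σ 2))
  refine zero_notMem_spectrum_kekuleOperator (l := σ 2) (fun i hi => ?_) (by linarith)
  obtain ⟨j, rfl⟩ := σ.surjective i
  fin_cases j
  · simp at *; linarith
  · simp at *; linarith
  · exact absurd rfl hi

end Graphene

end

theorem theorem2 :
    ∃ μc μc' : ℝ, 0 < μc ∧ μc ≤ μc' ∧
      (∀ μ : ℝ, 0 < μ → μ < μc →
        (∃ w : Fin 3 → ℝ, IsMinOn (Graphene.kekuleEnergy μ) Set.univ w) ∧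
        ∀ w : Fin 3 → ℝ, IsMinOn (Graphene.kekuleEnergy μ) Set.univ w →
          (∃ σ : Equiv.Perm (Fin 3), w (σ 0) = w (σ 1) ∧ w (σ 1) < w (σ 2)) ∧
          (0 : ℂ) ∉ spectrum ℂ (Graphene.kekuleOperator w)) ∧
      (∀ μ : ℝ, μc' ≤ μ →
        (∀ w : Fin 3 → ℝ, IsMinOn (Graphene.kekuleEnergy μ) Set.univ w ↔
          w = fun _ => Graphene.tStar μ) ∧
        (0 : ℂ) ∈ spectrum ℂ (Graphene.kekuleOperator fun _ => Graphene.tStar μ) ∧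
        ∀ L : ℕ, 1 ≤ L → ∀ τ : Graphene.Config,
          (Graphene.IsPeriodic L τ ∧
            IsMinOn (Graphene.energy μ L) {τ' | Graphene.IsPeriodic L τ'} τ) ↔
          τ = fun _ _ => Graphene.tStar μ) := by
  refine ⟨1 / (576 * 10 ^ 6), max (1 / (576 * 10 ^ 6)) (6 * Graphene.meanInvDisp + 1),
    by norm_num, le_max_left _ _, fun μ h0 h1 => ⟨Graphene.exists_isMinOn_kekuleEnergy h0,
      fun w hw => Graphene.kekule_distorted_and_gapped h0 (by linarith) hw⟩, fun μ hμ => ?_⟩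
  have h : 6 * Graphene.meanInvDisp < μ := by linarith [(le_max_right _ _).trans hμ]
  exact ⟨Graphene.isMinOn_kekuleEnergy_iff h, Graphene.zero_mem_spectrum_kekuleOperator_const _,
    fun L hL τ => Graphene.isMinOn_energy_iff h hL τ⟩
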